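/- Let $\mathsf{RCA}_0^\omega$ be Kohlenbach's base theory of higher-order Reverse Mathematics, in the language of all finite types: the axioms of an ordered semi-ring for $0,1,+,\times,<$ on the numbers, the defining axioms of the combinators $K,S$ and of the recursor $R_0$ of type $0$, the axiom of extensionality, induction for quantifier-free formulas, and the quantifier-free axiom of choice $\mathsf{QF}\text{-}\mathsf{AC}^{1,0}$. As usual, real numbers are fast converging sequences of (coded) rationals, functions $\mathbb R\to\mathbb R$ are functionals of type $1\to1$ mapping reals to reals and respecting $=_{\mathbb R}$, functionals $(\mathbb R\to\mathbb R)\to\mathbb R$ similarly respect equality of functions, and subsets of $\mathbb R$ and $\mathbb R^2$ are given by characteristic functions. Consider Kleene's quantifiers $$(\exists^2):\ (\exists E:\mathbb N^{\mathbb N}\to\mathbb N)(\forall f\in\mathbb N^{\mathbb N})\big(E(f)=0\leftrightarrow(\exists n\in\mathbb N)(f(n)=0)\big),$$ $$(\exists^3):\ (\exists E)(\forall Y:\mathbb N^{\mathbb N}\to\mathbb N)\big(E(Y)=0\leftrightarrow(\exists f\in\mathbb N^{\mathbb N})(Y(f)=0)\big).$$ For a class $\Gamma$ of functions and a property $P$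 of functions $[0,1]\to\mathbb R$, a $P$-decision functional for $\Gamma$ is a functional $\Xi:(\mathbb R\to\mathbb R)\to\mathbb R$ such that for every $f:\mathbb R\to\mathbb R$ whose restriction to $[0,1]$ is in $\Gamma$, $\Xi(f)=0$ if and only if the restriction of $f$ to $[0,1]$ satisfies $P$. **Theorem.** Let $\Gamma$ be any one of the following classes of functions $f:[0,1]\to\mathbb R$, where closures, interiors and neighbourhoods are taken in $[0,1]$ (respectively in $[0,1]\times\mathbb R$): * the Young condition: each $x\in[0,1]$ is the limit of a sequence in $[0,x)$ (if $x>0$) and of a sequence in $(x,1]$ (if $x<1$) along which $f$ converges to $f(x)$; * almost continuity (Husain): for each $x\in[0,1]$ and each open $G\subset\mathbb R$ with $f(x)\in G$, the set $\overline{f^{-1}(G)}$ is a neighbourhood of $x$; * graph continuity: there is a continuous $g:[0,1]\to\mathbb R$ whose graph is contained in the closure of the graph of $f$; * not of Cesàro type: there are no non-empty open $U\subset[0,1]$ and $V\subset\mathbb R$ with $U\subset\overline{f^{-1}(y)}$ for all $y\in V$; * pre-continuity: for each open $G\subset\mathbb R$, $f^{-1}(G)\subset\mathrm{int}\big(\overline{f^{-1}(G)}\big)$.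 Let $P$ be any one of the following properties of $f:[0,1]\to\mathbb R$: * almost continuity (Stallings): for each open $O\subset\mathbb R^2$ containing the graph of $f$ there is a continuous $g:[0,1]\to\mathbb R$ whose graph is contained in $O$; * continuity everywhere on $[0,1]$; * continuity almost everywhere on $[0,1]$: for each $\varepsilon>0$ the points of discontinuity are covered by a sequence of open intervals of total length at most $\varepsilon$; * Riemann integrability on $[0,1]$: for each $k$ there is $N$ such that any two Riemann sums of $f$ for tagged partitions of mesh less than $2^{-N}$ differ by at most $2^{-k}$; * the intermediate value property: for $x<y$ in $[0,1]$ and any $c$ between $f(x)$ and $f(y)$ there is $z\in[x,y]$ with $f(z)=c$. Then, over $\mathsf{RCA}_0^\omega$ (that is, in every model of $\mathsf{RCA}_0^\omega$; equivalently, provably in $\mathsf{RCA}_0^\omega$), the following are equivalent: 1. Kleene's quantifier $(\exists^3)$; 2. Kleene's quantifier $(\exists^2)$ together with the existence of a $P$-decision functional for $\Gamma$. -/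

import Mathlib

universe u

/-! # Higher-order arithmetic: the language of all finite types -/

/-- The finite types: the type `nat` (type `0`), and `arr σ τ` (type `σ → τ`). -/
inductive FinType where
  | nat : FinType
  | arr : FinType → FinType → FinType

namespace FinType

/-- Type `1`, the type of elements of Baire space. -/
abbrev one : FinType := arr nat nat

/-- Type `2`, the type of functionals from Baire space to the numbers. -/
abbrev two : FinType := arr one nat

end FinType

open FinType in
/-- A structure for the language of `RCA₀^ω`: a (possibly non-full) domain for each finite type,
with application, with `0`, `1`, `+`, `×`, `<` on the numbers, the combinators `K` (also written
`Π`) and `S` (also written `Σ`), and the type-`0` recursor `R`. -/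
structure TypeStructure where
  El : FinType → Type u
  app : {σ τ : FinType} → El (arr σ τ) → El σ → El τ
  [semiring : CommSemiring (El nat)]
  [order : LinearOrder (El nat)]
  plus : El (arr nat (arr nat nat))
  times : El (arr nat (arr nat nat))
  K : (σ τ : FinType) → El (arr σ (arr τ σ))
  S : (ρ σ τ : FinType) → El (arr (arr ρ (arr σ τ)) (arr (arr ρ σ) (arr ρ τ)))
  R : El (arr (arr nat (arr nat nat)) (arr nat (arr nat nat)))

namespace TypeStructure

open FinType

attribute [instance] TypeStructure.semiring TypeStructure.order

instance instCoeFunEl {M : TypeStructure.{u}} {σ τ : FinType} :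
    CoeFun (M.El (arr σ τ)) (fun _ => M.El σ → M.El τ) := ⟨M.app⟩

/-- The numbers of the structure (they may be non-standard). -/
abbrev N (M : TypeStructure.{u}) : Type u := M.El nat

/-- Terms of type `σ` with parameters from `M` in two free variables `x` of type `ρ`
and `y` of type `τ`.  (The constants of the language are among the parameters.) -/
inductive Term (M : TypeStructure.{u}) (ρ τ : FinType) : FinType → Type u where
  | x : Term M ρ τ ρ
  | y : Term M ρ τ τ
  | param {σ : FinType} (c : M.El σ) : Term M ρ τ σ
  | app {σ σ' : FinType} (s : Term M ρ τ (arr σ σ')) (t : Term M ρ τ σ) : Term M ρ τ σ'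

/-- The value of a term. -/
def Term.eval {M : TypeStructure.{u}} {ρ τ : FinType} (a : M.El ρ) (b : M.El τ) :
    {σ : FinType} → Term M ρ τ σ → M.El σ
  | _, .x => a
  | _, .y => b
  | _, .param c => c
  | _, .app s t => M.app (s.eval a b) (t.eval a b)

/-- Quantifier-free formulas with parameters from `M` in the variables `x`, `y`; the atomic
formulas are `s =₀ t` and `s <₀ t`. -/
inductive QF (M : TypeStructure.{u}) (ρ τ : FinType) : Type u where
  | eq (s t : Term M ρ τ nat) : QF M ρ τ
  | lt (s t : Term M ρ τ nat) : QF M ρ τ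
  | not (A : QF M ρ τ) : QF M ρ τ
  | and (A B : QF M ρ τ) : QF M ρ τ
  | or (A B : QF M ρ τ) : QF M ρ τ
  | imp (A B : QF M ρ τ) : QF M ρ τ

/-- Truth of a quantifier-free formula. -/
def QF.Holds {M : TypeStructure.{u}} {ρ τ : FinType} : QF M ρ τ → M.El ρ → M.El τ → Prop
  | .eq s t, a, b => s.eval a b = t.eval a b
  | .lt s t, a, b => s.eval a b < t.eval a b
  | .not A, a, b => ¬ A.Holds a b
  | .and A B, a, b => A.Holds a b ∧ B.Holds a b
  | .or A B, a, b => A.Holds a b ∨ B.Holds a b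
  | .imp A B, a, b => A.Holds a b → B.Holds a b

/-- `M` is a model of Kohlenbach's base theory `RCA₀^ω`.  Equality of higher type is
pointwise equality; identifying pointwise equal functionals, which the axiom of extensionality
permits, it becomes the identity, and this is how that axiom is stated in `ext`. -/
structure ModelsRCA0omega (M : TypeStructure.{u}) : Prop where
  /-- `0, 1, +, ×, <` form an ordered semi-ring. -/
  ordered : IsStrictOrderedRing M.N
  plus_eq : ∀ m n : M.N, M.plus m n = m + n
  times_eq : ∀ m n : M.N, M.times m n = m * n
  /-- The axioms of the combinators. -/
  K_eq : ∀ (σ τ : FinType) (a : M.El σ) (b : M.El τ), M.K σ τ a b = a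
  S_eq : ∀ (ρ σ τ : FinType) (a : M.El (arr ρ (arr σ τ))) (b : M.El (arr ρ σ)) (c : M.El ρ),
    M.S ρ σ τ a b c = a c (b c)
  /-- The axioms of the recursor of type `0`. -/
  R_zero : ∀ (f : M.El (arr nat (arr nat nat))) (m : M.N), M.R f m 0 = m
  R_succ : ∀ (f : M.El (arr nat (arr nat nat))) (m n : M.N),
    M.R f m (n + 1) = f n (M.R f m n)
  /-- The axiom of extensionality. -/
  ext : ∀ (σ τ : FinType) (f g : M.El (arr σ τ)), (∀ a : M.El σ, f a = g a) → f = g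
  /-- Induction for quantifier-free formulas. -/
  induction : ∀ (ρ : FinType) (A : QF M ρ nat) (p : M.El ρ), A.Holds p 0 →
    (∀ n : M.N, A.Holds p n → A.Holds p (n + 1)) → ∀ n : M.N, A.Holds p n
  /-- The quantifier-free axiom of choice `QF-AC^{1,0}`. -/
  choice : ∀ A : QF M FinType.one nat, (∀ f : M.El FinType.one, ∃ n : M.N, A.Holds f n) →
    ∃ Φ : M.El FinType.two, ∀ f : M.El FinType.one, A.Holds f (Φ f)

/-! # Kleene's quantifiers -/

/-- Kleene's quantifier `(∃²)`. -/
def KleeneE2 (M : TypeStructure.{u}) : Prop :=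
  ∃ E : M.El FinType.two, ∀ f : M.El FinType.one, E f = 0 ↔ ∃ n : M.N, f n = 0

/-- Kleene's quantifier `(∃³)`. -/
def KleeneE3 (M : TypeStructure.{u}) : Prop :=
  ∃ E : M.El (arr FinType.two nat), ∀ Y : M.El FinType.two,
    E Y = 0 ↔ ∃ f : M.El FinType.one, Y f = 0

/-! # Rational numbers of the structure -/

/-- A fraction `(pos - neg) / den` with entries in the numbers of `M`. -/
structure Frac (M : TypeStructure.{u}) where
  pos : M.N
  neg : M.N
  den : M.N

namespace Frac

variable {M : TypeStructure.{u}}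

instance : Zero (Frac M) := ⟨⟨0, 0, 1⟩⟩

instance : One (Frac M) := ⟨⟨1, 0, 1⟩⟩

instance : Neg (Frac M) := ⟨fun q => ⟨q.neg, q.pos, q.den⟩⟩

instance : Add (Frac M) :=
  ⟨fun q r => ⟨q.pos * r.den + r.pos * q.den, q.neg * r.den + r.neg * q.den, q.den * r.den⟩⟩

instance : Sub (Frac M) := ⟨fun q r => q + -r⟩

instance : Mul (Frac M) :=
  ⟨fun q r => ⟨q.pos * r.pos + q.neg * r.neg, q.pos * r.neg + q.neg * r.pos, q.den * r.den⟩⟩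

/-- `(p - n) / d ≤ (p' - n') / d'`, by cross multiplication (for positive `d`, `d'`). -/
instance : LE (Frac M) :=
  ⟨fun q r => q.pos * r.den + r.neg * q.den ≤ r.pos * q.den + q.neg * r.den⟩

/-- The absolute value of a fraction. -/
def abs (q : Frac M) : Frac M := if q.neg ≤ q.pos then q else -q

end Frac

/-- `2 ^ n` for a number `n` of `M`, by primitive recursion: `2 ^ 0 = 1` and
`2 ^ (n + 1) = 2 ^ n + 2 ^ n`. -/
def pow2 (M : TypeStructure.{u}) (n : M.N) : M.N :=
  M.R (M.K (arr nat nat) nat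
    (M.S nat nat nat M.plus (M.S nat (arr nat nat) nat (M.K nat (arr nat nat)) (M.K nat nat)))) 1 n

/-- The fraction `1 / 2 ^ k`. -/
def eps (M : TypeStructure.{u}) (k : M.N) : Frac M := ⟨1, 0, M.pow2 k⟩

/-- The injective pairing `(a, b) ↦ (a + b)² + a` of numbers. -/
def pair (M : TypeStructure.{u}) (a b : M.N) : M.N := (a + b) * (a + b) + a

/-- The number `c` is a code of the fraction `q`, which has positive denominator. -/
def Codes (M : TypeStructure.{u}) (c : M.N) (q : Frac M) : Prop :=
  0 < q.den ∧ c = M.pair (M.pair q.pos q.neg) q.den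

open Classical in
/-- The rational number coded by `c` (and `0` if `c` is not a code). -/
noncomputable def decode (M : TypeStructure.{u}) (c : M.N) : Frac M :=
  if h : ∃ q : Frac M, M.Codes c q then h.choose else 0

/-! # Sequences of rational numbers and their limits

A real number will be a fast converging sequence of rationals, and sums, differences and
products of reals are formed termwise.  The next three relations compare the limits of two
Cauchy sequences of rationals. -/

/-- `lim v = lim w`. -/
def LimEq {M : TypeStructure.{u}} (v w : M.N → Frac M) : Prop :=
  ∀ k : M.N, ∃ m : M.N, ∀ n : M.N, m ≤ n → (v n - w n).abs ≤ M.eps k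

/-- `lim v ≤ lim w`. -/
def LimLe {M : TypeStructure.{u}} (v w : M.N → Frac M) : Prop :=
  ∀ k : M.N, ∃ m : M.N, ∀ n : M.N, m ≤ n → v n ≤ w n + M.eps k

/-- `lim v < lim w`. -/
def LimLt {M : TypeStructure.{u}} (v w : M.N → Frac M) : Prop :=
  ∃ k : M.N, ∃ m : M.N, ∀ n : M.N, m ≤ n → v n + M.eps k ≤ w n

/-! # Real numbers, real functions and sets of reals of the structure -/

/-- An element of type `1` is a real if it is a sequence of codes of rationals `q₀, q₁, …`
with `|qₙ - qₙ₊ᵢ| ≤ 1 / 2 ^ n` for all `n` and `i`. -/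
def IsReal (M : TypeStructure.{u}) (x : M.El FinType.one) : Prop :=
  (∀ n : M.N, ∃ q : Frac M, M.Codes (x n) q) ∧
    ∀ n i : M.N, (M.decode (x n) - M.decode (x (n + i))).abs ≤ M.eps n

/-- The reals of `M`. -/
def Reals (M : TypeStructure.{u}) : Type u := {x : M.El FinType.one // M.IsReal x}

/-- The sequence of rational approximations of a real. -/
noncomputable def Reals.seq {M : TypeStructure.{u}} (x : M.Reals) : M.N → Frac M :=
  fun n => M.decode (x.1 n)

/-- Equality `=_ℝ` of reals. -/
def Reals.Eq {M : TypeStructure.{u}} (x y : M.Reals) : Prop := LimEq x.seq y.seq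

/-- `x ≤_ℝ y`. -/
def Reals.Le {M : TypeStructure.{u}} (x y : M.Reals) : Prop := LimLe x.seq y.seq

/-- `x <_ℝ y`. -/
def Reals.Lt {M : TypeStructure.{u}} (x y : M.Reals) : Prop := LimLt x.seq y.seq

/-- `|x - y| < 1 / 2 ^ k`. -/
def Reals.Near {M : TypeStructure.{u}} (k : M.N) (x y : M.Reals) : Prop :=
  LimLt (fun n => (x.seq n - y.seq n).abs) (fun _ => M.eps k)

/-- `x ∈ [0, 1]`. -/
def Reals.InUnit {M : TypeStructure.{u}} (x : M.Reals) : Prop :=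
  LimLe (fun _ => 0) x.seq ∧ LimLe x.seq (fun _ => 1)

/-- The functions `ℝ → ℝ` of `M`: elements of type `1 → 1` that map reals to reals and equal
reals to equal reals. -/
structure RealFun (M : TypeStructure.{u}) where
  val : M.El (arr FinType.one FinType.one)
  isReal : ∀ x : M.Reals, M.IsReal (val x.1)
  ext : ∀ x y : M.Reals, x.Eq y →
    Reals.Eq (⟨val x.1, isReal x⟩ : M.Reals) ⟨val y.1, isReal y⟩

/-- The value `f(x)`. -/
def RealFun.at {M : TypeStructure.{u}} (f : M.RealFun) (x : M.Reals) : M.Reals :=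
  ⟨f.val x.1, f.isReal x⟩

/-- The sequences of reals of `M`. -/
structure RealSeq (M : TypeStructure.{u}) where
  val : M.El (arr nat FinType.one)
  isReal : ∀ n : M.N, M.IsReal (val n)

/-- The `n`-th term of a sequence of reals. -/
def RealSeq.at {M : TypeStructure.{u}} (s : M.RealSeq) (n : M.N) : M.Reals :=
  ⟨s.val n, s.isReal n⟩

/-- The subsets of `ℝ` of `M`, given by characteristic functions `ℝ → {0, 1}`. -/
structure RealSet (M : TypeStructure.{u}) where
  val : M.El FinType.two
  zero_or_one : ∀ x : M.Reals, val x.1 = 0 ∨ val x.1 = 1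
  ext : ∀ x y : M.Reals, x.Eq y → val x.1 = val y.1

/-- `x ∈ A`. -/
def RealSet.Mem {M : TypeStructure.{u}} (A : M.RealSet) (x : M.Reals) : Prop := A.val x.1 = 1

/-- `A` is open: with each point it contains a ball around it. -/
def RealSet.IsOpen {M : TypeStructure.{u}} (A : M.RealSet) : Prop :=
  ∀ x : M.Reals, A.Mem x → ∃ k : M.N, ∀ y : M.Reals, y.Near k x → A.Mem y

/-- The subsets of `ℝ²` of `M`, given by characteristic functions `ℝ² → {0, 1}`. -/
structure PlaneSet (M : TypeStructure.{u}) where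
  val : M.El (arr FinType.one FinType.two)
  zero_or_one : ∀ x y : M.Reals, val x.1 y.1 = 0 ∨ val x.1 y.1 = 1
  ext : ∀ x x' y y' : M.Reals, x.Eq x' → y.Eq y' → val x.1 y.1 = val x'.1 y'.1

/-- `(x, y) ∈ O`. -/
def PlaneSet.Mem {M : TypeStructure.{u}} (O : M.PlaneSet) (x y : M.Reals) : Prop :=
  O.val x.1 y.1 = 1

/-- `O` is open: with each point it contains an open square around it. -/
def PlaneSet.IsOpen {M : TypeStructure.{u}} (O : M.PlaneSet) : Prop :=
  ∀ x y : M.Reals, O.Mem x y →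
    ∃ k : M.N, ∀ x' y' : M.Reals, x'.Near k x → y'.Near k y → O.Mem x' y'

/-! # Formulas about sets that need not exist as objects of the structure

Closures, interiors and inverse images need not exist in `M`; the relations `x ∈ closure S` and so
on abbreviate their definitions. -/

/-- `x` is in the closure of `S`. -/
def InClosure {M : TypeStructure.{u}} (S : M.Reals → Prop) (x : M.Reals) : Prop :=
  ∀ k : M.N, ∃ y : M.Reals, S y ∧ y.Near k x

/-- `S` is a neighbourhood of `x` in the space `[0, 1]`, that is, `x` is in the interior of `S`
relative to `[0, 1]`. -/
def IsNbhd {M : TypeStructure.{u}} (S : M.Reals → Prop) (x : M.Reals) : Prop :=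
  ∃ k : M.N, ∀ y : M.Reals, y.InUnit → y.Near k x → S y

/-! # Properties of functions `f : [0, 1] → ℝ`

Each property below only depends on the restriction of `f` to `[0, 1]`. -/

namespace RealFun

variable {M : TypeStructure.{u}}

/-- `f⁻¹(G)`, as a subset of `[0, 1]`. -/
def Preimage (f : M.RealFun) (G : M.RealSet) (x : M.Reals) : Prop := x.InUnit ∧ G.Mem (f.at x)

/-- `f⁻¹(y)`, as a subset of `[0, 1]`. -/
def Fiber (f : M.RealFun) (y x : M.Reals) : Prop := x.InUnit ∧ (f.at x).Eq y

/-- `f : [0, 1] → ℝ` is continuous at `x`. -/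
def ContAt (f : M.RealFun) (x : M.Reals) : Prop :=
  ∀ k : M.N, ∃ m : M.N, ∀ y : M.Reals, y.InUnit → y.Near m x → (f.at y).Near k (f.at x)

/-- `f` is continuous everywhere on `[0, 1]`. -/
def Continuous (f : M.RealFun) : Prop := ∀ x : M.Reals, x.InUnit → f.ContAt x

/-- `(f(sₙ))` converges to `f(x)`, and `(sₙ)` is a sequence in `[0, 1]` with limit `x`. -/
def TendsAlong (f : M.RealFun) (s : M.RealSeq) (x : M.Reals) : Prop :=
  (∀ n : M.N, (s.at n).InUnit) ∧
  (∀ k : M.N, ∃ m : M.N, ∀ n : M.N, m ≤ n → (s.at n).Near k x) ∧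
  ∀ k : M.N, ∃ m : M.N, ∀ n : M.N, m ≤ n → (f.at (s.at n)).Near k (f.at x)

/-- The Young condition: each `x ∈ [0, 1]` is the limit of a sequence from the left (if `x ≠ 0`)
and of a sequence from the right (if `x ≠ 1`) along which `f` tends to `f(x)`. -/
def Young (f : M.RealFun) : Prop :=
  ∀ x : M.Reals, x.InUnit →
    (LimLt (fun _ => 0) x.seq →
      ∃ s : M.RealSeq, (∀ n : M.N, (s.at n).Lt x) ∧ f.TendsAlong s x) ∧
    (LimLt x.seq (fun _ => 1) →
      ∃ s : M.RealSeq, (∀ n : M.N, x.Lt (s.at n)) ∧ f.TendsAlong s x)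

/-- Almost continuity in the sense of Husain. -/
def Husain (f : M.RealFun) : Prop :=
  ∀ x : M.Reals, x.InUnit → ∀ G : M.RealSet, G.IsOpen → G.Mem (f.at x) →
    IsNbhd (InClosure (f.Preimage G)) x

/-- Graph continuity: the graph of some continuous `g : [0, 1] → ℝ` is contained in the closure
of the graph of `f`. -/
def GraphContinuous (f : M.RealFun) : Prop :=
  ∃ g : M.RealFun, g.Continuous ∧ ∀ x : M.Reals, x.InUnit →
    ∀ k : M.N, ∃ z : M.Reals, z.InUnit ∧ z.Near k x ∧ (f.at z).Near k (g.at x)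

/-- `f` is of Cesàro type. -/
def CesaroType (f : M.RealFun) : Prop :=
  ∃ U V : M.RealSet, U.IsOpen ∧ V.IsOpen ∧ (∃ x : M.Reals, U.Mem x) ∧ (∃ y : M.Reals, V.Mem y) ∧
    (∀ x : M.Reals, U.Mem x → x.InUnit) ∧
    ∀ y : M.Reals, V.Mem y → ∀ x : M.Reals, U.Mem x → InClosure (f.Fiber y) x

/-- Pre-continuity: for each open `G`, the set `f⁻¹(G)` is pre-open in `[0, 1]`, that is,
contained in the interior of its closure. -/
def PreContinuous (f : M.RealFun) : Prop :=
  ∀ G : M.RealSet, G.IsOpen → ∀ x : M.Reals, f.Preimage G x →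
    IsNbhd (InClosure (f.Preimage G)) x

/-- Almost continuity in the sense of Stallings: each open `O ⊆ ℝ²` that contains the graph of
`f` contains the graph of a continuous `g : [0, 1] → ℝ`. -/
def Stallings (f : M.RealFun) : Prop :=
  ∀ O : M.PlaneSet, O.IsOpen → (∀ x : M.Reals, x.InUnit → O.Mem x (f.at x)) →
    ∃ g : M.RealFun, g.Continuous ∧ ∀ x : M.Reals, x.InUnit → O.Mem x (g.at x)

/-- Continuity almost everywhere: for each `k` the points of discontinuity in `[0, 1]` are covered
by a sequence of open intervals `(aₙ, bₙ)` of total length at most `1 / 2 ^ k`.  Here `s` is the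
sequence of partial sums of the lengths. -/
def ContinuousAE (f : M.RealFun) : Prop :=
  ∀ k : M.N, ∃ a b s : M.RealSeq,
    (∀ n : M.N, (a.at n).Le (b.at n)) ∧
    LimEq (s.at 0).seq (fun _ => 0) ∧
    (∀ n : M.N, LimEq (s.at (n + 1)).seq
      (fun i => (s.at n).seq i + ((b.at n).seq i - (a.at n).seq i))) ∧
    (∀ n : M.N, LimLe (s.at n).seq (fun _ => M.eps k)) ∧
    ∀ x : M.Reals, x.InUnit → ¬ f.ContAt x → ∃ n : M.N, (a.at n).Lt x ∧ x.Lt (b.at n)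

/-- `x₀ ≤ t₀ ≤ x₁ ≤ t₁ ≤ ⋯ ≤ x_l` is a tagged partition of `[0, 1]` of mesh less than
`1 / 2 ^ m`, and `r` is the associated Riemann sum `∑_{i < l} f(tᵢ) (xᵢ₊₁ - xᵢ)` of `f`.  Here `s`
is the sequence of partial sums. -/
def IsRiemannSum (f : M.RealFun) (m : M.N) (r : M.Reals) : Prop :=
  ∃ (l : M.N) (x t s : M.RealSeq),
    LimEq (x.at 0).seq (fun _ => 0) ∧ LimEq (x.at l).seq (fun _ => 1) ∧
    (∀ i : M.N, i < l → (x.at i).Le (t.at i) ∧ (t.at i).Le (x.at (i + 1)) ∧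
      (x.at (i + 1)).Near m (x.at i)) ∧
    LimEq (s.at 0).seq (fun _ => 0) ∧
    (∀ i : M.N, i < l → LimEq (s.at (i + 1)).seq
      (fun j => (s.at i).seq j +
        (f.at (t.at i)).seq j * ((x.at (i + 1)).seq j - (x.at i).seq j))) ∧
    r.Eq (s.at l)

/-- Riemann integrability on `[0, 1]`: for each `k` there is `m` such that any two Riemann sums
of mesh less than `1 / 2 ^ m` differ by at most `1 / 2 ^ k`. -/
def RiemannIntegrable (f : M.RealFun) : Prop :=
  ∀ k : M.N, ∃ m : M.N, ∀ r r' : M.Reals, f.IsRiemannSum m r → f.IsRiemannSum m r' →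
    LimLe (fun n => (r.seq n - r'.seq n).abs) (fun _ => M.eps k)

/-- The intermediate value property on `[0, 1]`. -/
def IntermediateValue (f : M.RealFun) : Prop :=
  ∀ x y c : M.Reals, x.InUnit → y.InUnit → x.Lt y →
    (((f.at x).Le c ∧ c.Le (f.at y)) ∨ ((f.at y).Le c ∧ c.Le (f.at x))) →
    ∃ z : M.Reals, x.Le z ∧ z.Le y ∧ (f.at z).Eq c

end RealFun

/-- The weak continuity classes `Γ`. -/
inductive WeakContinuity where
  | young
  | husain
  | graphContinuous
  | notCesaroType
  | preContinuous

/-- `f` belongs to the class `Γ`. -/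
def WeakContinuity.Holds {M : TypeStructure.{u}} : WeakContinuity → M.RealFun → Prop
  | .young, f => f.Young
  | .husain, f => f.Husain
  | .graphContinuous, f => f.GraphContinuous
  | .notCesaroType, f => ¬ f.CesaroType
  | .preContinuous, f => f.PreContinuous

/-- The properties `P` to be decided. -/
inductive DecidedProperty where
  | stallings
  | continuous
  | continuousAE
  | riemannIntegrable
  | intermediateValue

/-- `f` has the property `P`. -/
def DecidedProperty.Holds {M : TypeStructure.{u}} : DecidedProperty → M.RealFun → Prop
  | .stallings, f => f.Stallings
  | .continuous, f => f.Continuous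
  | .continuousAE, f => f.ContinuousAE
  | .riemannIntegrable, f => f.RiemannIntegrable
  | .intermediateValue, f => f.IntermediateValue

/-- The functionals `(ℝ → ℝ) → ℝ` of `M`: elements of type `(1 → 1) → 1` that map functions
`ℝ → ℝ` to reals and equal functions to equal reals. -/
structure RealFunctional (M : TypeStructure.{u}) where
  val : M.El (arr (arr FinType.one FinType.one) FinType.one)
  isReal : ∀ f : M.RealFun, M.IsReal (val f.val)
  ext : ∀ f g : M.RealFun, (∀ x : M.Reals, (f.at x).Eq (g.at x)) →
    Reals.Eq (⟨val f.val, isReal f⟩ : M.Reals) ⟨val g.val, isReal g⟩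

/-- The value `Ξ(f)`. -/
def RealFunctional.at {M : TypeStructure.{u}} (Ξ : M.RealFunctional) (f : M.RealFun) : M.Reals :=
  ⟨Ξ.val f.val, Ξ.isReal f⟩

/-- `Ξ` is a `P`-decision functional for `Γ`: for each `f` in `Γ`, `Ξ(f) = 0` if and only if `f`
has the property `P`. -/
def RealFunctional.Decides {M : TypeStructure.{u}} (Ξ : M.RealFunctional)
    (P : DecidedProperty) (Γ : WeakContinuity) : Prop :=
  ∀ f : M.RealFun, Γ.Holds f → (LimEq (Ξ.at f).seq (fun _ => 0) ↔ P.Holds f)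

end TypeStructure

/-!
Let `M` be a model of the base theory.

*From a decision functional to `(∃³)`.* Given `Y` of type `2`, a real is read in base four, and
`indicatorFun Y` is the indicator function of the set of reals such that some tail of the expansion
codes, by the places of the digit `1`, an element `g` of Baire space with `Y g = 0`
(`CodesZero`, `readOff`). Since `(∃²)` is available, this function exists in `M`, and so does the
map `Y ↦ indicatorFun Y` (`Rep.indicator`). Membership in the set depends on a tail of the
expansion only, so there are two cases.
If `Y` has no zero, the function is constantly `0` and has each of the five properties
(`DecidedProperty.holds_of_val_eq_zero`). If `Y` has a zero, the values `0` and `1` are both taken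
on dense sets (`graphDigits`, `readOff_point`), and the function has none of the properties
(`HasDenseFibers.not_holds`): there is an open set around its graph that misses the line at height
`1 / 2`, while a continuous function in this set has to cross that line (`exists_eq_half`), it is
discontinuous everywhere while `[0, 1]` cannot be covered by short intervals (`one_le_fracSum`,
`not_cover`), and it has the Riemann sums `0` and `1` for arbitrarily fine partitions. In both
cases the function is in each of the classes `Γ`, since it has at most two values, each of which is
taken on a dense set (`HasDenseFibers.holds`). So a functional `Ξ` that decides `P` on `Γ` has the
value `0` at `indicatorFun Y` if and only if `Y` has no zero (`holds_indicatorFun_iff`,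
`RealFunctional.Decides.kleeneE3`).

*From `(∃³)` to decision functionals.* With `(∃³)`, quantifiers over elements of type `1` are
decidable, and hence quantifiers over reals and over sequences of reals (`Rep.exists_of_codes`,
`Rep.exists_real`, `Rep.exists_realSeq`). Four of the five properties are built from such
quantifiers. Stallings' property quantifies over subsets of the plane and over functions; but open
sets and continuous functions are coded by elements of type `1` (`RealFun.stallings_iff`), where the
function with a given code is obtained from a definable description of its values (`theReal`).
So each property is decidable (`rep_holds`), and a single functional decides it for all functions
(`exists_decides`).

*Working in the model.* The numbers of `M` may be nonstandard, so every induction, recursion or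
search has to be carried out for predicates and functions that exist in `M`. A function between
represented types is called representable (`Rep`) if it is realized by an element of `M`;
combinatory completeness gives closure properties, which `fun_prop` applies. Induction
(`induction_on`), primitive recursion (`exists_recursion`) and, with `(∃²)`, arithmetical predicates
and least elements (`least`) are available for representable data. Inequalities between reals of
`M` are reduced to inequalities between their values in the ordered field `RealLine M`, the Cauchy
completion of the field of fractions of the ring of differences of the numbers of `M`. This field
need not be Dedekind complete; infima of decidable sets of dyadic rationals, which exist by
`exists_inf`, replace the completeness arguments.
-/

/-! ### Ordered rings of differences and ordered fields of fractions -/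

section OrderFromCone

variable {R : Type*} [CommRing R]

/-- The total order on a commutative ring whose nonnegative elements are those of `P`. -/
noncomputable abbrev linearOrderOfNonneg (P : R → Prop)
    (add : ∀ a b, P a → P b → P (a + b)) (zero : P 0)
    (antisymm : ∀ a, P a → P (-a) → a = 0) (total : ∀ a, P a ∨ P (-a)) : LinearOrder R where
  le a b := P (b - a)
  le_refl a := by simpa using zero
  le_trans a b c h h' := by simpa using add _ _ h' h
  le_antisymm a b h h' := by
    have := antisymm (b - a) h (by simpa using h')
    exact (sub_eq_zero.mp this).symm
  le_total a b := by simpa using total (b - a)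
  toDecidableLE := Classical.decRel _

theorem isStrictOrderedRing_of_nonneg [IsDomain R] (P : R → Prop)
    (add : ∀ a b, P a → P b → P (a + b)) (zero : P 0)
    (antisymm : ∀ a, P a → P (-a) → a = 0) (total : ∀ a, P a ∨ P (-a))
    (mul : ∀ a b, P a → P b → P (a * b)) (one : P 1) :
    letI := linearOrderOfNonneg P add zero antisymm total
    IsStrictOrderedRing R := by
  let _ := linearOrderOfNonneg P add zero antisymm total
  have hle : ∀ a b : R, a ≤ b ↔ P (b - a) := fun _ _ => Iff.rfl
  have : IsOrderedAddMonoid R :=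
    { add_le_add_left := fun a b h c => by
        rw [hle] at h ⊢
        simpa using h }
  have : ZeroLEOneClass R := ⟨by rw [hle]; simpa using one⟩
  refine IsStrictOrderedRing.of_mul_pos fun a b ha hb => ?_
  refine lt_of_le_of_ne ?_ (mul_ne_zero ha.ne' hb.ne').symm
  have h1 := ha.le
  have h2 := hb.le
  rw [hle] at h1 h2 ⊢
  simpa using mul _ _ (by simpa using h1) (by simpa using h2)

end OrderFromCone

/-- Formal differences `a - b` of elements of a cancellative semiring. -/
def diffSetoid (R : Type*) [CommSemiring R] [IsCancelAdd R] : Setoid (R × R) where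
  r p q := p.1 + q.2 = q.1 + p.2
  iseqv :=
    { refl := fun _ => rfl
      symm := fun h => h.symm
      trans := fun {a b c} h h' => by
        have : (a.1 + c.2) + (b.1 + b.2) = (c.1 + a.2) + (b.1 + b.2) := by
          calc _ = (a.1 + b.2) + (b.1 + c.2) := by ring
            _ = (b.1 + a.2) + (c.1 + b.2) := by rw [h, h']
            _ = _ := by ring
        exact add_right_cancel this }

/-- The ring of differences of a cancellative commutative semiring. -/
def DiffRing (R : Type*) [CommSemiring R] [IsCancelAdd R] : Type _ := Quotient (diffSetoid R)

namespace DiffRing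

section Ring

variable {R : Type*} [CommSemiring R] [IsCancelAdd R]

/-- The difference `a - b`. -/
def mk (a b : R) : DiffRing R := Quotient.mk (diffSetoid R) (a, b)

theorem mk_eq {a b c d : R} : mk a b = mk c d ↔ a + d = c + b :=
  Quotient.eq (r := diffSetoid R)

theorem exists_mk (x : DiffRing R) : ∃ a b, x = mk a b := by
  obtain ⟨⟨a, b⟩, rfl⟩ := Quotient.exists_rep x
  exact ⟨a, b, rfl⟩

instance : Add (DiffRing R) := ⟨Quotient.map₂ (fun p q => (p.1 + q.1, p.2 + q.2)) (by
  rintro ⟨a, b⟩ ⟨a', b'⟩ h ⟨c, d⟩ ⟨c', d'⟩ h'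
  change a + b' = a' + b at h
  change c + d' = c' + d at h'
  change a + c + (b' + d') = a' + c' + (b + d)
  calc _ = (a + b') + (c + d') := by ring
    _ = _ := by rw [h, h']; ring)⟩

instance : Mul (DiffRing R) :=
  ⟨Quotient.map₂ (fun p q => (p.1 * q.1 + p.2 * q.2, p.1 * q.2 + p.2 * q.1)) (by
  rintro ⟨a, b⟩ ⟨a', b'⟩ h ⟨c, d⟩ ⟨c', d'⟩ h'
  change a + b' = a' + b at h
  change c + d' = c' + d at h'
  change a * c + b * d + (a' * d' + b' * c') = a' * c' + b' * d' + (a * d + b * c)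
  have key : (a * c + b * d + (a' * d' + b' * c')) + (b' * c + a' * d) =
      (a' * c' + b' * d' + (a * d + b * c)) + (b' * c + a' * d) := by
    calc _ = (a + b') * c + (a' + b) * d + a' * d' + b' * c' := by ring
      _ = (a' + b) * c + (a + b') * d + a' * d' + b' * c' := by rw [h]
      _ = a' * (c + d') + b' * (c' + d) + a * d + b * c := by ring
      _ = a' * (c' + d) + b' * (c + d') + a * d + b * c := by rw [h']
      _ = _ := by ring
  exact add_right_cancel key)⟩

instance : Neg (DiffRing R) := ⟨Quotient.map (fun p => (p.2, p.1)) (by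
  rintro ⟨a, b⟩ ⟨a', b'⟩ h
  change a + b' = a' + b at h
  change b + a' = b' + a
  rw [add_comm b, add_comm b', h])⟩

instance : Zero (DiffRing R) := ⟨mk 0 0⟩

instance : One (DiffRing R) := ⟨mk 1 0⟩

theorem mk_add (a b c d : R) : mk a b + mk c d = mk (a + c) (b + d) := rfl

theorem mk_mul (a b c d : R) : mk a b * mk c d = mk (a * c + b * d) (a * d + b * c) := rfl

theorem neg_mk (a b : R) : -mk a b = mk b a := rfl

theorem zero_def : (0 : DiffRing R) = mk 0 0 := rfl

theorem one_def : (1 : DiffRing R) = mk 1 0 := rfl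

instance : CommRing (DiffRing R) where
  add_assoc x y z := by
    obtain ⟨a, b, rfl⟩ := exists_mk x
    obtain ⟨c, d, rfl⟩ := exists_mk y
    obtain ⟨e, f, rfl⟩ := exists_mk z
    simp only [mk_add, add_assoc]
  zero_add x := by
    obtain ⟨a, b, rfl⟩ := exists_mk x
    simp only [zero_def, mk_add, zero_add]
  add_zero x := by
    obtain ⟨a, b, rfl⟩ := exists_mk x
    simp only [zero_def, mk_add, add_zero]
  add_comm x y := by
    obtain ⟨a, b, rfl⟩ := exists_mk x
    obtain ⟨c, d, rfl⟩ := exists_mk y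
    simp only [mk_add, add_comm]
  neg_add_cancel x := by
    obtain ⟨a, b, rfl⟩ := exists_mk x
    simp only [neg_mk, mk_add, zero_def, mk_eq]
    ring
  left_distrib x y z := by
    obtain ⟨a, b, rfl⟩ := exists_mk x
    obtain ⟨c, d, rfl⟩ := exists_mk y
    obtain ⟨e, f, rfl⟩ := exists_mk z
    simp only [mk_add, mk_mul, mk_eq]
    ring
  right_distrib x y z := by
    obtain ⟨a, b, rfl⟩ := exists_mk x
    obtain ⟨c, d, rfl⟩ := exists_mk y
    obtain ⟨e, f, rfl⟩ := exists_mk z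
    simp only [mk_add, mk_mul, mk_eq]
    ring
  zero_mul x := by
    obtain ⟨a, b, rfl⟩ := exists_mk x
    simp only [mk_mul, zero_def, mk_eq]
    ring
  mul_zero x := by
    obtain ⟨a, b, rfl⟩ := exists_mk x
    simp only [mk_mul, zero_def, mk_eq]
    ring
  one_mul x := by
    obtain ⟨a, b, rfl⟩ := exists_mk x
    simp only [mk_mul, one_def, mk_eq]
    ring
  mul_one x := by
    obtain ⟨a, b, rfl⟩ := exists_mk x
    simp only [mk_mul, one_def, mk_eq]
    ring
  mul_assoc x y z := by
    obtain ⟨a, b, rfl⟩ := exists_mk x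
    obtain ⟨c, d, rfl⟩ := exists_mk y
    obtain ⟨e, f, rfl⟩ := exists_mk z
    simp only [mk_mul, mk_eq]
    ring
  mul_comm x y := by
    obtain ⟨a, b, rfl⟩ := exists_mk x
    obtain ⟨c, d, rfl⟩ := exists_mk y
    simp only [mk_mul, mk_eq]
    ring
  nsmul := nsmulRec
  zsmul := zsmulRec

/-- The embedding of the semiring into its ring of differences. -/
def of : R →+* DiffRing R where
  toFun a := mk a 0
  map_zero' := rfl
  map_one' := rfl
  map_add' a b := by simp only [mk_add, add_zero]
  map_mul' a b := by simp only [mk_mul, mk_eq]; ring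

theorem mk_eq_sub (a b : R) : mk a b = of a - of b := by
  rw [sub_eq_add_neg]
  change mk a b = mk a 0 + -mk b 0
  rw [neg_mk, mk_add, add_zero, zero_add]

end Ring

section Order

variable {R : Type*} [CommSemiring R] [LinearOrder R] [IsStrictOrderedRing R]

/-- The nonnegative differences `a - b`, those with `b ≤ a`. -/
def Nonneg (x : DiffRing R) : Prop := ∃ a b, b ≤ a ∧ x = mk a b

theorem nonneg_mk {a b : R} : Nonneg (mk a b) ↔ b ≤ a := by
  refine ⟨?_, fun h => ⟨a, b, h, rfl⟩⟩
  rintro ⟨c, d, h, e⟩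
  rw [mk_eq] at e
  by_contra! hlt
  exact absurd e (add_lt_add_of_lt_of_le hlt h |>.trans_eq (add_comm _ _)).ne

theorem Nonneg.add (x y : DiffRing R) (hx : Nonneg x) (hy : Nonneg y) : Nonneg (x + y) := by
  obtain ⟨a, b, h, rfl⟩ := hx
  obtain ⟨c, d, h', rfl⟩ := hy
  exact ⟨_, _, add_le_add h h', rfl⟩

theorem Nonneg.antisymm (x : DiffRing R) (hx : Nonneg x) (hx' : Nonneg (-x)) : x = 0 := by
  obtain ⟨a, b, rfl⟩ := exists_mk x
  rw [neg_mk, nonneg_mk] at hx'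
  rw [nonneg_mk] at hx
  rw [le_antisymm hx' hx, zero_def, mk_eq, add_zero, zero_add]

theorem nonneg_total (x : DiffRing R) : Nonneg x ∨ Nonneg (-x) := by
  obtain ⟨a, b, rfl⟩ := exists_mk x
  rw [neg_mk, nonneg_mk, nonneg_mk]
  exact le_total _ _

theorem nonneg_zero : Nonneg (0 : DiffRing R) := nonneg_mk.2 le_rfl

theorem nonneg_one : Nonneg (1 : DiffRing R) := nonneg_mk.2 zero_le_one

variable [ExistsAddOfLE R]

theorem Nonneg.mul (x y : DiffRing R) (hx : Nonneg x) (hy : Nonneg y) :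
    Nonneg (x * y) := by
  obtain ⟨a, b, h, rfl⟩ := hx
  obtain ⟨c, d, h', rfl⟩ := hy
  exact ⟨_, _, mul_add_mul_le_mul_add_mul' h h', rfl⟩

instance : IsDomain (DiffRing R) := by
  have : Nontrivial (DiffRing R) := ⟨0, 1, fun h => by
    rw [zero_def, one_def, mk_eq] at h
    simp at h⟩
  have : NoZeroDivisors (DiffRing R) := ⟨fun {x y} h => by
    obtain ⟨a, b, rfl⟩ := exists_mk x
    obtain ⟨c, d, rfl⟩ := exists_mk y
    rw [mk_mul, zero_def, mk_eq, add_zero, zero_add] at h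
    simp only [zero_def, mk_eq, add_zero, zero_add]
    by_contra! hne
    rcases lt_or_gt_of_ne hne.1 with h1 | h1 <;> rcases lt_or_gt_of_ne hne.2 with h2 | h2
    · exact absurd h (mul_add_mul_lt_mul_add_mul h1 h2).ne'
    · exact absurd h (mul_add_mul_lt_mul_add_mul h1 h2).ne
    · exact absurd h (by simpa [add_comm] using (mul_add_mul_lt_mul_add_mul h1 h2).ne)
    · exact absurd h (mul_add_mul_lt_mul_add_mul' h1 h2).ne'⟩
  exact NoZeroDivisors.to_isDomain _

noncomputable instance : LinearOrder (DiffRing R) :=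
  linearOrderOfNonneg Nonneg Nonneg.add nonneg_zero Nonneg.antisymm nonneg_total

instance : IsStrictOrderedRing (DiffRing R) :=
  isStrictOrderedRing_of_nonneg Nonneg Nonneg.add nonneg_zero Nonneg.antisymm nonneg_total
    Nonneg.mul nonneg_one

omit [ExistsAddOfLE R] in
theorem of_le_of {a b : R} : of a ≤ of b ↔ a ≤ b := by
  change Nonneg (of b - of a) ↔ _
  rw [← mk_eq_sub, nonneg_mk]

end Order

end DiffRing

namespace OrderedFraction

variable {Z : Type*} [CommRing Z] [LinearOrder Z] [IsStrictOrderedRing Z]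

/-- The nonnegative fractions, those that have nonnegative numerator and positive denominator. -/
def Nonneg (x : FractionRing Z) : Prop :=
  ∃ a b : Z, 0 ≤ a ∧ 0 < b ∧ x * algebraMap Z _ b = algebraMap Z _ a

omit [LinearOrder Z] [IsStrictOrderedRing Z] in
theorem algebraMap_inj {a b : Z} :
    algebraMap Z (FractionRing Z) a = algebraMap Z (FractionRing Z) b ↔ a = b :=
  (IsFractionRing.injective Z (FractionRing Z)).eq_iff

theorem exists_fraction (x : FractionRing Z) :
    ∃ a b : Z, 0 < b ∧ x * algebraMap Z _ b = algebraMap Z _ a := by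
  obtain ⟨⟨a, b⟩, h⟩ := IsLocalization.surj (nonZeroDivisors Z) x
  have hb : (b : Z) ≠ 0 := nonZeroDivisors.ne_zero b.2
  rcases lt_or_gt_of_ne hb with h1 | h1
  · exact ⟨-a, -b, by simpa using h1, by simpa using h⟩
  · exact ⟨a, b, h1, h⟩

theorem Nonneg.add (x y : FractionRing Z) (hx : Nonneg x) (hy : Nonneg y) : Nonneg (x + y) := by
  obtain ⟨a, b, ha, hb, h⟩ := hx
  obtain ⟨c, d, hc, hd, h'⟩ := hy
  refine ⟨a * d + c * b, b * d, by positivity, by positivity, ?_⟩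
  simp only [map_mul, map_add, ← h, ← h']
  ring

theorem Nonneg.mul (x y : FractionRing Z) (hx : Nonneg x) (hy : Nonneg y) : Nonneg (x * y) := by
  obtain ⟨a, b, ha, hb, h⟩ := hx
  obtain ⟨c, d, hc, hd, h'⟩ := hy
  refine ⟨a * c, b * d, by positivity, by positivity, ?_⟩
  simp only [map_mul, ← h, ← h']
  ring

theorem nonneg_zero : Nonneg (0 : FractionRing Z) := ⟨0, 1, le_rfl, zero_lt_one, by simp⟩

theorem nonneg_one : Nonneg (1 : FractionRing Z) := ⟨1, 1, zero_le_one, zero_lt_one, by simp⟩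

theorem Nonneg.antisymm (x : FractionRing Z) (hx : Nonneg x) (hx' : Nonneg (-x)) : x = 0 := by
  obtain ⟨a, b, ha, hb, h⟩ := hx
  obtain ⟨c, d, hc, hd, h'⟩ := hx'
  have key : a * d + c * b = 0 := by
    rw [← algebraMap_inj]
    simp only [map_mul, map_add, ← h, ← h', map_zero]
    ring
  have h0 : a * d = 0 := le_antisymm (by nlinarith [mul_nonneg hc hb.le]) (by positivity)
  have ha0 : a = 0 := (mul_eq_zero.mp h0).resolve_right hd.ne'
  rw [ha0, map_zero] at h
  refine (mul_eq_zero.mp h).resolve_right fun h => hb.ne' ?_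
  rwa [← map_zero (algebraMap Z (FractionRing Z)), algebraMap_inj] at h

theorem nonneg_total (x : FractionRing Z) : Nonneg x ∨ Nonneg (-x) := by
  obtain ⟨a, b, hb, h⟩ := exists_fraction x
  rcases le_total 0 a with ha | ha
  · exact .inl ⟨a, b, ha, hb, h⟩
  · exact .inr ⟨-a, b, by simpa using ha, hb, by simpa using h⟩

/-- The order of the field of fractions of an ordered domain. -/
noncomputable abbrev linearOrder : LinearOrder (FractionRing Z) :=
  linearOrderOfNonneg Nonneg Nonneg.add nonneg_zero Nonneg.antisymm nonneg_total

theorem isStrictOrderedRing :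
    letI : LinearOrder (FractionRing Z) := linearOrder
    IsStrictOrderedRing (FractionRing Z) :=
  isStrictOrderedRing_of_nonneg Nonneg Nonneg.add nonneg_zero Nonneg.antisymm nonneg_total
    Nonneg.mul nonneg_one

theorem algebraMap_nonneg {a : Z} (ha : 0 ≤ a) : Nonneg (algebraMap Z (FractionRing Z) a) :=
  ⟨a, 1, ha, zero_lt_one, by simp⟩

end OrderedFraction

/-- The ordered field of fractions of differences of elements of an ordered semiring. -/
def RatField (R : Type*) [CommSemiring R] [LinearOrder R] [IsStrictOrderedRing R] : Type _ :=
  FractionRing (DiffRing R)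

namespace RatField

variable {R : Type*} [CommSemiring R] [LinearOrder R] [IsStrictOrderedRing R] [ExistsAddOfLE R]

noncomputable instance : Field (RatField R) :=
  inferInstanceAs (Field (FractionRing (DiffRing R)))

noncomputable instance : LinearOrder (RatField R) := OrderedFraction.linearOrder (Z := DiffRing R)

instance : IsStrictOrderedRing (RatField R) :=
  OrderedFraction.isStrictOrderedRing (Z := DiffRing R)

/-- The embedding of the semiring. -/
noncomputable def of : R →+* RatField R :=
  (algebraMap (DiffRing R) (FractionRing (DiffRing R))).comp DiffRing.of

theorem of_strictMono : StrictMono (of : R → RatField R) := by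
  refine Monotone.strictMono_of_injective (fun a b h => ?_) fun a b h => ?_
  · have h' : (0 : DiffRing R) ≤ DiffRing.of b - DiffRing.of a :=
      sub_nonneg.2 (DiffRing.of_le_of.2 h)
    have := OrderedFraction.algebraMap_nonneg h'
    rw [map_sub] at this
    exact this
  · have h' := OrderedFraction.algebraMap_inj.1 h
    exact le_antisymm (DiffRing.of_le_of.1 h'.le) (DiffRing.of_le_of.1 h'.ge)

end RatField

/-! ### Combinatory completeness and representable functions -/

namespace TypeStructure

open FinType

/-- The axioms of `RCA₀^ω`, as an instance argument. -/
class IsModel (M : TypeStructure.{u}) : Prop where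
  out : M.ModelsRCA0omega

instance (M : TypeStructure.{u}) (σ : FinType) : Nonempty (M.El σ) := by
  induction σ with
  | nat => exact ⟨0⟩
  | arr σ τ _ ih => exact ih.elim fun b => ⟨M.K τ σ b⟩

section Combinators

variable {M : TypeStructure.{u}} [hM : IsModel M]

instance : IsStrictOrderedRing M.N := hM.out.ordered

theorem El.ext {σ τ : FinType} {f g : M.El (arr σ τ)} (h : ∀ a, f a = g a) : f = g :=
  hM.out.ext _ _ _ _ h

theorem exists_const {α β : FinType} (c : M.El β) : ∃ F : M.El (arr α β), ∀ a, F a = c :=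
  ⟨M.K β α c, fun _ => hM.out.K_eq ..⟩

theorem exists_id (α : FinType) : ∃ F : M.El (arr α α), ∀ a, F a = a :=
  ⟨M.S α (arr α α) α (M.K α (arr α α)) (M.K α α), fun a => by
    rw [hM.out.S_eq, hM.out.K_eq]⟩

theorem exists_app {α β γ : FinType} {φ : M.El α → M.El (arr β γ)} {ψ : M.El α → M.El β}
    (hφ : ∃ F : M.El (arr α (arr β γ)), ∀ a, F a = φ a)
    (hψ : ∃ F : M.El (arr α β), ∀ a, F a = ψ a) :
    ∃ F : M.El (arr α γ), ∀ a, F a = φ a (ψ a) := by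
  obtain ⟨F, hF⟩ := hφ
  obtain ⟨G, hG⟩ := hψ
  exact ⟨M.S _ _ _ F G, fun a => by rw [hM.out.S_eq, hF, hG]⟩

theorem exists_const₂ {α β γ : FinType} (c : M.El γ) :
    ∃ F : M.El (arr α (arr β γ)), ∀ a b, F a b = c :=
  ⟨M.K _ _ (M.K _ _ c), fun a b => by rw [hM.out.K_eq, hM.out.K_eq]⟩

theorem exists_fst₂ {α β : FinType} : ∃ F : M.El (arr α (arr β α)), ∀ a b, F a b = a :=
  ⟨M.K _ _, fun a b => by rw [hM.out.K_eq]⟩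

theorem exists_snd₂ {α β : FinType} : ∃ F : M.El (arr α (arr β β)), ∀ a b, F a b = b := by
  obtain ⟨I, hI⟩ := exists_id (M := M) β
  exact ⟨M.K _ _ I, fun a b => by rw [hM.out.K_eq, hI]⟩

theorem exists_app₂ {α β γ δ : FinType} {φ : M.El α → M.El β → M.El (arr γ δ)}
    {ψ : M.El α → M.El β → M.El γ}
    (hφ : ∃ F : M.El (arr α (arr β (arr γ δ))), ∀ a b, F a b = φ a b)
    (hψ : ∃ F : M.El (arr α (arr β γ)), ∀ a b, F a b = ψ a b) :
    ∃ F : M.El (arr α (arr β δ)), ∀ a b, F a b = φ a b (ψ a b) := by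
  obtain ⟨F, hF⟩ := hφ
  obtain ⟨G, hG⟩ := hψ
  obtain ⟨H, hH⟩ := exists_app (exists_app (exists_const (M.S β γ δ)) ⟨F, fun _ => rfl⟩)
    ⟨G, fun _ => rfl⟩
  exact ⟨H, fun a b => by rw [hH, hM.out.S_eq, hF, hG]⟩

theorem exists_app₃ {α β γ δ ε : FinType} {φ : M.El α → M.El β → M.El γ → M.El (arr δ ε)}
    {ψ : M.El α → M.El β → M.El γ → M.El δ}
    (hφ : ∃ F : M.El (arr α (arr β (arr γ (arr δ ε)))), ∀ a b c, F a b c = φ a b c)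
    (hψ : ∃ F : M.El (arr α (arr β (arr γ δ))), ∀ a b c, F a b c = ψ a b c) :
    ∃ F : M.El (arr α (arr β (arr γ ε))), ∀ a b c, F a b c = φ a b c (ψ a b c) := by
  obtain ⟨F, hF⟩ := hφ
  obtain ⟨G, hG⟩ := hψ
  obtain ⟨H, hH⟩ := exists_app₂ (exists_app₂ (exists_const₂ (M.S γ δ ε)) ⟨F, fun _ _ => rfl⟩)
    ⟨G, fun _ _ => rfl⟩
  exact ⟨H, fun a b c => by rw [hH, hM.out.S_eq, hF, hG]⟩

theorem exists_fst₃ {α β γ : FinType} :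
    ∃ F : M.El (arr α (arr β (arr γ α))), ∀ a b c, F a b c = a := by
  obtain ⟨F, hF⟩ := exists_app₂ (exists_const₂ (M.K α γ)) (exists_fst₂ (M := M) (β := β))
  exact ⟨F, fun a b c => by rw [hF, hM.out.K_eq]⟩

theorem exists_snd₃ {α β γ : FinType} :
    ∃ F : M.El (arr α (arr β (arr γ β))), ∀ a b c, F a b c = b := by
  obtain ⟨F, hF⟩ := exists_app₂ (exists_const₂ (M.K β γ)) (exists_snd₂ (M := M) (α := α))
  exact ⟨F, fun a b c => by rw [hF, hM.out.K_eq]⟩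

theorem exists_trd₃ {α β γ : FinType} :
    ∃ F : M.El (arr α (arr β (arr γ γ))), ∀ a b c, F a b c = c := by
  obtain ⟨I, hI⟩ := exists_id (M := M) γ
  obtain ⟨F, hF⟩ := exists_const₂ (M := M) (α := α) (β := β) I
  exact ⟨F, fun a b c => by rw [hF, hI]⟩

/-- The combinator `f ↦ (x ↦ (y ↦ f y x))`. -/
theorem exists_flip (α β γ : FinType) :
    ∃ C : M.El (arr (arr α (arr β γ)) (arr β (arr α γ))), ∀ f x y, C f x y = f y x := by
  obtain ⟨C, hC⟩ := exists_app₃ (exists_app₃ (exists_fst₃ (M := M)) exists_trd₃)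
    (exists_snd₃ (M := M) (α := arr α (arr β γ)) (β := β) (γ := α))
  exact ⟨C, hC⟩

/-- The type of Church pairs `k ↦ k a b`, where `k` ranges over numerical functions. -/
abbrev pairTy (σ τ : FinType) : FinType := arr (arr σ (arr τ nat)) nat

theorem exists_mkPair (σ τ : FinType) :
    ∃ P : M.El (arr σ (arr τ (pairTy σ τ))), ∀ a b k, P a b k = k a b := by
  obtain ⟨C, hC⟩ := exists_app₃ (exists_app₃ (exists_trd₃ (M := M)) exists_fst₃)
    (exists_snd₃ (M := M) (α := σ) (β := τ) (γ := arr σ (arr τ nat)))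
  exact ⟨C, hC⟩

/-- The Church pair of `a` and `b`. -/
noncomputable def mkPair {σ τ : FinType} (a : M.El σ) (b : M.El τ) : M.El (pairTy σ τ) :=
  (exists_mkPair σ τ).choose a b

theorem mkPair_app {σ τ : FinType} (a : M.El σ) (b : M.El τ) (k) : mkPair a b k = k a b :=
  (exists_mkPair σ τ).choose_spec a b k

/-- Although Church pairs only apply to numerical functions, they can be taken apart with values
in any type `ρ`, by recursion on `ρ`. -/
theorem exists_uncurry (σ τ ρ : FinType) :
    ∃ U : M.El (arr (arr σ (arr τ ρ)) (arr (pairTy σ τ) ρ)),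
      ∀ G a b, U G (mkPair a b) = G a b := by
  induction ρ with
  | nat =>
    obtain ⟨C, hC⟩ := exists_app₂ exists_snd₂
      (exists_fst₂ (M := M) (α := arr σ (arr τ nat)) (β := pairTy σ τ))
    exact ⟨C, fun G a b => by rw [hC, mkPair_app]⟩
  | arr ρ₁ ρ₂ _ ih =>
    obtain ⟨U, hU⟩ := ih
    obtain ⟨C, hC⟩ := exists_flip (M := M) τ ρ₁ ρ₂
    -- `W G c a b = G a b c`
    obtain ⟨W, hW⟩ : ∃ W : M.El (arr (arr σ (arr τ (arr ρ₁ ρ₂))) (arr ρ₁ (arr σ (arr τ ρ₂)))),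
        ∀ G c a b, W G c a b = G a b c := by
      obtain ⟨W, hW⟩ := exists_app₃ (exists_app₃ (φ := fun _ _ _ => C)
        (⟨M.K _ _ (M.K _ _ (M.K _ _ C)), fun a b c => by simp only [hM.out.K_eq]⟩)
        (exists_app₃ exists_fst₃ exists_trd₃))
        (exists_snd₃ (M := M) (α := arr σ (arr τ (arr ρ₁ ρ₂))) (β := ρ₁) (γ := σ))
      exact ⟨W, fun G c a b => by rw [hW, hC]⟩
    -- `H G p c = U (W G c) p`
    obtain ⟨H, hH⟩ : ∃ H : M.El (arr (arr σ (arr τ (arr ρ₁ ρ₂)))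
        (arr (pairTy σ τ) (arr ρ₁ ρ₂))), ∀ G p c, H G p c = U (W G c) p := by
      obtain ⟨H, hH⟩ := exists_app₃ (exists_app₃ (φ := fun _ _ _ => U)
        (⟨M.K _ _ (M.K _ _ (M.K _ _ U)), fun a b c => by simp only [hM.out.K_eq]⟩)
        (exists_app₃ (exists_app₃ (φ := fun _ _ _ => W)
          (⟨M.K _ _ (M.K _ _ (M.K _ _ W)), fun a b c => by simp only [hM.out.K_eq]⟩)
          exists_fst₃) exists_trd₃))
        (exists_snd₃ (M := M) (α := arr σ (arr τ (arr ρ₁ ρ₂))) (β := pairTy σ τ) (γ := ρ₁))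
      exact ⟨H, hH⟩
    exact ⟨H, fun G a b => El.ext fun c => by rw [hH, hU, hW]⟩

end Combinators

/-- A type of mathematical objects that are represented by elements of a finite type of `M`:
`rel a x` says that `a` represents `x`.  An object may have several representatives. -/
class Asm (M : TypeStructure.{u}) (X : Type*) where
  ty : FinType
  rel : M.El ty → X → Prop
  exists_rel : ∀ x : X, ∃ a, rel a x

instance (M : TypeStructure.{u}) (σ : FinType) : Asm M (M.El σ) := ⟨σ, Eq, fun x => ⟨x, rfl⟩⟩

/-- A truth value is represented by `0` if it is true, and by any other number if it is false. -/
instance (M : TypeStructure.{u}) [IsModel M] : Asm M Prop :=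
  ⟨nat, fun a p => a = 0 ↔ p, fun p => by
    by_cases hp : p
    · exact ⟨0, by simpa using hp⟩
    · exact ⟨1, by simpa using hp⟩⟩

instance (M : TypeStructure.{u}) [IsModel M] (X Y : Type*) [Asm M X] [Asm M Y] : Asm M (X × Y) :=
  ⟨pairTy (Asm.ty M X) (Asm.ty M Y), fun p x => ∃ a b, Asm.rel a x.1 ∧ Asm.rel b x.2 ∧
    p = mkPair a b, fun x => by
    obtain ⟨a, ha⟩ := Asm.exists_rel (M := M) x.1
    obtain ⟨b, hb⟩ := Asm.exists_rel (M := M) x.2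
    exact ⟨_, a, b, ha, hb, rfl⟩⟩

/-- `f` is represented by an element of `M`: some functional of `M` maps each representative of
`x` to a representative of `f x`.  For `f : X → Prop` this says that `f` has a characteristic
function in `M`. -/
@[fun_prop]
def Rep (M : TypeStructure.{u}) {X Y : Type*} [Asm M X] [Asm M Y] (f : X → Y) : Prop :=
  ∃ F : M.El (arr (Asm.ty M X) (Asm.ty M Y)), ∀ a x, Asm.rel a x → Asm.rel (F a) (f x)

open Classical in
/-- The element of `M` that represents `f`, if there is one. -/
noncomputable def lam {M : TypeStructure.{u}} {σ τ : FinType} (f : M.El σ → M.El τ) :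
    M.El (arr σ τ) :=
  Classical.epsilon fun F => ∀ a, F a = f a

namespace Rep

variable {M : TypeStructure.{u}} [hM : IsModel M] {X Y Z : Type*} [Asm M X] [Asm M Y] [Asm M Z]

@[fun_prop]
theorem id' : Rep M (fun x : X => x) := by
  obtain ⟨I, hI⟩ := exists_id (M := M) (Asm.ty M X)
  exact ⟨I, fun a x h => by rwa [hI]⟩

@[fun_prop]
theorem const (y : Y) : Rep M (fun _ : X => y) := by
  obtain ⟨b, hb⟩ := Asm.exists_rel (M := M) y
  exact ⟨M.K _ _ b, fun a x _ => by rwa [hM.out.K_eq]⟩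

@[fun_prop]
theorem comp {g : Y → Z} {f : X → Y} (hg : Rep M g) (hf : Rep M f) :
    Rep M (fun x => g (f x)) := by
  obtain ⟨F, hF⟩ := hf
  obtain ⟨G, hG⟩ := hg
  obtain ⟨H, hH⟩ := exists_app (exists_const G) ⟨F, fun _ => rfl⟩
  exact ⟨H, fun a x h => by rw [hH]; exact hG _ _ (hF _ _ h)⟩

@[fun_prop]
theorem prodMk {f : X → Y} {g : X → Z} (hf : Rep M f) (hg : Rep M g) :
    Rep M (fun x => (f x, g x)) := by
  obtain ⟨F, hF⟩ := hf
  obtain ⟨G, hG⟩ := hg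
  obtain ⟨H, hH⟩ := exists_app (exists_app
    (exists_const (exists_mkPair (M := M) (Asm.ty M Y) (Asm.ty M Z)).choose)
    ⟨F, fun _ => rfl⟩) ⟨G, fun _ => rfl⟩
  exact ⟨H, fun a x h => ⟨F a, G a, hF _ _ h, hG _ _ h, hH a⟩⟩

theorem fst' : Rep M (fun p : X × Y => p.1) := by
  obtain ⟨U, hU⟩ := exists_uncurry (M := M) (Asm.ty M X) (Asm.ty M Y) (Asm.ty M X)
  refine ⟨U (M.K _ _), ?_⟩
  rintro _ x ⟨a, b, ha, hb, rfl⟩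
  rwa [hU, hM.out.K_eq]

theorem snd' : Rep M (fun p : X × Y => p.2) := by
  obtain ⟨U, hU⟩ := exists_uncurry (M := M) (Asm.ty M X) (Asm.ty M Y) (Asm.ty M Y)
  obtain ⟨P, hP⟩ := exists_snd₂ (M := M) (α := Asm.ty M X) (β := Asm.ty M Y)
  refine ⟨U P, ?_⟩
  rintro _ x ⟨a, b, ha, hb, rfl⟩
  rwa [hU, hP]

@[fun_prop]
theorem fst {f : X → Y × Z} (hf : Rep M f) : Rep M (fun x => (f x).1) := fst'.comp hf

@[fun_prop]
theorem snd {f : X → Y × Z} (hf : Rep M f) : Rep M (fun x => (f x).2) := snd'.comp hf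

@[fun_prop]
theorem app {σ τ : FinType} {f : X → M.El (arr σ τ)} {g : X → M.El σ} (hf : Rep M f)
    (hg : Rep M g) : Rep M (fun x => f x (g x)) := by
  obtain ⟨F, hF⟩ := hf
  obtain ⟨G, hG⟩ := hg
  obtain ⟨H, hH⟩ := exists_app (M := M) ⟨F, fun _ => rfl⟩ ⟨G, fun _ => rfl⟩
  refine ⟨H, fun a x h => ?_⟩
  rw [hH]
  have h1 : F a = f x := hF _ _ h
  have h2 : G a = g x := hG _ _ h
  exact congr_arg₂ _ h1 h2

omit hM in
theorem lam_app {σ τ : FinType} {f : M.El σ → M.El τ} (hf : Rep M f) (a : M.El σ) :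
    lam f a = f a := by
  obtain ⟨F, hF⟩ := hf
  exact Classical.epsilon_spec (p := fun F : M.El (arr σ τ) => ∀ a, F a = f a)
    ⟨F, fun a => hF a a rfl⟩ a

@[fun_prop]
theorem lam {σ τ : FinType} {f : X → M.El σ → M.El τ}
    (hf : Rep M (fun p : X × M.El σ => f p.1 p.2)) :
    Rep M (fun x => TypeStructure.lam (f x)) := by
  have hfx : ∀ x, Rep M (f x) := fun x => comp (g := fun p : X × M.El σ => f p.1 p.2)
    hf (prodMk (const x) id')
  obtain ⟨F, hF⟩ := hf
  obtain ⟨H, hH⟩ := exists_app₂ (exists_const₂ F) (exists_app₂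
    (exists_app₂ (exists_const₂ (exists_mkPair (M := M) (Asm.ty M X) σ).choose) exists_fst₂)
    exists_snd₂)
  refine ⟨H, fun a x h => El.ext fun b => ?_⟩
  rw [lam_app (hfx x), hH]
  exact hF _ (x, b) ⟨a, b, h, rfl, rfl⟩

theorem curry_left {f : X → Y → Z} (hf : Rep M (fun p : X × Y => f p.1 p.2)) (x : X) :
    Rep M (f x) :=
  comp (g := fun p : X × Y => f p.1 p.2) hf (prodMk (const x) id')

end Rep

end TypeStructure

/-! ### Decidable relations, induction and recursion in the model -/

namespace TypeStructure

open FinType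

variable {M : TypeStructure.{u}} [hM : IsModel M]

/-- Quantifier-free formulas about a type `1` argument have characteristic functionals: this is
`QF-AC^{1,0}`, applied to the graph of the characteristic functional. -/
theorem exists_charFun (B : QF M FinType.one nat) (hB : ∀ f m n, B.Holds f m ↔ B.Holds f n) :
    ∃ Φ : M.El two, ∀ f, Φ f = 0 ↔ B.Holds f 0 := by
  obtain ⟨Φ, hΦ⟩ := hM.out.choice
    (.or (.and B (.eq .y (.param 0))) (.and (.not B) (.eq .y (.param 1)))) fun f => by
      by_cases h : B.Holds f 0
      · exact ⟨0, .inl ⟨h, rfl⟩⟩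
      · exact ⟨1, .inr ⟨fun h' => h ((hB _ _ _).1 h'), rfl⟩⟩
  refine ⟨Φ, fun f => ?_⟩
  rcases hΦ f with ⟨h, h'⟩ | ⟨h, h'⟩
  · exact iff_of_true h' ((hB _ _ _).1 h)
  · refine iff_of_false ?_ fun h'' => h ((hB _ _ _).1 h'')
    intro h0
    exact zero_ne_one (h0.symm.trans h')

/-- A sequence whose first two terms are `m` and `n`. -/
theorem exists_seq₂ : ∃ s : M.El (arr nat (arr nat FinType.one)), ∀ m n,
    s m n 0 = m ∧ s m n 1 = n := by
  obtain ⟨s, hs⟩ := exists_app₂ (M := M) (exists_app₂ (exists_const₂ M.R)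
    (exists_app₂ (exists_const₂ (M.K (arr nat nat) nat))
      (exists_app₂ (exists_const₂ (M.K nat nat)) (exists_snd₂ (M := M) (α := nat) (β := nat)))))
    exists_fst₂
  refine ⟨s, fun m n => ⟨by rw [hs, hM.out.R_zero], ?_⟩⟩
  rw [hs, ← zero_add (1 : M.N), hM.out.R_succ, hM.out.K_eq, hM.out.K_eq]

theorem rep_of_qf {B : QF M FinType.one nat} (hB : ∀ f m n, B.Holds f m ↔ B.Holds f n)
    {p : M.N → M.N → Prop} (hp : ∀ f n, B.Holds f n ↔ p (f 0) (f 1)) :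
    Rep M (fun x : M.N × M.N => p x.1 x.2) := by
  obtain ⟨Φ, hΦ⟩ := exists_charFun B hB
  obtain ⟨s, hs⟩ := exists_seq₂ (M := M)
  have h1 : Rep M (fun x : M.N × M.N => Φ (s x.1 x.2)) := by fun_prop
  obtain ⟨F, hF⟩ := h1
  refine ⟨F, fun a x h => ?_⟩
  have h2 : F a = Φ (s x.1 x.2) := hF a x h
  have h3 := hΦ (s x.1 x.2)
  rw [← h2, hp, (hs _ _).1, (hs _ _).2] at h3
  exact h3

namespace Rep

variable {X Y Z : Type*} [Asm M X] [Asm M Y] [Asm M Z]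

theorem comp₂ {W : Type*} [Asm M W] {φ : Y → Z → W} (h : Rep M (fun x : Y × Z => φ x.1 x.2))
    {f : X → Y} {g : X → Z} (hf : Rep M f) (hg : Rep M g) : Rep M (fun x => φ (f x) (g x)) :=
  h.comp (hf.prodMk hg)

omit hM in
theorem congr {f g : X → Y} (hf : Rep M f) (h : ∀ x, f x = g x) : Rep M g := by
  rwa [← funext h]

theorem congr_prop {p q : X → Prop} (hf : Rep M p) (h : ∀ x, p x ↔ q x) : Rep M q :=
  hf.congr fun x => propext (h x)

@[fun_prop]
theorem eq {f g : X → M.N} (hf : Rep M f) (hg : Rep M g) : Rep M (fun x => f x = g x) :=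
  comp₂ (φ := fun m n : M.N => m = n) (rep_of_qf
    (B := .eq (.app .x (.param 0)) (.app .x (.param 1))) (fun _ _ _ => Iff.rfl)
    (fun _ _ => Iff.rfl)) hf hg

@[fun_prop]
theorem lt {f g : X → M.N} (hf : Rep M f) (hg : Rep M g) : Rep M (fun x => f x < g x) :=
  comp₂ (φ := fun m n : M.N => m < n) (rep_of_qf
    (B := .lt (.app .x (.param 0)) (.app .x (.param 1))) (fun _ _ _ => Iff.rfl)
    (fun _ _ => Iff.rfl)) hf hg

/-- The numerical function that represents a predicate. -/
theorem exists_char {p : X → Prop} (hp : Rep M p) :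
    ∃ F : M.El (arr (Asm.ty M X) nat), ∀ a x, Asm.rel a x → (F a = 0 ↔ p x) := hp

@[fun_prop]
theorem not {p : X → Prop} (hp : Rep M p) : Rep M (fun x => ¬ p x) := by
  obtain ⟨F, hF⟩ := hp.exists_char
  have h : Rep M (fun a : M.El (Asm.ty M X) => ¬ F a = 0) :=
    (rep_of_qf (p := fun m n => ¬ m = n)
      (B := .not (.eq (.app .x (.param 0)) (.app .x (.param 1)))) (fun _ _ _ => Iff.rfl)
      (fun _ _ => Iff.rfl)).comp (g := fun x : M.N × M.N => ¬ x.1 = x.2)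
      (f := fun a : M.El (Asm.ty M X) => (F a, (0 : M.N))) (by fun_prop)
  obtain ⟨G, hG⟩ := h.exists_char
  exact ⟨G, fun a x hx => (hG a a rfl).trans (not_congr (hF a x hx))⟩

theorem and_aux : Rep M (fun x : M.N × M.N => x.1 = 0 ∧ x.2 = 0) :=
  rep_of_qf (p := fun m n => m = 0 ∧ n = 0)
    (B := .and (.eq (.app .x (.param 0)) (.param 0)) (.eq (.app .x (.param 1)) (.param 0)))
    (fun _ _ _ => Iff.rfl) (fun _ _ => Iff.rfl)

@[fun_prop]
theorem and {p q : X → Prop} (hp : Rep M p) (hq : Rep M q) : Rep M (fun x => p x ∧ q x) := by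
  obtain ⟨F, hF⟩ := hp.exists_char
  obtain ⟨G, hG⟩ := hq.exists_char
  have h : Rep M (fun a : M.El (Asm.ty M X) => F a = 0 ∧ G a = 0) :=
    and_aux.comp (f := fun a : M.El (Asm.ty M X) => (F a, G a)) (by fun_prop)
  obtain ⟨H, hH⟩ := h.exists_char
  exact ⟨H, fun a x hx => (hH a a rfl).trans (and_congr (hF a x hx) (hG a x hx))⟩

@[fun_prop]
theorem or {p q : X → Prop} (hp : Rep M p) (hq : Rep M q) : Rep M (fun x => p x ∨ q x) :=
  (hp.not.and hq.not).not.congr_prop fun x => by tauto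

theorem imp {p q : X → Prop} (hp : Rep M p) (hq : Rep M q) : Rep M (fun x => p x → q x) :=
  (hp.and hq.not).not.congr_prop fun x => by tauto

@[fun_prop]
theorem le {f g : X → M.N} (hf : Rep M f) (hg : Rep M g) : Rep M (fun x => f x ≤ g x) :=
  (hg.lt hf).not.congr_prop fun x => not_lt

@[fun_prop]
theorem add {f g : X → M.N} (hf : Rep M f) (hg : Rep M g) : Rep M (fun x => f x + g x) :=
  congr (f := fun x => M.plus (f x) (g x)) (by fun_prop) fun x => hM.out.plus_eq _ _

@[fun_prop]
theorem mul {f g : X → M.N} (hf : Rep M f) (hg : Rep M g) : Rep M (fun x => f x * g x) :=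
  congr (f := fun x => M.times (f x) (g x)) (by fun_prop) fun x => hM.out.times_eq _ _

end Rep

/-- Induction for predicates that have a characteristic function. -/
theorem induction_on {p : M.N → Prop} (hp : Rep M p) (zero : p 0)
    (succ : ∀ n, p n → p (n + 1)) (n : M.N) : p n := by
  obtain ⟨F, hF⟩ := hp.exists_char
  have hF' : ∀ n : M.N, (M.app (τ := nat) F n = 0) ↔ p n := fun n => hF n n rfl
  refine (hF' n).1 (hM.out.induction nat (.eq (.app (.param F) .y) (.param 0)) 0 ?_ ?_ n)
  · exact (hF' 0).2 zero
  · exact fun n h => (hF' _).2 (succ n ((hF' n).1 h))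

theorem zero_le_num (n : M.N) : 0 ≤ n :=
  induction_on (p := fun n => 0 ≤ n) (by fun_prop) le_rfl
    (fun n h => h.trans (le_add_of_nonneg_right zero_le_one)) n

theorem num_eq_zero_or_one_le (n : M.N) : n = 0 ∨ 1 ≤ n :=
  induction_on (p := fun n => n = 0 ∨ 1 ≤ n) (by fun_prop) (.inl rfl)
    (fun n _ => .inr (le_add_of_nonneg_left (zero_le_num n))) n

/-- Functions defined by primitive recursion are represented. -/
theorem exists_recursion {X : Type*} [Asm M X] {z : X → M.N} {s : X → M.N → M.N → M.N}
    (hz : Rep M z) (hs : Rep M (fun p : (X × M.N) × M.N => s p.1.1 p.1.2 p.2)) :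
    ∃ φ : X → M.N → M.N, Rep M (fun p : X × M.N => φ p.1 p.2) ∧ (∀ x, φ x 0 = z x) ∧
      ∀ x n, φ x (n + 1) = s x n (φ x n) := by
  refine ⟨fun x n => M.R (lam fun m => lam fun k => s x m k) (z x) n, ?_,
    fun x => hM.out.R_zero _ _, fun x n => ?_⟩
  · have h1 := hs.comp (f := fun q : ((X × M.N) × M.N) × M.N => ((q.1.1.1, q.1.2), q.2))
      (by fun_prop)
    have h2 : Rep M (fun p : X × M.N => lam fun m => lam fun k => s p.1 m k) :=
      Rep.lam (Rep.lam h1)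
    beta_reduce
    fun_prop
  · have h1 : Rep M (fun p : M.N × M.N => s x p.1 p.2) := hs.comp
      (f := fun p : M.N × M.N => ((x, p.1), p.2)) (by fun_prop)
    beta_reduce
    rw [hM.out.R_succ, Rep.lam_app (f := fun m => lam fun k => s x m k) h1.lam,
      Rep.lam_app (h1.curry_left _)]

/-- The predecessor and, by iterating it, truncated subtraction are primitive recursive. -/
theorem exists_truncatedSub : ∃ φ : M.N → M.N → M.N, Rep M (fun p : M.N × M.N => φ p.1 p.2) ∧
    (∀ m, φ m 0 = m) ∧ ∀ m n, φ m (n + 1) + 1 = φ m n ∨ φ m (n + 1) = 0 ∧ φ m n = 0 := by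
  obtain ⟨pred, hpred, h0, hs⟩ := exists_recursion (M := M) (X := M.N) (z := fun _ => 0)
    (s := fun _ n _ => n) (by fun_prop) (by fun_prop)
  obtain ⟨φ, hφ, hφ0, hφs⟩ := exists_recursion (M := M) (X := M.N) (z := fun m => m)
    (s := fun _ _ k => pred 0 k) (by fun_prop)
    ((hpred.curry_left 0).comp (f := fun p : (M.N × M.N) × M.N => p.2) (by fun_prop))
  refine ⟨φ, hφ, hφ0, fun m n => ?_⟩
  rw [hφs]
  exact induction_on (p := fun k => pred 0 k + 1 = k ∨ pred 0 k = 0 ∧ k = 0)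
    (by have := hpred.curry_left 0; fun_prop) (.inr ⟨h0 0, rfl⟩)
    (fun k _ => .inl (by rw [hs])) _

theorem num_exists_add {m n : M.N} (h : m ≤ n) : ∃ k, n = m + k := by
  obtain ⟨φ, hφ, h0, hs⟩ := exists_truncatedSub (M := M)
  have := hφ.curry_left n
  refine ⟨φ n m, ?_⟩
  revert h
  refine induction_on (p := fun m => m ≤ n → n = m + φ n m) ?_ ?_ ?_ m
  · exact Rep.imp (by fun_prop) (by fun_prop)
  · intro _
    rw [h0, zero_add]
  · intro k ih hk
    have hk' := ih (le_trans (le_add_of_nonneg_right zero_le_one) hk)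
    rcases hs n k with h | ⟨_, h⟩
    · calc n = k + φ n k := hk'
        _ = k + (φ n (k + 1) + 1) := by rw [h]
        _ = _ := by ring
    · rw [h, add_zero] at hk'
      exact absurd (hk'.le.trans_lt (lt_add_of_pos_right k one_pos)) hk.not_gt

instance : ExistsAddOfLE M.N := ⟨num_exists_add⟩

theorem num_lt_add_one {m n : M.N} : m < n + 1 ↔ m ≤ n := by
  refine ⟨fun h => ?_, fun h => lt_of_le_of_lt h (lt_add_of_pos_right _ one_pos)⟩
  obtain ⟨k, hk⟩ := exists_add_of_le h.le
  rcases num_eq_zero_or_one_le k with rfl | h1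
  · rw [add_zero] at hk
    exact absurd hk h.ne'
  · exact le_of_add_le_add_right (hk ▸ add_le_add_right h1 m)

theorem num_add_one_le {m n : M.N} : m + 1 ≤ n ↔ m < n := by
  rw [← not_lt, num_lt_add_one, not_le]

end TypeStructure

/-! ### Arithmetical comprehension from `(∃²)` -/

namespace TypeStructure

open FinType

/-- Kleene's quantifier `(∃²)`, as an instance argument. -/
class HasE2 (M : TypeStructure.{u}) : Prop where
  out : M.KleeneE2

/-- Kleene's quantifier `(∃³)`, as an instance argument. -/
class HasE3 (M : TypeStructure.{u}) : Prop where
  out : M.KleeneE3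

variable {M : TypeStructure.{u}} [hM : IsModel M]

namespace Rep

variable {X Y Z : Type*} [Asm M X] [Asm M Y] [Asm M Z]

/-- A numerical function that is `0` exactly where `p` holds. -/
noncomputable def _root_.TypeStructure.chi (p : Prop) : M.N :=
  open Classical in if p then 0 else 1

theorem chi_eq_zero {p : Prop} : (chi p : M.N) = 0 ↔ p := by
  unfold chi
  split_ifs with h <;> simp [h]

/-- If-then-else on numbers, by primitive recursion. -/
@[fun_prop]
theorem ite {p : X → Prop} [∀ x, Decidable (p x)] {f g : X → M.N} (hp : Rep M p) (hf : Rep M f)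
    (hg : Rep M g) : Rep M (fun x => if p x then f x else g x) := by
  obtain ⟨φ, hφ, h0, hs⟩ := exists_recursion (M := M) (X := M.N × M.N) (z := fun p => p.1)
    (s := fun p _ _ => p.2) (by fun_prop) (by fun_prop)
  have h : Rep M (fun q : M.N × (M.N × M.N) => φ q.2 q.1) :=
    hφ.comp (f := fun q : M.N × (M.N × M.N) => (q.2, q.1)) (by fun_prop)
  have key : ∀ (n : M.N) (q : M.N × M.N), (n = 0 → φ q n = q.1) ∧ (n ≠ 0 → φ q n = q.2) := by
    intro n q
    refine ⟨fun h => by rw [h, h0], fun hn => ?_⟩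
    obtain ⟨k, rfl⟩ := exists_add_of_le ((num_eq_zero_or_one_le n).resolve_left hn)
    rw [add_comm, hs]
  obtain ⟨P, hP⟩ := hp.exists_char
  have h2 : Rep M (fun q : M.El (Asm.ty M X) × (M.N × M.N) => φ q.2 (P q.1)) :=
    hφ.comp (f := fun q : M.El (Asm.ty M X) × (M.N × M.N) => (q.2, M.app (τ := nat) P q.1))
      (by fun_prop)
  obtain ⟨H, hH⟩ := h2
  obtain ⟨G, hG⟩ := (id' (M := M) (X := X)).prodMk (hf.prodMk hg)
  obtain ⟨J, hJ⟩ := exists_app (exists_const H) ⟨G, fun _ => rfl⟩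
  refine ⟨J, fun a x hx => ?_⟩
  obtain ⟨b, c, hb, hc, e⟩ := hG a x hx
  rw [hJ]
  have h3 : M.app H (M.app G a) = φ (f x, g x) (P b) := hH (M.app G a) (b, (f x, g x))
    ⟨b, c, rfl, hc, e⟩
  change M.app H (M.app G a) = if p x then f x else g x
  have h4 := hP b x hb
  rw [h3]
  split_ifs with hpx
  · exact (key _ _).1 (h4.2 hpx)
  · exact (key _ _).2 (mt h4.1 hpx)

@[fun_prop]
theorem chi {p : X → Prop} (hp : Rep M p) : Rep M (fun x => (TypeStructure.chi (p x) : M.N)) := by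
  classical
  have := ite hp (const (0 : M.N)) (const (1 : M.N))
  exact this.congr fun x => by unfold TypeStructure.chi; congr

section E2

variable [hE : HasE2 M]

@[fun_prop]
theorem exists_num {p : X → M.N → Prop} (hp : Rep M (fun q : X × M.N => p q.1 q.2)) :
    Rep M (fun x => ∃ n, p x n) := by
  obtain ⟨E, hE⟩ := hE.out
  refine congr_prop (p := fun x => E (TypeStructure.lam fun n => TypeStructure.chi (p x n)) = 0)
    (by fun_prop) fun x => ?_
  have hx := hp.curry_left x
  have : ∀ n, (TypeStructure.lam fun n => TypeStructure.chi (p x n) : M.El one) n =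
    TypeStructure.chi (p x n) := fun n => lam_app (by fun_prop) n
  rw [hE]
  simp only [this, chi_eq_zero]

theorem forall_num {p : X → M.N → Prop} (hp : Rep M (fun q : X × M.N => p q.1 q.2)) :
    Rep M (fun x => ∀ n, p x n) :=
  (exists_num (p := fun x n => ¬ p x n) hp.not).not.congr_prop fun x => by push Not; rfl

/-- A numerical function with a representable graph is representable. -/
theorem of_graph {f : X → M.N} (hf : Rep M (fun q : X × M.N => f q.1 = q.2)) : Rep M f := by
  obtain ⟨E, hE⟩ := hE.out
  obtain ⟨μ, hμ⟩ := hM.out.choice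
    (.or (.eq (.app .x .y) (.param 0)) (.not (.eq (.app (.param E) .x) (.param 0)))) fun g => by
      by_cases h : E g = 0
      · obtain ⟨n, hn⟩ := (hE g).1 h
        exact ⟨n, .inl hn⟩
      · exact ⟨0, .inr h⟩
  have hμ' : ∀ g : M.El one, g (μ g) = 0 ∨ ¬ E g = 0 := hμ
  have h1 : Rep M (fun x => μ (TypeStructure.lam fun n => TypeStructure.chi (f x = n))) := by
    fun_prop
  refine h1.congr fun x => ?_
  have hx := curry_left (f := fun x n => f x = n) hf x
  have h2 : ∀ n, (TypeStructure.lam fun n => TypeStructure.chi (f x = n) : M.El one) n =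
    TypeStructure.chi (f x = n) := fun n => lam_app (by fun_prop) n
  rcases hμ' (TypeStructure.lam fun n => TypeStructure.chi (f x = n)) with h | h
  · rw [h2, chi_eq_zero] at h
    exact h.symm
  · refine absurd ((hE _).2 ⟨f x, ?_⟩) h
    rw [h2, chi_eq_zero]

end E2

theorem exists_one [hE : HasE3 M] {p : X → M.El one → Prop}
    (hp : Rep M (fun q : X × M.El one => p q.1 q.2)) : Rep M (fun x => ∃ f, p x f) := by
  obtain ⟨E, hE⟩ := hE.out
  refine congr_prop (p := fun x => E (TypeStructure.lam fun f => TypeStructure.chi (p x f)) = 0)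
    (by fun_prop) fun x => ?_
  have hx := hp.curry_left x
  have : ∀ f, (TypeStructure.lam fun f => TypeStructure.chi (p x f) : M.El two) f =
    TypeStructure.chi (p x f) := fun f => lam_app (by fun_prop) f
  rw [hE]
  simp only [this, chi_eq_zero]

theorem forall_one [hE : HasE3 M] {p : X → M.El one → Prop}
    (hp : Rep M (fun q : X × M.El one => p q.1 q.2)) : Rep M (fun x => ∀ f, p x f) :=
  (exists_one (p := fun x f => ¬ p x f) hp.not).not.congr_prop fun x => by push Not; rfl

end Rep

/-- `(∃³)` implies `(∃²)`. -/
theorem KleeneE3.kleeneE2 (h : M.KleeneE3) : M.KleeneE2 := by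
  obtain ⟨E, hE⟩ := h
  have h1 : Rep M (fun q : M.El one × M.El one => q.1 (q.2 0)) := by fun_prop
  have h2 : Rep M (fun f : M.El one => E (lam fun g : M.El one => f (g 0))) := by fun_prop
  refine ⟨lam fun f => E (lam fun g : M.El one => f (g 0)), fun f => ?_⟩
  rw [Rep.lam_app h2, hE]
  have h3 : ∀ g, (lam fun g : M.El one => f (g 0)) g = f (g 0) :=
    Rep.lam_app (Rep.curry_left (f := fun (f g : M.El one) => f (g 0)) h1 f)
  simp only [h3]
  constructor
  · rintro ⟨g, hg⟩
    exact ⟨_, hg⟩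
  · rintro ⟨n, hn⟩
    exact ⟨M.K _ _ n, by rwa [hM.out.K_eq]⟩

section E2

variable [HasE2 M]

/-- A predicate with a characteristic function that holds for some number holds for a least one. -/
theorem exists_least {p : M.N → Prop} (hp : Rep M p) (h : ∃ n, p n) :
    ∃ n, p n ∧ ∀ m < n, ¬ p m := by
  by_contra! hcon
  obtain ⟨n, hn⟩ := h
  have hrep : Rep M (fun n => ∀ m, m < n → ¬ p m) :=
    Rep.forall_num (Rep.imp (by fun_prop) (by fun_prop))
  have : ∀ n, ∀ m, m < n → ¬ p m := induction_on hrep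
    (fun m hm => absurd (zero_le_num m) hm.not_ge) fun n ih m hm h => by
      obtain ⟨m', h1, h2⟩ := hcon m h
      exact ih m' (lt_of_lt_of_le h1 (num_lt_add_one.1 hm)) h2
  exact this (n + 1) n (num_lt_add_one.2 le_rfl) hn

/-- The least number with the property `p`, and `0` if there is none. -/
noncomputable def least (p : M.N → Prop) : M.N :=
  open Classical in if h : ∃ n, p n ∧ ∀ m < n, ¬ p m then h.choose else 0

theorem least_spec {p : M.N → Prop} (hp : Rep M p) (h : ∃ n, p n) : p (least p) := by
  have h' := exists_least hp h
  unfold least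
  rw [dif_pos h']
  exact h'.choose_spec.1

theorem least_le {p : M.N → Prop} {n : M.N} (hp : Rep M p) (h : p n) : least p ≤ n := by
  have h' := exists_least hp ⟨n, h⟩
  unfold least
  rw [dif_pos h']
  exact not_lt.1 fun hlt => h'.choose_spec.2 n hlt h

theorem Rep.least {X : Type*} [Asm M X] {p : X → M.N → Prop}
    (hp : Rep M (fun q : X × M.N => p q.1 q.2)) :
    Rep M (fun x => TypeStructure.least (p x)) := by
  have h1 : Rep M (fun q : (X × M.N) × M.N => p q.1.1 q.2) :=
    hp.comp (f := fun q : (X × M.N) × M.N => (q.1.1, q.2)) (by fun_prop)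
  have h2 : Rep M (fun q : X × M.N => (p q.1 q.2 ∧ ∀ m, m < q.2 → ¬ p q.1 m) ∨
      (¬ ∃ m, p q.1 m) ∧ q.2 = 0) := by
    refine (hp.and (Rep.forall_num (Rep.imp ?_ ?_))).or ((Rep.exists_num ?_).not.and ?_)
    all_goals fun_prop
  refine Rep.of_graph (h2.congr_prop fun q => ?_)
  have hpq := hp.curry_left q.1
  constructor
  · rintro (⟨h, h'⟩ | ⟨h, h'⟩)
    · refine le_antisymm (least_le hpq h) (not_lt.1 fun hlt => h' _ hlt (least_spec hpq ⟨_, h⟩))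
    · unfold TypeStructure.least
      rw [dif_neg fun ⟨m, hm, _⟩ => h ⟨m, hm⟩, h']
  · intro h
    by_cases hex : ∃ m, p q.1 m
    · refine .inl ⟨h ▸ least_spec hpq hex, fun m hm hpm => ?_⟩
      exact absurd (least_le hpq hpm) (h ▸ hm.not_ge)
    · refine .inr ⟨hex, ?_⟩
      unfold TypeStructure.least at h
      rwa [dif_neg fun ⟨m, hm, _⟩ => hex ⟨m, hm⟩, eq_comm] at h

end E2

end TypeStructure

/-! ### Cauchy completion of an ordered field along a linear order -/

namespace OrderedCompletion

variable {I K : Type*} [LinearOrder I] [Nonempty I] [Field K] [LinearOrder K]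
  [IsStrictOrderedRing K]

/-- `v` is a Cauchy sequence. -/
def IsCau (v : I → K) : Prop := ∀ ε > 0, ∃ m, ∀ n ≥ m, ∀ n' ≥ m, |v n - v n'| < ε

/-- `v` converges to zero. -/
def IsNull (v : I → K) : Prop := ∀ ε > 0, ∃ m, ∀ n ≥ m, |v n| < ε

namespace IsCau

omit [Nonempty I] in
theorem bounded {v : I → K} (hv : IsCau v) : ∃ B > 0, ∃ m, ∀ n ≥ m, |v n| < B := by
  obtain ⟨m, hm⟩ := hv 1 one_pos
  refine ⟨|v m| + 1, by positivity, m, fun n hn => ?_⟩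
  have := hm n hn m le_rfl
  have h2 := abs_sub_abs_le_abs_sub (v n) (v m)
  linarith

theorem const (c : K) : IsCau (fun _ : I => c) := fun ε hε =>
  ⟨Classical.arbitrary I, fun _ _ _ _ => by simpa using hε⟩

omit [Nonempty I] [IsStrictOrderedRing K] in
theorem neg {v : I → K} (hv : IsCau v) : IsCau (fun n => -v n) := fun ε hε => by
  obtain ⟨m, hm⟩ := hv ε hε
  refine ⟨m, fun n hn n' hn' => ?_⟩
  rw [show -v n - -v n' = v n' - v n by ring, abs_sub_comm]
  exact hm n hn n' hn'

omit [Nonempty I] in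
theorem add {v w : I → K} (hv : IsCau v) (hw : IsCau w) : IsCau (fun n => v n + w n) :=
  fun ε hε => by
  obtain ⟨m, hm⟩ := hv (ε / 2) (by positivity)
  obtain ⟨m', hm'⟩ := hw (ε / 2) (by positivity)
  refine ⟨max m m', fun n hn n' hn' => ?_⟩
  have h1 := hm n (le_of_max_le_left hn) n' (le_of_max_le_left hn')
  have h2 := hm' n (le_of_max_le_right hn) n' (le_of_max_le_right hn')
  rw [abs_lt] at *
  constructor <;> linarith

omit [Nonempty I] in
theorem mul {v w : I → K} (hv : IsCau v) (hw : IsCau w) : IsCau (fun n => v n * w n) :=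
  fun ε hε => by
  obtain ⟨A, hA, a, ha⟩ := hv.bounded
  obtain ⟨B, hB, b, hb⟩ := hw.bounded
  obtain ⟨m, hm⟩ := hv (ε / (2 * B)) (by positivity)
  obtain ⟨m', hm'⟩ := hw (ε / (2 * A)) (by positivity)
  refine ⟨max (max m m') (max a b), fun n hn n' hn' => ?_⟩
  simp only [ge_iff_le, max_le_iff] at hn hn'
  have e : v n * w n - v n' * w n' = v n * (w n - w n') + (v n - v n') * w n' := by ring
  have h1 : |v n * (w n - w n')| < A * (ε / (2 * A)) := by
    rw [abs_mul]
    exact mul_lt_mul'' (ha n hn.2.1) (hm' n hn.1.2 n' hn'.1.2) (abs_nonneg _) (abs_nonneg _)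
  have h2 : |(v n - v n') * w n'| < ε / (2 * B) * B := by
    rw [abs_mul]
    exact mul_lt_mul'' (hm n hn.1.1 n' hn'.1.1) (hb n' hn'.2.2) (abs_nonneg _) (abs_nonneg _)
  have h3 : A * (ε / (2 * A)) = ε / 2 := by field_simp
  have h4 : ε / (2 * B) * B = ε / 2 := by field_simp
  rw [e]
  calc _ ≤ _ := abs_add_le _ _
    _ < ε := by linarith

omit [Nonempty I] in
theorem sub {v w : I → K} (hv : IsCau v) (hw : IsCau w) : IsCau (fun n => v n - w n) := by
  simpa only [sub_eq_add_neg] using hv.add hw.neg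

omit [Nonempty I] in
theorem abs {v : I → K} (hv : IsCau v) : IsCau (fun n => |v n|) := fun ε hε => by
  obtain ⟨m, hm⟩ := hv ε hε
  exact ⟨m, fun n hn n' hn' => (abs_abs_sub_abs_le_abs_sub _ _).trans_lt (hm n hn n' hn')⟩

end IsCau

variable (I K) in
/-- The ring of Cauchy sequences. -/
def cauRing : Subring (I → K) where
  carrier := {v | IsCau v}
  mul_mem' := IsCau.mul
  one_mem' := IsCau.const 1
  add_mem' := IsCau.add
  zero_mem' := IsCau.const 0
  neg_mem' := IsCau.neg

variable (I K) in
/-- The ideal of null sequences. -/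
def nullIdeal : Ideal (cauRing I K) where
  carrier := {v | IsNull v.1}
  zero_mem' := fun ε hε => ⟨Classical.arbitrary I, fun _ _ => by simpa using hε⟩
  add_mem' := fun {v w} hv hw ε hε => by
    obtain ⟨m, hm⟩ := hv (ε / 2) (by positivity)
    obtain ⟨m', hm'⟩ := hw (ε / 2) (by positivity)
    refine ⟨max m m', fun n hn => ?_⟩
    have h1 := hm n (le_of_max_le_left hn)
    have h2 := hm' n (le_of_max_le_right hn)
    calc _ ≤ |v.1 n| + |w.1 n| := abs_add_le _ _
      _ < ε := by linarith
  smul_mem' := fun v w hw ε hε => by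
    obtain ⟨B, hB, b, hb⟩ := v.2.bounded
    obtain ⟨m, hm⟩ := hw (ε / B) (by positivity)
    refine ⟨max b m, fun n hn => ?_⟩
    have h1 := hm n (le_of_max_le_right hn)
    have h2 := hb n (le_of_max_le_left hn)
    have h3 : B * (ε / B) = ε := by field_simp
    calc |v.1 n * w.1 n| = |v.1 n| * |w.1 n| := abs_mul _ _
      _ < B * (ε / B) := mul_lt_mul'' h2 h1 (abs_nonneg _) (abs_nonneg _)
      _ = ε := h3

omit [Nonempty I] in
theorem exists_bound_of_not_null {v : I → K} (hv : IsCau v) (h : ¬ IsNull v) :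
    ∃ ε > 0, ∃ m, ∀ n ≥ m, ε ≤ |v n| := by
  unfold IsNull at h
  push Not at h
  obtain ⟨ε, hε, h⟩ := h
  obtain ⟨m, hm⟩ := hv (ε / 2) (by positivity)
  obtain ⟨k, hk, hk'⟩ := h m
  refine ⟨ε / 2, by positivity, m, fun n hn => ?_⟩
  have h1 := hm k hk n hn
  have h2 := abs_sub_abs_le_abs_sub (v k) (v n)
  linarith

instance : (nullIdeal I K).IsPrime := by
  refine ⟨fun h => ?_, fun {v w} h => ?_⟩
  · have h1 : (1 : cauRing I K) ∈ nullIdeal I K := h ▸ Submodule.mem_top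
    obtain ⟨m, hm⟩ := h1 1 one_pos
    have := hm m le_rfl
    simp at this
  · by_contra! hcon
    obtain ⟨δ, hδ, a, ha⟩ := exists_bound_of_not_null v.2 hcon.1
    refine hcon.2 fun ε hε => ?_
    obtain ⟨m, hm⟩ := h (δ * ε) (by positivity)
    refine ⟨max a m, fun n hn => ?_⟩
    have h1 := ha n (le_of_max_le_left hn)
    have h2 : |v.1 n * w.1 n| < δ * ε := hm n (le_of_max_le_right hn)
    rw [abs_mul] at h2
    by_contra! h3
    exact absurd h2 (mul_le_mul h1 h3 hε.le (abs_nonneg _)).not_gt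

variable (I K) in
/-- The completion: Cauchy sequences modulo null sequences. -/
def Compl : Type _ := cauRing I K ⧸ nullIdeal I K

noncomputable instance : CommRing (Compl I K) :=
  inferInstanceAs (CommRing (cauRing I K ⧸ nullIdeal I K))

instance : IsDomain (Compl I K) := inferInstanceAs (IsDomain (cauRing I K ⧸ nullIdeal I K))

/-- The class of a Cauchy sequence. -/
noncomputable def mk (v : cauRing I K) : Compl I K := Ideal.Quotient.mk (nullIdeal I K) v

theorem exists_mk (x : Compl I K) : ∃ v, x = mk v := by
  obtain ⟨v, rfl⟩ := Ideal.Quotient.mk_surjective x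
  exact ⟨v, rfl⟩

theorem mk_eq {v w : cauRing I K} : mk v = mk w ↔ IsNull (fun n => v.1 n - w.1 n) :=
  Ideal.Quotient.eq

theorem mk_neg (v : cauRing I K) : mk (-v) = -mk v := rfl

theorem mk_mul (v w : cauRing I K) : mk (v * w) = mk v * mk w := rfl

/-- The limit `x` is nonnegative. -/
def Nonneg (x : Compl I K) : Prop := ∃ v, x = mk v ∧ ∀ ε > 0, ∃ m, ∀ n ≥ m, -ε < v.1 n

theorem nonneg_mk {v : cauRing I K} : Nonneg (mk v) ↔ ∀ ε > 0, ∃ m, ∀ n ≥ m, -ε < v.1 n := by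
  refine ⟨?_, fun h => ⟨v, rfl, h⟩⟩
  rintro ⟨w, e, h⟩ ε hε
  obtain ⟨m, hm⟩ := h (ε / 2) (by positivity)
  obtain ⟨m', hm'⟩ := mk_eq.1 e (ε / 2) (by positivity)
  refine ⟨max m m', fun n hn => ?_⟩
  have h1 := hm n (le_of_max_le_left hn)
  have h2 := (abs_lt.1 (hm' n (le_of_max_le_right hn))).1
  linarith

theorem Nonneg.add (x y : Compl I K) (hx : Nonneg x) (hy : Nonneg y) : Nonneg (x + y) := by
  obtain ⟨v, rfl, hv⟩ := hx
  obtain ⟨w, rfl, hw⟩ := hy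
  refine ⟨v + w, rfl, fun ε hε => ?_⟩
  obtain ⟨m, hm⟩ := hv (ε / 2) (by positivity)
  obtain ⟨m', hm'⟩ := hw (ε / 2) (by positivity)
  refine ⟨max m m', fun n hn => ?_⟩
  have h1 := hm n (le_of_max_le_left hn)
  have h2 := hm' n (le_of_max_le_right hn)
  change -ε < v.1 n + w.1 n
  linarith

theorem nonneg_zero : Nonneg (0 : Compl I K) :=
  ⟨0, rfl, fun ε hε => ⟨Classical.arbitrary I, fun _ _ => neg_lt_zero.2 hε⟩⟩

theorem nonneg_one : Nonneg (1 : Compl I K) :=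
  ⟨1, rfl, fun ε hε => ⟨Classical.arbitrary I, fun _ _ =>
    (neg_lt_zero.2 hε).trans_le zero_le_one⟩⟩

theorem Nonneg.antisymm (x : Compl I K) (hx : Nonneg x) (hx' : Nonneg (-x)) : x = 0 := by
  obtain ⟨v, rfl⟩ := exists_mk x
  rw [← mk_neg] at hx'
  rw [nonneg_mk] at hx hx'
  refine (mk_eq (w := 0)).2 fun ε hε => ?_
  obtain ⟨m, hm⟩ := hx ε hε
  obtain ⟨m', hm'⟩ := hx' ε hε
  refine ⟨max m m', fun n hn => ?_⟩
  have h1 := hm n (le_of_max_le_left hn)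
  have h2 : -ε < -v.1 n := hm' n (le_of_max_le_right hn)
  change |v.1 n - 0| < ε
  rw [abs_lt]
  constructor <;> linarith

theorem nonneg_total (x : Compl I K) : Nonneg x ∨ Nonneg (-x) := by
  obtain ⟨v, rfl⟩ := exists_mk x
  by_cases h : Nonneg (mk v)
  · exact .inl h
  · right
    rw [nonneg_mk] at h
    push Not at h
    obtain ⟨ε, hε, h⟩ := h
    obtain ⟨m, hm⟩ := v.2 ε hε
    obtain ⟨k, hk, hk'⟩ := h m
    refine ⟨-v, rfl, fun δ hδ => ⟨m, fun n hn => ?_⟩⟩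
    have := (abs_lt.1 (hm n hn k hk)).2
    change -δ < -v.1 n
    linarith

theorem Nonneg.mul (x y : Compl I K) (hx : Nonneg x) (hy : Nonneg y) : Nonneg (x * y) := by
  obtain ⟨v, rfl⟩ := exists_mk x
  obtain ⟨w, rfl⟩ := exists_mk y
  rw [nonneg_mk] at hx hy
  rw [← mk_mul, nonneg_mk]
  intro ε hε
  obtain ⟨A, hA, a, ha⟩ := v.2.bounded
  obtain ⟨B, hB, b, hb⟩ := w.2.bounded
  have hδ : 0 < ε / (A + B) := by positivity
  obtain ⟨m, hm⟩ := hx _ hδ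
  obtain ⟨m', hm'⟩ := hy _ hδ
  refine ⟨max (max m m') (max a b), fun n hn => ?_⟩
  simp only [ge_iff_le, max_le_iff] at hn
  have h1 := hm n hn.1.1
  have h2 := hm' n hn.1.2
  have h3 := abs_lt.1 (ha n hn.2.1)
  have h4 := abs_lt.1 (hb n hn.2.2)
  have e : ε / (A + B) * A + ε / (A + B) * B = ε := by field_simp
  change -ε < v.1 n * w.1 n
  generalize ε / (A + B) = δ at *
  rcases le_or_gt 0 (v.1 n) with hv | hv <;> rcases le_or_gt 0 (w.1 n) with hw | hw
  · nlinarith [mul_nonneg hv hw]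
  · nlinarith [mul_nonneg hv (by linarith : 0 ≤ w.1 n + δ), mul_pos hδ hB,
      mul_lt_mul_of_pos_left h3.2 hδ]
  · nlinarith [mul_nonneg hw (by linarith : 0 ≤ v.1 n + δ), mul_pos hδ hA,
      mul_lt_mul_of_pos_left h4.2 hδ]
  · nlinarith [mul_pos_of_neg_of_neg hv hw]

noncomputable instance : LinearOrder (Compl I K) :=
  linearOrderOfNonneg Nonneg Nonneg.add nonneg_zero Nonneg.antisymm nonneg_total

instance : IsStrictOrderedRing (Compl I K) :=
  isStrictOrderedRing_of_nonneg Nonneg Nonneg.add nonneg_zero Nonneg.antisymm nonneg_total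
    Nonneg.mul nonneg_one

open Classical in
/-- The limit of a Cauchy sequence (and `0` for other sequences). -/
noncomputable def lim (v : I → K) : Compl I K := if h : IsCau v then mk ⟨v, h⟩ else 0

section Lim

variable {v w : I → K}

theorem lim_of (hv : IsCau v) : lim v = mk ⟨v, hv⟩ := dif_pos hv

theorem lim_add (hv : IsCau v) (hw : IsCau w) : lim (fun n => v n + w n) = lim v + lim w := by
  rw [lim_of hv, lim_of hw, lim_of (hv.add hw)]
  rfl

theorem lim_neg (hv : IsCau v) : lim (fun n => -v n) = -lim v := by
  rw [lim_of hv, lim_of hv.neg]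
  rfl

theorem lim_mul (hv : IsCau v) (hw : IsCau w) : lim (fun n => v n * w n) = lim v * lim w := by
  rw [lim_of hv, lim_of hw, lim_of (hv.mul hw)]
  rfl

theorem lim_sub (hv : IsCau v) (hw : IsCau w) : lim (fun n => v n - w n) = lim v - lim w := by
  simp only [sub_eq_add_neg]
  rw [lim_add hv hw.neg, lim_neg hw]

theorem lim_le (hv : IsCau v) (hw : IsCau w) :
    lim v ≤ lim w ↔ ∀ ε > 0, ∃ m, ∀ n ≥ m, v n < w n + ε := by
  have h : lim v ≤ lim w ↔ Nonneg (lim w - lim v) := Iff.rfl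
  rw [h, ← lim_sub hw hv, lim_of (hw.sub hv), nonneg_mk]
  refine forall₂_congr fun ε hε => exists_congr fun m => forall₂_congr fun n hn => ?_
  constructor <;> intro h <;> linarith

theorem lim_lt (hv : IsCau v) (hw : IsCau w) :
    lim v < lim w ↔ ∃ ε > 0, ∃ m, ∀ n ≥ m, v n + ε < w n := by
  rw [← not_le, lim_le hw hv]
  push Not
  constructor
  · rintro ⟨ε, hε, h⟩
    obtain ⟨m, hm⟩ := hv (ε / 4) (by positivity)
    obtain ⟨m', hm'⟩ := hw (ε / 4) (by positivity)
    obtain ⟨k, hk, hk'⟩ := h (max m m')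
    refine ⟨ε / 4, by positivity, max m m', fun n hn => ?_⟩
    have h1 := abs_lt.1 (hm n (le_of_max_le_left hn) k (le_of_max_le_left hk))
    have h2 := abs_lt.1 (hm' n (le_of_max_le_right hn) k (le_of_max_le_right hk))
    linarith
  · rintro ⟨ε, hε, m, hm⟩
    refine ⟨ε, hε, fun m' => ⟨max m m', le_max_right _ _, (hm _ (le_max_left _ _)).le⟩⟩

theorem lim_eq (hv : IsCau v) (hw : IsCau w) :
    lim v = lim w ↔ ∀ ε > 0, ∃ m, ∀ n ≥ m, |v n - w n| < ε := by
  rw [lim_of hv, lim_of hw, mk_eq]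
  rfl

theorem lim_abs (hv : IsCau v) : lim (fun n => |v n|) = |lim v| := by
  rcases le_total (lim fun _ => 0) (lim v) with h | h
  · rw [abs_of_nonneg (a := lim v) (by rwa [lim_of (IsCau.const 0)] at h), lim_eq hv.abs hv]
    intro ε hε
    obtain ⟨m, hm⟩ := (lim_le (IsCau.const 0) hv).1 h (ε / 2) (by positivity)
    refine ⟨m, fun n hn => ?_⟩
    have := hm n hn
    rcases abs_cases (v n) with ⟨h1, h2⟩ | ⟨h1, h2⟩ <;> rw [h1, abs_lt] <;>
      constructor <;> linarith
  · rw [abs_of_nonpos (a := lim v) (by rwa [lim_of (IsCau.const 0)] at h), ← lim_neg hv,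
      lim_eq hv.abs hv.neg]
    intro ε hε
    obtain ⟨m, hm⟩ := (lim_le hv (IsCau.const 0)).1 h (ε / 2) (by positivity)
    refine ⟨m, fun n hn => ?_⟩
    have := hm n hn
    rcases abs_cases (v n) with ⟨h1, h2⟩ | ⟨h1, h2⟩ <;> rw [h1, abs_lt] <;>
      constructor <;> linarith

end Lim

variable (I) in
/-- The embedding of the field in its completion, by constant sequences. -/
noncomputable def const : K →+* Compl I K where
  toFun c := lim fun _ => c
  map_one' := lim_of (IsCau.const 1)
  map_zero' := lim_of (IsCau.const 0)
  map_add' a b := lim_add (IsCau.const a) (IsCau.const b)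
  map_mul' a b := lim_mul (IsCau.const a) (IsCau.const b)

theorem lim_const (c : K) : lim (fun _ : I => c) = const I c := rfl

theorem const_strictMono : StrictMono (const I : K → Compl I K) := by
  intro a b h
  refine (lim_lt (IsCau.const a) (IsCau.const b)).2
    ⟨(b - a) / 2, by linarith, Classical.arbitrary I, fun _ _ => by linarith⟩

theorem exists_const_lt {x : Compl I K} (hx : 0 < x) : ∃ ε > 0, const I ε < x := by
  obtain ⟨v, rfl⟩ := exists_mk x
  rw [← lim_of v.2, ← map_zero (const I), ← lim_const, lim_lt (IsCau.const 0) v.2] at hx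
  obtain ⟨ε, hε, m, hm⟩ := hx
  refine ⟨ε / 2, by positivity, ?_⟩
  rw [← lim_of v.2, ← lim_const, lim_lt (IsCau.const _) v.2]
  exact ⟨ε / 2, by positivity, m, fun n hn => by have := hm n hn; linarith⟩

end OrderedCompletion

/-! ### Rational and real numbers of the model -/

namespace TypeStructure

open FinType OrderedCompletion

section Pairing

variable {M : TypeStructure.{u}} [hM : IsModel M]

theorem pair_inj {a b c d : M.N} : M.pair a b = M.pair c d ↔ a = c ∧ b = d := by
  refine ⟨fun h => ?_, fun h => by rw [h.1, h.2]⟩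
  -- `(a + b)² ≤ pair a b < (a + b + 1)²` determines the sum
  have key : ∀ a b c d : M.N, M.pair a b = M.pair c d → ¬ a + b < c + d := by
    intro a b c d h hlt
    have h1 : a + b + 1 ≤ c + d := num_add_one_le.2 hlt
    have h2 : (a + b + 1) * (a + b + 1) ≤ (c + d) * (c + d) :=
      mul_le_mul h1 h1 (zero_le_num _) (zero_le_num _)
    have h3 : (a + b) * (a + b) + a < (a + b + 1) * (a + b + 1) := by
      have h4 : (a + b + 1) * (a + b + 1) = (a + b) * (a + b) + a + (a + b + b + 1) := by ring
      rw [h4]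
      refine lt_add_of_pos_right _ ?_
      exact lt_of_lt_of_le one_pos (le_add_of_nonneg_left (zero_le_num _))
    have h5 : M.pair c d < M.pair a b :=
      absurd h (h3.trans_le (h2.trans (le_add_of_nonneg_right (zero_le_num c)))).ne
    exact h5.ne' h
  have hs : a + b = c + d := le_antisymm (not_lt.1 (key _ _ _ _ h.symm)) (not_lt.1 (key _ _ _ _ h))
  unfold pair at h
  rw [hs] at h
  have hac := add_left_cancel h
  exact ⟨hac, add_left_cancel (hac ▸ hs)⟩

theorem le_pair_left (a b : M.N) : a ≤ M.pair a b := le_add_of_nonneg_left (zero_le_num _)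

variable {X : Type*} [Asm M X]

@[fun_prop]
theorem Rep.pair {f g : X → M.N} (hf : Rep M f) (hg : Rep M g) :
    Rep M (fun x => M.pair (f x) (g x)) := by
  unfold TypeStructure.pair
  fun_prop

/-- The first component of a pair. -/
noncomputable def unpairFst (c : M.N) : M.N := least fun a => ∃ b, c = M.pair a b

/-- The second component of a pair. -/
noncomputable def unpairSnd (c : M.N) : M.N := least fun b => ∃ a, c = M.pair a b

variable [HasE2 M]

theorem unpairFst_pair (a b : M.N) : unpairFst (M.pair a b) = a := by
  obtain ⟨b', h⟩ := least_spec (p := fun a' => ∃ b', M.pair a b = M.pair a' b') (by fun_prop)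
    ⟨a, b, rfl⟩
  exact (pair_inj.1 h).1.symm

theorem unpairSnd_pair (a b : M.N) : unpairSnd (M.pair a b) = b := by
  obtain ⟨b', h⟩ := least_spec (p := fun b' => ∃ a', M.pair a b = M.pair a' b') (by fun_prop)
    ⟨b, a, rfl⟩
  exact (pair_inj.1 h).2.symm

@[fun_prop]
theorem Rep.unpairFst {f : X → M.N} (hf : Rep M f) :
    Rep M (fun x => TypeStructure.unpairFst (f x)) := by
  unfold TypeStructure.unpairFst
  exact Rep.least (by fun_prop)

@[fun_prop]
theorem Rep.unpairSnd {f : X → M.N} (hf : Rep M f) :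
    Rep M (fun x => TypeStructure.unpairSnd (f x)) := by
  unfold TypeStructure.unpairSnd
  exact Rep.least (by fun_prop)

end Pairing

section Fractions

variable {M : TypeStructure.{u}} [hM : IsModel M]

/-- The code of a fraction. -/
def Frac.code (q : Frac M) : M.N := M.pair (M.pair q.pos q.neg) q.den

/-- Fractions are represented by their codes. -/
instance (M : TypeStructure.{u}) [IsModel M] : Asm M (Frac M) :=
  ⟨nat, fun c q => c = q.code, fun q => ⟨q.code, rfl⟩⟩

theorem Frac.code_inj {q r : Frac M} : q.code = r.code ↔ q = r := by
  refine ⟨fun h => ?_, fun h => h ▸ rfl⟩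
  obtain ⟨h1, h2⟩ := pair_inj.1 h
  obtain ⟨h3, h4⟩ := pair_inj.1 h1
  cases q
  cases r
  simp_all

theorem decode_code {q : Frac M} (hq : 0 < q.den) : M.decode q.code = q := by
  have h : ∃ r : Frac M, M.Codes q.code r := ⟨q, hq, rfl⟩
  unfold decode
  rw [dif_pos h]
  exact (Frac.code_inj.1 h.choose_spec.2).symm

omit hM in
theorem decode_of_not {c : M.N} (h : ¬ ∃ q : Frac M, M.Codes c q) : M.decode c = 0 := dif_neg h

theorem decode_den_pos (c : M.N) : 0 < (M.decode c).den := by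
  by_cases h : ∃ q : Frac M, M.Codes c q
  · unfold decode
    rw [dif_pos h]
    exact h.choose_spec.1
  · rw [decode_of_not h]
    exact one_pos

namespace Rep

variable {X : Type*} [Asm M X]

/-- A function to the fractions is represented by the codes of its values. -/
theorem frac_iff {f : X → Frac M} : Rep M f ↔ Rep M (fun x => (f x).code) := Iff.rfl

@[fun_prop]
theorem code {f : X → Frac M} (hf : Rep M f) : Rep M (fun x => (f x).code) := frac_iff.1 hf

@[fun_prop]
theorem frac_mk {f g h : X → M.N} (hf : Rep M f) (hg : Rep M g) (hh : Rep M h) :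
    Rep M (fun x => (Frac.mk (f x) (g x) (h x) : Frac M)) := by
  rw [frac_iff]
  unfold Frac.code
  fun_prop

@[fun_prop]
theorem pow2 {f : X → M.N} (hf : Rep M f) : Rep M (fun x => M.pow2 (f x)) := by
  unfold TypeStructure.pow2
  fun_prop

@[fun_prop]
theorem eps {f : X → M.N} (hf : Rep M f) : Rep M (fun x => M.eps (f x)) := by
  unfold TypeStructure.eps
  fun_prop

variable [HasE2 M]

@[fun_prop]
theorem pos {f : X → Frac M} (hf : Rep M f) : Rep M (fun x => (f x).pos) :=
  congr (f := fun x => TypeStructure.unpairFst (TypeStructure.unpairFst (f x).code))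
    (by fun_prop) fun x => by rw [Frac.code, unpairFst_pair, unpairFst_pair]

@[fun_prop]
theorem neg {f : X → Frac M} (hf : Rep M f) : Rep M (fun x => (f x).neg) :=
  congr (f := fun x => TypeStructure.unpairSnd (TypeStructure.unpairFst (f x).code))
    (by fun_prop) fun x => by rw [Frac.code, unpairFst_pair, unpairSnd_pair]

@[fun_prop]
theorem den {f : X → Frac M} (hf : Rep M f) : Rep M (fun x => (f x).den) :=
  congr (f := fun x => TypeStructure.unpairSnd (f x).code)
    (by fun_prop) fun x => by rw [Frac.code, unpairSnd_pair]

@[fun_prop]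
theorem frac_neg {f : X → Frac M} (hf : Rep M f) : Rep M (fun x => -f x) :=
  congr (f := fun x => (⟨(f x).neg, (f x).pos, (f x).den⟩ : Frac M)) (by fun_prop) fun _ => rfl

@[fun_prop]
theorem frac_add {f g : X → Frac M} (hf : Rep M f) (hg : Rep M g) : Rep M (fun x => f x + g x) :=
  congr (f := fun x => (⟨(f x).pos * (g x).den + (g x).pos * (f x).den,
    (f x).neg * (g x).den + (g x).neg * (f x).den, (f x).den * (g x).den⟩ : Frac M))
    (by fun_prop) fun _ => rfl

@[fun_prop]
theorem frac_sub {f g : X → Frac M} (hf : Rep M f) (hg : Rep M g) : Rep M (fun x => f x - g x) :=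
  congr (f := fun x => f x + -g x) (by fun_prop) fun _ => rfl

@[fun_prop]
theorem frac_mul {f g : X → Frac M} (hf : Rep M f) (hg : Rep M g) : Rep M (fun x => f x * g x) :=
  congr (f := fun x => (⟨(f x).pos * (g x).pos + (f x).neg * (g x).neg,
    (f x).pos * (g x).neg + (f x).neg * (g x).pos, (f x).den * (g x).den⟩ : Frac M))
    (by fun_prop) fun _ => rfl

@[fun_prop]
theorem frac_le {f g : X → Frac M} (hf : Rep M f) (hg : Rep M g) : Rep M (fun x => f x ≤ g x) :=
  congr (f := fun x => (f x).pos * (g x).den + (g x).neg * (f x).den ≤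
    (g x).pos * (f x).den + (f x).neg * (g x).den) (by fun_prop) fun _ => rfl

omit [HasE2 M] in
@[fun_prop]
theorem frac_ite {p : X → Prop} [∀ x, Decidable (p x)] {f g : X → Frac M} (hp : Rep M p)
    (hf : Rep M f) (hg : Rep M g) : Rep M (fun x => if p x then f x else g x) := by
  rw [frac_iff]
  exact congr (f := fun x => if p x then (f x).code else (g x).code) (by fun_prop) fun x => by
    split_ifs <;> rfl

@[fun_prop]
theorem frac_abs {f : X → Frac M} (hf : Rep M f) : Rep M (fun x => (f x).abs) := by
  unfold Frac.abs
  fun_prop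

theorem exists_frac {p : X → Frac M → Prop} (hp : Rep M (fun q : X × Frac M => p q.1 q.2)) :
    Rep M (fun x => ∃ q, p x q) := by
  have h : Rep M (fun y : ((X × M.N) × M.N) × M.N => p y.1.1.1 ⟨y.1.1.2, y.1.2, y.2⟩) :=
    hp.comp (f := fun y : ((X × M.N) × M.N) × M.N =>
      (y.1.1.1, (⟨y.1.1.2, y.1.2, y.2⟩ : Frac M))) (by fun_prop)
  refine congr_prop (p := fun x => ∃ a b c, p x ⟨a, b, c⟩) ?_ fun x => ?_
  · exact exists_num (exists_num (exists_num h))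
  · exact ⟨fun ⟨a, b, c, h⟩ => ⟨_, h⟩, fun ⟨q, h⟩ => ⟨q.pos, q.neg, q.den, h⟩⟩

@[fun_prop]
theorem codes {f : X → M.N} {g : X → Frac M} (hf : Rep M f) (hg : Rep M g) :
    Rep M (fun x => M.Codes (f x) (g x)) :=
  congr_prop (p := fun x => 0 < (g x).den ∧ f x = (g x).code) (by fun_prop) fun _ => Iff.rfl

@[fun_prop]
theorem decode {f : X → M.N} (hf : Rep M f) : Rep M (fun x => M.decode (f x)) := by
  classical
  rw [frac_iff]
  have h1 : Rep M (fun x => ∃ q : Frac M, M.Codes (f x) q) := exists_frac (by fun_prop)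
  refine congr (f := fun x => if ∃ q : Frac M, M.Codes (f x) q then f x else (0 : Frac M).code)
    (by fun_prop) fun x => ?_
  split_ifs with h
  · obtain ⟨q, hq, e⟩ := h
    have e' : f x = q.code := e
    rw [e', decode_code hq]
  · rw [decode_of_not h]

end Rep

end Fractions

end TypeStructure

/-! ### Values of fractions and of reals in an ordered field and its completion -/

namespace TypeStructure

open FinType OrderedCompletion

/-- The ordered field of the rational numbers of the model. -/
abbrev Rats (M : TypeStructure.{u}) [IsModel M] : Type u := RatField M.N

/-- The completion of the rational numbers of the model; it contains the reals of the model. -/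
abbrev RealLine (M : TypeStructure.{u}) [IsModel M] : Type u := Compl M.N M.Rats

variable {M : TypeStructure.{u}} [hM : IsModel M]

theorem of_pos {n : M.N} (h : 0 < n) : (0 : M.Rats) < RatField.of n := by
  have := RatField.of_strictMono h
  rwa [map_zero] at this

theorem of_nonneg (n : M.N) : (0 : M.Rats) ≤ RatField.of n := by
  have := RatField.of_strictMono.monotone (zero_le_num n)
  rwa [map_zero] at this

namespace Frac

/-- The value of a fraction in the field of rational numbers. -/
noncomputable def val (q : Frac M) : M.Rats :=
  (RatField.of q.pos - RatField.of q.neg) / RatField.of q.den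

omit hM in
theorem abs_den (q : Frac M) : q.abs.den = q.den := by
  unfold abs
  split_ifs <;> rfl

theorem val_zero : (0 : Frac M).val = 0 := by
  change (RatField.of 0 - RatField.of 0) / RatField.of 1 = (0 : M.Rats)
  simp

theorem val_one : (1 : Frac M).val = 1 := by
  change (RatField.of 1 - RatField.of 0) / RatField.of 1 = (1 : M.Rats)
  simp

theorem val_neg (q : Frac M) : (-q).val = -q.val := by
  change (RatField.of q.neg - RatField.of q.pos) / RatField.of q.den = (_ : M.Rats)
  rw [val, ← neg_div, neg_sub]

theorem val_add {q r : Frac M} (hq : 0 < q.den) (hr : 0 < r.den) : (q + r).val = q.val + r.val := by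
  change (RatField.of (q.pos * r.den + r.pos * q.den) -
    RatField.of (q.neg * r.den + r.neg * q.den)) / RatField.of (q.den * r.den) = (_ : M.Rats)
  have h1 := (of_pos hq).ne'
  have h2 := (of_pos hr).ne'
  rw [val, val, div_add_div _ _ h1 h2]
  simp only [map_add, map_mul]
  congr 1
  ring

theorem val_sub {q r : Frac M} (hq : 0 < q.den) (hr : 0 < r.den) :
    (q - r).val = q.val - r.val := by
  change (q + -r).val = _
  rw [val_add hq (by exact hr), val_neg, sub_eq_add_neg]

theorem val_mul (q r : Frac M) : (q * r).val = q.val * r.val := by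
  change (RatField.of (q.pos * r.pos + q.neg * r.neg) -
    RatField.of (q.pos * r.neg + q.neg * r.pos)) / RatField.of (q.den * r.den) = (_ : M.Rats)
  rw [val, val, div_mul_div_comm]
  simp only [map_add, map_mul]
  congr 1
  ring

theorem le_iff {q r : Frac M} (hq : 0 < q.den) (hr : 0 < r.den) : q ≤ r ↔ q.val ≤ r.val := by
  change q.pos * r.den + r.neg * q.den ≤ r.pos * q.den + q.neg * r.den ↔ _
  rw [val, val, div_le_div_iff₀ (of_pos hq) (of_pos hr), ← RatField.of_strictMono.le_iff_le]
  simp only [map_add, map_mul]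
  constructor <;> intro h <;> linarith

theorem val_abs {q : Frac M} (hq : 0 < q.den) : q.abs.val = |q.val| := by
  unfold abs
  split_ifs with h
  · rw [abs_of_nonneg]
    exact div_nonneg (sub_nonneg.2 (RatField.of_strictMono.monotone h)) (of_nonneg _)
  · rw [val_neg, abs_of_nonpos]
    exact div_nonpos_of_nonpos_of_nonneg
      (sub_nonpos.2 (RatField.of_strictMono.monotone (not_le.1 h).le)) (of_nonneg _)

end Frac

theorem pow2_zero : M.pow2 0 = 1 := hM.out.R_zero _ _

theorem pow2_succ (n : M.N) : M.pow2 (n + 1) = M.pow2 n + M.pow2 n := by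
  unfold pow2
  rw [hM.out.R_succ, hM.out.K_eq, hM.out.S_eq, hM.out.S_eq, hM.out.K_eq,
    hM.out.plus_eq]

theorem lt_pow2 (n : M.N) : n < M.pow2 n := by
  refine induction_on (p := fun n => n < M.pow2 n) (by fun_prop) ?_ (fun n ih => ?_) n
  · rw [pow2_zero]
    exact one_pos
  · rw [pow2_succ]
    exact add_lt_add_of_lt_of_le ih
      (num_add_one_le.2 ((zero_le_num n).trans_lt ih) |>.trans' (by simp))

theorem pow2_pos (n : M.N) : 0 < M.pow2 n := (zero_le_num n).trans_lt (lt_pow2 n)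

theorem pow2_add (m n : M.N) : M.pow2 (m + n) = M.pow2 m * M.pow2 n := by
  refine induction_on (p := fun n => M.pow2 (m + n) = M.pow2 m * M.pow2 n) (by fun_prop) ?_
    (fun n ih => ?_) n
  · rw [pow2_zero, add_zero, mul_one]
  · rw [← add_assoc, pow2_succ, ih, pow2_succ, mul_add]

/-- The value of `1 / 2 ^ k`. -/
noncomputable abbrev epsQ (k : M.N) : M.Rats := (M.eps k).val

theorem epsQ_eq (k : M.N) : epsQ k = 1 / RatField.of (M.pow2 k) := by
  change (RatField.of 1 - RatField.of 0) / RatField.of (M.pow2 k) = (_ : M.Rats)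
  simp

theorem epsQ_pos (k : M.N) : 0 < epsQ k := by
  rw [epsQ_eq]
  exact one_div_pos.2 (of_pos (pow2_pos k))

/-- The rational numbers of the model are archimedean with respect to its numbers. -/
theorem exists_le_of (x : M.Rats) : ∃ n : M.N, x ≤ RatField.of n := by
  rcases le_total x 0 with hx | hx
  · exact ⟨0, hx.trans (map_zero _).ge⟩
  obtain ⟨a, b, hb, h⟩ := OrderedFraction.exists_fraction (Z := DiffRing M.N) x
  obtain ⟨p, q, rfl⟩ := DiffRing.exists_mk a
  obtain ⟨r, s, rfl⟩ := DiffRing.exists_mk b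
  have hsr : s + 1 ≤ r := by
    rw [DiffRing.mk_eq_sub, sub_pos] at hb
    exact num_add_one_le.2 (not_le.1 fun h => hb.not_ge (DiffRing.of_le_of.2 h))
  rw [DiffRing.mk_eq_sub, DiffRing.mk_eq_sub, map_sub, map_sub] at h
  have h' : x * (RatField.of r - RatField.of s) = RatField.of p - RatField.of q := h
  have h1 : (RatField.of (s + 1) : M.Rats) ≤ RatField.of r := RatField.of_strictMono.monotone hsr
  rw [map_add, map_one] at h1
  have h2 : (0 : M.Rats) ≤ RatField.of q := of_nonneg q
  refine ⟨p, ?_⟩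
  nlinarith

theorem exists_epsQ_lt {x : M.Rats} (hx : 0 < x) : ∃ k : M.N, epsQ k < x := by
  obtain ⟨n, hn⟩ := exists_le_of x⁻¹
  refine ⟨n, ?_⟩
  rw [epsQ_eq, one_div, inv_lt_comm₀ (of_pos (pow2_pos n)) hx]
  exact hn.trans_lt (RatField.of_strictMono (lt_pow2 n))

section Limits

variable {v w : M.N → Frac M}

/-- A Cauchy sequence of fractions with positive denominators. -/
def IsCauchy (v : M.N → Frac M) : Prop := (∀ n, 0 < (v n).den) ∧ IsCau fun n => (v n).val

/-- The limit of a sequence of fractions. -/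
noncomputable def limit (v : M.N → Frac M) : M.RealLine := lim fun n => (v n).val

theorem IsCauchy.const {q : Frac M} (hq : 0 < q.den) : IsCauchy fun _ => q :=
  ⟨fun _ => hq, IsCau.const _⟩

theorem IsCauchy.zero : IsCauchy fun _ => (0 : Frac M) := .const one_pos

theorem IsCauchy.one : IsCauchy fun _ => (1 : Frac M) := .const one_pos

theorem IsCauchy.eps (k : M.N) : IsCauchy fun _ => M.eps k := .const (pow2_pos k)

theorem IsCauchy.add (hv : IsCauchy v) (hw : IsCauchy w) : IsCauchy fun n => v n + w n :=
  ⟨fun n => mul_pos (hv.1 n) (hw.1 n), by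
    simpa only [Frac.val_add (hv.1 _) (hw.1 _)] using hv.2.add hw.2⟩

theorem IsCauchy.sub (hv : IsCauchy v) (hw : IsCauchy w) : IsCauchy fun n => v n - w n :=
  ⟨fun n => mul_pos (hv.1 n) (hw.1 n), by
    simpa only [Frac.val_sub (hv.1 _) (hw.1 _)] using hv.2.sub hw.2⟩

theorem IsCauchy.mul (hv : IsCauchy v) (hw : IsCauchy w) : IsCauchy fun n => v n * w n :=
  ⟨fun n => mul_pos (hv.1 n) (hw.1 n), by
    simpa only [Frac.val_mul] using hv.2.mul hw.2⟩

theorem IsCauchy.abs (hv : IsCauchy v) : IsCauchy fun n => (v n).abs :=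
  ⟨fun n => by rw [Frac.abs_den]; exact hv.1 n, by
    simpa only [Frac.val_abs (hv.1 _)] using hv.2.abs⟩

theorem limit_add (hv : IsCauchy v) (hw : IsCauchy w) :
    limit (fun n => v n + w n) = limit v + limit w := by
  simp only [limit, Frac.val_add (hv.1 _) (hw.1 _), lim_add hv.2 hw.2]

theorem limit_sub (hv : IsCauchy v) (hw : IsCauchy w) :
    limit (fun n => v n - w n) = limit v - limit w := by
  simp only [limit, Frac.val_sub (hv.1 _) (hw.1 _), lim_sub hv.2 hw.2]

theorem limit_mul (hv : IsCauchy v) (hw : IsCauchy w) :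
    limit (fun n => v n * w n) = limit v * limit w := by
  simp only [limit, Frac.val_mul, lim_mul hv.2 hw.2]

theorem limit_abs (hv : IsCauchy v) : limit (fun n => (v n).abs) = |limit v| := by
  simp only [limit, Frac.val_abs (hv.1 _), lim_abs hv.2]

theorem limit_const (q : Frac M) : limit (fun _ => q) = OrderedCompletion.const M.N q.val := rfl

theorem limit_zero : limit (fun _ => (0 : Frac M)) = 0 := by
  rw [limit_const, Frac.val_zero, map_zero]

theorem limit_one : limit (fun _ => (1 : Frac M)) = 1 := by
  rw [limit_const, Frac.val_one, map_one]

theorem limLe_iff (hv : IsCauchy v) (hw : IsCauchy w) : LimLe v w ↔ limit v ≤ limit w := by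
  have h1 : ∀ n k, v n ≤ w n + M.eps k ↔ (v n).val ≤ (w n).val + epsQ k := fun n k => by
    rw [Frac.le_iff (hv.1 n) (mul_pos (hw.1 n) (pow2_pos k)),
      Frac.val_add (hw.1 n) (pow2_pos k)]
  unfold LimLe limit
  simp only [h1]
  rw [lim_le hv.2 hw.2]
  constructor
  · intro h ε hε
    obtain ⟨k, hk⟩ := exists_epsQ_lt hε
    obtain ⟨m, hm⟩ := h k
    exact ⟨m, fun n hn => (hm n hn).trans_lt (by linarith)⟩
  · intro h k
    obtain ⟨m, hm⟩ := h _ (epsQ_pos k)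
    exact ⟨m, fun n hn => (hm n hn).le⟩

theorem limLt_iff (hv : IsCauchy v) (hw : IsCauchy w) : LimLt v w ↔ limit v < limit w := by
  have h1 : ∀ n k, v n + M.eps k ≤ w n ↔ (v n).val + epsQ k ≤ (w n).val := fun n k => by
    rw [Frac.le_iff (mul_pos (hv.1 n) (pow2_pos k)) (hw.1 n),
      Frac.val_add (hv.1 n) (pow2_pos k)]
  unfold LimLt limit
  simp only [h1]
  rw [lim_lt hv.2 hw.2]
  constructor
  · rintro ⟨k, m, hm⟩
    exact ⟨epsQ (k + 1), epsQ_pos _, m, fun n hn => lt_of_lt_of_le (by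
      have h2 : epsQ (k + 1) < epsQ k := by
        rw [epsQ_eq, epsQ_eq]
        refine one_div_lt_one_div_of_lt (of_pos (pow2_pos k)) (RatField.of_strictMono ?_)
        rw [pow2_succ]
        exact lt_add_of_pos_right _ (pow2_pos k)
      linarith) (hm n hn)⟩
  · rintro ⟨ε, hε, m, hm⟩
    obtain ⟨k, hk⟩ := exists_epsQ_lt hε
    exact ⟨k, m, fun n hn => by have := hm n hn; linarith⟩

theorem limEq_iff (hv : IsCauchy v) (hw : IsCauchy w) : LimEq v w ↔ limit v = limit w := by
  have h1 : ∀ n k, (v n - w n).abs ≤ M.eps k ↔ |(v n).val - (w n).val| ≤ epsQ k := fun n k => by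
    rw [Frac.le_iff (by rw [Frac.abs_den]; exact mul_pos (hv.1 n) (hw.1 n)) (pow2_pos k),
      Frac.val_abs (mul_pos (hv.1 n) (hw.1 n)), Frac.val_sub (hv.1 n) (hw.1 n)]
  unfold LimEq limit
  simp only [h1]
  rw [lim_eq hv.2 hw.2]
  constructor
  · intro h ε hε
    obtain ⟨k, hk⟩ := exists_epsQ_lt hε
    obtain ⟨m, hm⟩ := h k
    exact ⟨m, fun n hn => (hm n hn).trans_lt hk⟩
  · intro h k
    obtain ⟨m, hm⟩ := h _ (epsQ_pos k)
    exact ⟨m, fun n hn => (hm n hn).le⟩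

end Limits

/-- A number of the model as an element of the real line. -/
noncomputable def num : M.N →+* M.RealLine := (OrderedCompletion.const M.N).comp RatField.of

theorem num_strictMono : StrictMono (num : M.N → M.RealLine) :=
  const_strictMono.comp RatField.of_strictMono

theorem num_le {m n : M.N} : num m ≤ num n ↔ m ≤ n := num_strictMono.le_iff_le

theorem num_nonneg (n : M.N) : 0 ≤ num n := by
  rw [← map_zero num, num_le]
  exact zero_le_num n

/-- The value of a fraction on the real line. -/
noncomputable def Frac.real (q : Frac M) : M.RealLine := OrderedCompletion.const M.N q.val

/-- The real number `1 / 2 ^ k`. -/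
noncomputable def epsR (k : M.N) : M.RealLine := (M.eps k).real

theorem epsR_mul_pow2 (k : M.N) : epsR k * num (M.pow2 k) = 1 := by
  change OrderedCompletion.const M.N (epsQ k) * OrderedCompletion.const M.N _ = 1
  rw [← map_mul, epsQ_eq, one_div_mul_cancel (of_pos (pow2_pos k)).ne', map_one]

theorem epsR_pos (k : M.N) : 0 < epsR k := by
  have := const_strictMono (I := M.N) (epsQ_pos k)
  rwa [map_zero] at this

theorem epsR_zero : epsR (0 : M.N) = 1 := by
  have := epsR_mul_pow2 (0 : M.N)
  rwa [pow2_zero, map_one, mul_one] at this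

theorem epsR_succ (k : M.N) : epsR (k + 1) + epsR (k + 1) = epsR k := by
  have h1 := epsR_mul_pow2 k
  have h2 := epsR_mul_pow2 (k + 1)
  rw [pow2_succ, map_add] at h2
  calc epsR (k + 1) + epsR (k + 1)
      = (epsR (k + 1) + epsR (k + 1)) * (epsR k * num (M.pow2 k)) := by rw [h1, mul_one]
    _ = epsR (k + 1) * (num (M.pow2 k) + num (M.pow2 k)) * epsR k := by ring
    _ = epsR k := by rw [h2, one_mul]

theorem epsR_add (m n : M.N) : epsR (m + n) = epsR m * epsR n := by
  have h1 := epsR_mul_pow2 m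
  have h2 := epsR_mul_pow2 n
  have h3 := epsR_mul_pow2 (m + n)
  rw [pow2_add, map_mul] at h3
  calc epsR (m + n) = epsR (m + n) * ((epsR m * num (M.pow2 m)) * (epsR n * num (M.pow2 n))) := by
        rw [h1, h2, mul_one, mul_one]
    _ = (epsR (m + n) * (num (M.pow2 m) * num (M.pow2 n))) * (epsR m * epsR n) := by ring
    _ = _ := by rw [h3, one_mul]

theorem epsR_le_one (k : M.N) : epsR k ≤ 1 := by
  have h1 := epsR_mul_pow2 k
  have h2 : num 1 ≤ num (M.pow2 k) := num_le.2 (by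
    have := num_add_one_le.2 (pow2_pos k)
    rwa [zero_add] at this)
  rw [map_one] at h2
  nlinarith [epsR_pos k]

theorem epsR_anti {m n : M.N} (h : m ≤ n) : epsR n ≤ epsR m := by
  obtain ⟨k, rfl⟩ := exists_add_of_le h
  rw [epsR_add]
  nlinarith [epsR_pos m, epsR_le_one k]

theorem exists_epsR_lt {x : M.RealLine} (hx : 0 < x) : ∃ k : M.N, epsR k < x := by
  obtain ⟨ε, hε, h⟩ := exists_const_lt hx
  obtain ⟨k, hk⟩ := exists_epsQ_lt hε
  exact ⟨k, (const_strictMono (I := M.N) hk).trans h⟩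

namespace Reals

/-- The value of a real of the model on the real line. -/
noncomputable def val (x : M.Reals) : M.RealLine := limit x.seq

theorem seq_den_pos (x : M.Reals) (n : M.N) : 0 < (x.seq n).den := decode_den_pos _

theorem abs_seq_sub_le (x : M.Reals) (n i : M.N) :
    |(x.seq n).val - (x.seq (n + i)).val| ≤ epsQ n := by
  have h : (x.seq n - x.seq (n + i)).abs ≤ M.eps n := x.2.2 n i
  rwa [Frac.le_iff (by rw [Frac.abs_den]; exact mul_pos (x.seq_den_pos _) (x.seq_den_pos _))
    (pow2_pos n), Frac.val_abs (mul_pos (x.seq_den_pos _) (x.seq_den_pos _)),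
    Frac.val_sub (x.seq_den_pos _) (x.seq_den_pos _)] at h

theorem isCauchy (x : M.Reals) : IsCauchy x.seq := by
  refine ⟨x.seq_den_pos, fun ε hε => ?_⟩
  obtain ⟨k, hk⟩ := exists_epsQ_lt (half_pos hε)
  refine ⟨k, fun n hn n' hn' => ?_⟩
  obtain ⟨i, rfl⟩ := exists_add_of_le hn
  obtain ⟨j, rfl⟩ := exists_add_of_le hn'
  have h1 := abs_le.1 (x.abs_seq_sub_le k i)
  have h2 := abs_le.1 (x.abs_seq_sub_le k j)
  rw [abs_lt]
  constructor <;> linarith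

theorem abs_val_sub_seq_le (x : M.Reals) (n : M.N) : |x.val - (x.seq n).real| ≤ epsR n := by
  have h1 := x.isCauchy.2
  have h2 : IsCau fun _ : M.N => (x.seq n).val := IsCau.const _
  rw [val, limit, Frac.real, ← lim_const, ← lim_sub h1 h2, ← lim_abs (h1.sub h2)]
  refine (lim_le (h1.sub h2).abs (IsCau.const _)).2 fun ε hε => ⟨n, fun m hm => ?_⟩
  obtain ⟨i, rfl⟩ := exists_add_of_le hm
  have := x.abs_seq_sub_le n i
  rw [abs_sub_comm] at this
  linarith

variable {x y : M.Reals}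

theorem eq_iff : x.Eq y ↔ x.val = y.val := limEq_iff x.isCauchy y.isCauchy

theorem le_iff : x.Le y ↔ x.val ≤ y.val := limLe_iff x.isCauchy y.isCauchy

theorem lt_iff : x.Lt y ↔ x.val < y.val := limLt_iff x.isCauchy y.isCauchy

theorem near_iff {k : M.N} : x.Near k y ↔ |x.val - y.val| < epsR k := by
  unfold Near
  rw [limLt_iff (x.isCauchy.sub y.isCauchy).abs (.eps k),
    limit_abs (x.isCauchy.sub y.isCauchy), limit_sub x.isCauchy y.isCauchy]
  rfl

theorem inUnit_iff : x.InUnit ↔ 0 ≤ x.val ∧ x.val ≤ 1 := by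
  unfold InUnit
  rw [limLe_iff .zero x.isCauchy, limLe_iff x.isCauchy .one, limit_zero, limit_one]
  rfl

end Reals

end TypeStructure

/-! ### Constructing reals and real functions in the model -/

namespace TypeStructure

open FinType OrderedCompletion

variable {M : TypeStructure.{u}} [hM : IsModel M]

/-- The sequence of fractions coded by an element of type `1`. -/
noncomputable def sq (x : M.El one) : M.N → Frac M := fun n => M.decode (x n)

namespace Rep

variable {X : Type*} [Asm M X]

theorem comp_curried {Y Z : Type*} [Asm M Y] [Asm M Z] {v : X → Y → Z}
    (hv : Rep M (fun p : X × Y => v p.1 p.2)) {W : Type*} [Asm M W] {f : W → X} {g : W → Y}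
    (hf : Rep M f) (hg : Rep M g) : Rep M (fun w => v (f w) (g w)) := hv.comp (hf.prodMk hg)

variable [HasE2 M]

@[fun_prop]
theorem sq {f : X → M.El one} {g : X → M.N} (hf : Rep M f) (hg : Rep M g) :
    Rep M (fun x => TypeStructure.sq (f x) (g x)) := by
  unfold TypeStructure.sq
  fun_prop

@[fun_prop]
theorem limEq {v w : X → M.N → Frac M} (hv : Rep M (fun p : X × M.N => v p.1 p.2))
    (hw : Rep M (fun p : X × M.N => w p.1 p.2)) : Rep M (fun x => LimEq (v x) (w x)) := by
  have h1 : Rep M (fun q : ((X × M.N) × M.N) × M.N => v q.1.1.1 q.2) :=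
    hv.comp_curried (by fun_prop) (by fun_prop)
  have h2 : Rep M (fun q : ((X × M.N) × M.N) × M.N => w q.1.1.1 q.2) :=
    hw.comp_curried (by fun_prop) (by fun_prop)
  exact forall_num (exists_num (forall_num (imp (by fun_prop) (by fun_prop))))

@[fun_prop]
theorem limLe {v w : X → M.N → Frac M} (hv : Rep M (fun p : X × M.N => v p.1 p.2))
    (hw : Rep M (fun p : X × M.N => w p.1 p.2)) : Rep M (fun x => LimLe (v x) (w x)) := by
  have h1 : Rep M (fun q : ((X × M.N) × M.N) × M.N => v q.1.1.1 q.2) :=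
    hv.comp_curried (by fun_prop) (by fun_prop)
  have h2 : Rep M (fun q : ((X × M.N) × M.N) × M.N => w q.1.1.1 q.2) :=
    hw.comp_curried (by fun_prop) (by fun_prop)
  exact forall_num (exists_num (forall_num (imp (by fun_prop) (by fun_prop))))

@[fun_prop]
theorem limLt {v w : X → M.N → Frac M} (hv : Rep M (fun p : X × M.N => v p.1 p.2))
    (hw : Rep M (fun p : X × M.N => w p.1 p.2)) : Rep M (fun x => LimLt (v x) (w x)) := by
  have h1 : Rep M (fun q : ((X × M.N) × M.N) × M.N => v q.1.1.1 q.2) :=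
    hv.comp_curried (by fun_prop) (by fun_prop)
  have h2 : Rep M (fun q : ((X × M.N) × M.N) × M.N => w q.1.1.1 q.2) :=
    hw.comp_curried (by fun_prop) (by fun_prop)
  exact exists_num (exists_num (forall_num (imp (by fun_prop) (by fun_prop))))

@[fun_prop]
theorem isReal {f : X → M.El one} (hf : Rep M f) : Rep M (fun x => M.IsReal (f x)) := by
  have h : Rep M (fun q : (X × M.N) × Frac M => M.Codes (f q.1.1 q.1.2) q.2) := by fun_prop
  refine and (forall_num (exists_frac h)) (forall_num (forall_num ?_))
  fun_prop

end Rep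

/-- The fraction `a / 2 ^ n`. -/
def dyadic (M : TypeStructure.{u}) (a n : M.N) : Frac M := ⟨a, 0, M.pow2 n⟩

@[fun_prop]
theorem Rep.dyadic {X : Type*} [Asm M X] {f g : X → M.N} (hf : Rep M f) (hg : Rep M g) :
    Rep M (fun x => M.dyadic (f x) (g x)) := by
  unfold TypeStructure.dyadic
  fun_prop

theorem dyadic_real (a n : M.N) : (M.dyadic a n).real = num a * epsR n := by
  have h : (M.dyadic a n).val = RatField.of a * epsQ n := by
    change (RatField.of a - RatField.of 0) / RatField.of (M.pow2 n) = (_ : M.Rats)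
    rw [epsQ_eq, map_zero, sub_zero, mul_one_div]
  rw [Frac.real, h, map_mul]
  rfl

theorem dyadic_den_pos (a n : M.N) : 0 < (M.dyadic a n).den := pow2_pos n

namespace Frac

theorem real_add {q r : Frac M} (hq : 0 < q.den) (hr : 0 < r.den) :
    (q + r).real = q.real + r.real := by
  rw [real, val_add hq hr, map_add, real, real]

theorem real_sub {q r : Frac M} (hq : 0 < q.den) (hr : 0 < r.den) :
    (q - r).real = q.real - r.real := by
  rw [real, val_sub hq hr, map_sub, real, real]

theorem real_zero : (0 : Frac M).real = 0 := by rw [real, val_zero, map_zero]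

theorem real_one : (1 : Frac M).real = 1 := by rw [real, val_one, map_one]

theorem real_le {q r : Frac M} : q.real ≤ r.real ↔ q.val ≤ r.val :=
  const_strictMono.le_iff_le

theorem real_abs_sub (q r : Frac M) :
    |q.real - r.real| = OrderedCompletion.const M.N |q.val - r.val| := by
  rw [real, real, ← map_sub]
  rcases le_total 0 (q.val - r.val) with h | h
  · rw [abs_of_nonneg h, abs_of_nonneg]
    rw [← map_zero (OrderedCompletion.const M.N)]
    exact const_strictMono.monotone h
  · rw [abs_of_nonpos h, map_neg, abs_of_nonpos]
    rw [← map_zero (OrderedCompletion.const M.N)]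
    exact const_strictMono.monotone h

end Frac

/-- The element of type `1` that codes the sequence `q` of fractions. -/
noncomputable def codeSeq (q : M.N → Frac M) : M.El one := lam fun n => (q n).code

@[fun_prop]
theorem Rep.codeSeq {X : Type*} [Asm M X] {q : X → M.N → Frac M}
    (hq : Rep M (fun p : X × M.N => q p.1 p.2)) : Rep M (fun x => TypeStructure.codeSeq (q x)) := by
  unfold TypeStructure.codeSeq
  exact Rep.lam (f := fun x n => (q x n).code) hq.code

section CodeSeq

variable {q : M.N → Frac M} (hq : Rep M q) (hden : ∀ n, 0 < (q n).den)
include hq hden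

theorem codeSeq_app (n : M.N) : codeSeq q n = (q n).code ∧ M.decode (codeSeq q n) = q n := by
  have h : codeSeq q n = (q n).code := Rep.lam_app hq.code n
  exact ⟨h, by rw [h, decode_code (hden n)]⟩

theorem isReal_codeSeq (h : ∀ n i, |(q n).real - (q (n + i)).real| ≤ epsR n) :
    M.IsReal (codeSeq q) := by
  refine ⟨fun n => ⟨q n, hden n, (codeSeq_app hq hden n).1⟩, fun n i => ?_⟩
  rw [(codeSeq_app hq hden n).2, (codeSeq_app hq hden _).2,
    Frac.le_iff (by rw [Frac.abs_den]; exact mul_pos (hden _) (hden _)) (pow2_pos n),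
    Frac.val_abs (mul_pos (hden _) (hden _)), Frac.val_sub (hden _) (hden _)]
  have := h n i
  rw [Frac.real_abs_sub] at this
  exact const_strictMono.le_iff_le.1 this

theorem isReal_codeSeq_of_approx {ρ : M.RealLine} (h : ∀ n, |(q n).real - ρ| ≤ epsR (n + 1)) :
    M.IsReal (codeSeq q) := by
  refine isReal_codeSeq hq hden fun n i => ?_
  have h1 := h n
  have h2 := h (n + i)
  have h3 : epsR (n + i + 1) ≤ epsR (n + 1) :=
    epsR_anti (by
      rw [add_assoc, add_comm i, ← add_assoc]
      exact le_add_of_nonneg_right (zero_le_num i))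
  rw [← epsR_succ n]
  rw [abs_le] at *
  constructor <;> linarith

theorem seq_codeSeq (h : M.IsReal (codeSeq q)) : Reals.seq ⟨codeSeq q, h⟩ = q :=
  funext fun n => (codeSeq_app hq hden n).2

end CodeSeq

/-- Two elements of the real line with arbitrarily good common approximations are equal. -/
theorem eq_of_forall_abs_le {x y : M.RealLine} (h : ∀ k : M.N, |x - y| ≤ epsR k) : x = y := by
  by_contra hne
  obtain ⟨k, hk⟩ := exists_epsR_lt (abs_pos.2 (sub_ne_zero.2 hne))
  exact (h k).not_gt hk

theorem le_of_forall_le_add {x y : M.RealLine} (h : ∀ k : M.N, x ≤ y + epsR k) : x ≤ y := by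
  by_contra! hlt
  obtain ⟨k, hk⟩ := exists_epsR_lt (sub_pos.2 hlt)
  have := h k
  linarith

theorem val_codeSeq {q : M.N → Frac M} (hq : Rep M q) (hden : ∀ n, 0 < (q n).den)
    {ρ : M.RealLine} (h : ∀ n, |(q n).real - ρ| ≤ epsR (n + 1)) (hr : M.IsReal (codeSeq q)) :
    Reals.val ⟨codeSeq q, hr⟩ = ρ := by
  refine eq_of_forall_abs_le fun k => ?_
  have h1 := Reals.abs_val_sub_seq_le ⟨codeSeq q, hr⟩ (k + 1)
  have h2 := h (k + 1)
  rw [seq_codeSeq hq hden] at h1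
  have h3 : epsR (k + 1 + 1) ≤ epsR (k + 1) := epsR_anti (le_add_of_nonneg_right zero_le_one)
  rw [← epsR_succ k]
  rw [abs_le] at *
  constructor <;> linarith

/-- A fraction as a real of the model. -/
noncomputable def ofFrac (q : Frac M) (hq : 0 < q.den) : M.Reals :=
  ⟨codeSeq fun _ => q, isReal_codeSeq (by fun_prop) (fun _ => hq) fun n i => by
    simpa using (epsR_pos n).le⟩

theorem val_ofFrac (q : Frac M) (hq : 0 < q.den) : (ofFrac q hq).val = q.real := by
  refine val_codeSeq (q := fun _ => q) (by fun_prop) (fun _ => hq) (fun n => ?_) _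
  simpa using (epsR_pos _).le

theorem Reals.le_val_of_forall_le {x : M.Reals} {c : M.RealLine} (n : M.N)
    (h : ∀ i, c ≤ (x.seq (n + i)).real) : c ≤ x.val := by
  refine le_of_forall_le_add fun k => ?_
  have h1 := h k
  have h2 := (abs_le.1 (x.abs_val_sub_seq_le (n + k))).1
  have h3 : epsR (n + k) ≤ epsR k := epsR_anti (le_add_of_nonneg_left (zero_le_num n))
  linarith

theorem Reals.val_le_of_forall_le {x : M.Reals} {c : M.RealLine} (n : M.N)
    (h : ∀ i, (x.seq (n + i)).real ≤ c) : x.val ≤ c := by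
  refine le_of_forall_le_add fun k => ?_
  have h1 := h k
  have h2 := (abs_le.1 (x.abs_val_sub_seq_le (n + k))).2
  have h3 : epsR (n + k) ≤ epsR k := epsR_anti (le_add_of_nonneg_left (zero_le_num n))
  linarith

namespace Reals

theorem le_const_iff {x : M.Reals} {q : Frac M} (hq : 0 < q.den) :
    LimLe (sq x.1) (fun _ => q) ↔ x.val ≤ q.real := limLe_iff x.isCauchy (.const hq)

theorem const_le_iff {x : M.Reals} {q : Frac M} (hq : 0 < q.den) :
    LimLe (fun _ => q) (sq x.1) ↔ q.real ≤ x.val := limLe_iff (.const hq) x.isCauchy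

theorem lt_const_iff {x : M.Reals} {q : Frac M} (hq : 0 < q.den) :
    LimLt (sq x.1) (fun _ => q) ↔ x.val < q.real := limLt_iff x.isCauchy (.const hq)

end Reals

/-- For a real `x` in `[0, 1]`, the least `a` with `x ≤ (a + 1) / 2 ^ n`. -/
noncomputable def ceilPred (x : M.El one) (n : M.N) : M.N :=
  least fun a => LimLe (sq x) (fun _ => M.dyadic (a + 1) n)

section Floor

variable [HasE2 M]

theorem ceilPred_spec {x : M.Reals} (h0 : 0 ≤ x.val) (h1 : x.val ≤ 1) (n : M.N) :
    num (ceilPred x.1 n) * epsR n ≤ x.val ∧ x.val ≤ (num (ceilPred x.1 n) + 1) * epsR n ∧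
      ceilPred x.1 n + 1 ≤ M.pow2 n := by
  have hrep : Rep M fun a => LimLe (sq x.1) (fun _ => M.dyadic (a + 1) n) := by fun_prop
  have key : ∀ a, LimLe (sq x.1) (fun _ => M.dyadic (a + 1) n) ↔ x.val ≤ (num a + 1) * epsR n :=
    fun a => by rw [Reals.le_const_iff (dyadic_den_pos _ _), dyadic_real, map_add, map_one]
  obtain ⟨a, ha⟩ : ∃ a, M.pow2 n = a + 1 := by
    obtain ⟨a, ha⟩ := exists_add_of_le (num_add_one_le.2 (pow2_pos n))
    exact ⟨a, by rw [ha]; ring⟩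
  have hmem : LimLe (sq x.1) (fun _ => M.dyadic (a + 1) n) := by
    rw [key, ← map_one num, ← map_add, ← ha, mul_comm, epsR_mul_pow2]
    exact h1
  have hs := least_spec hrep ⟨_, hmem⟩
  have hl := least_le hrep hmem
  change LimLe (sq x.1) (fun _ => M.dyadic (ceilPred x.1 n + 1) n) at hs
  change ceilPred x.1 n ≤ a at hl
  refine ⟨?_, (key _).1 hs, by rw [ha]; exact add_le_add_left hl 1⟩
  rcases num_eq_zero_or_one_le (ceilPred x.1 n) with h | h
  · rw [h, map_zero, zero_mul]
    exact h0
  · obtain ⟨b, hb⟩ := exists_add_of_le h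
    rw [hb, map_add, map_one, add_comm]
    by_contra! hlt
    have hb' : ceilPred x.1 n ≤ b := least_le hrep ((key b).2 hlt.le)
    rw [hb] at hb'
    exact absurd hb' (lt_add_of_pos_left b one_pos).not_ge

end Floor

end TypeStructure

/-! ### Reals with prescribed digits in base four -/

namespace TypeStructure

open FinType OrderedCompletion

variable {M : TypeStructure.{u}} [hM : IsModel M]

/-- The `n`-th digit given by `A`: it is `0` if `A n = 0` and `1` otherwise. -/
noncomputable def digit (A : M.El one) (n : M.N) : M.N := open Classical in if A n = 0 then 0 else 1

@[fun_prop]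
theorem Rep.digit {X : Type*} [Asm M X] {f : X → M.El one} {g : X → M.N} (hf : Rep M f)
    (hg : Rep M g) : Rep M (fun x => TypeStructure.digit (f x) (g x)) := by
  classical
  refine Rep.congr (f := fun x => if f x (g x) = 0 then 0 else 1) (by fun_prop) fun x => ?_
  unfold TypeStructure.digit
  congr

omit hM in
theorem digit_cases (A : M.El one) (n : M.N) :
    digit A n = 0 ∧ A n = 0 ∨ digit A n = 1 ∧ A n ≠ 0 := by
  unfold digit
  split_ifs with h
  · exact .inl ⟨rfl, h⟩
  · exact .inr ⟨rfl, h⟩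

theorem exists_digitSum : ∃ φ : M.El one → M.N → M.N,
    Rep M (fun p : M.El one × M.N => φ p.1 p.2) ∧ (∀ A, φ A 0 = 0) ∧
      ∀ A n, φ A (n + 1) = 4 * φ A n + digit A n :=
  exists_recursion (z := fun _ => 0) (s := fun A n s => 4 * s + digit A n)
    (by fun_prop) (by fun_prop)

/-- The number whose digits in base four are the first `n` digits given by `A`. -/
noncomputable def digitSum (A : M.El one) (n : M.N) : M.N := exists_digitSum.choose A n

@[fun_prop]
theorem Rep.digitSum {X : Type*} [Asm M X] {f : X → M.El one} {g : X → M.N} (hf : Rep M f)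
    (hg : Rep M g) : Rep M (fun x => TypeStructure.digitSum (f x) (g x)) :=
  exists_digitSum.choose_spec.1.comp_curried hf hg

theorem digitSum_zero (A : M.El one) : digitSum A 0 = 0 := exists_digitSum.choose_spec.2.1 A

theorem digitSum_succ (A : M.El one) (n : M.N) :
    digitSum A (n + 1) = 4 * digitSum A n + digit A n := exists_digitSum.choose_spec.2.2 A n

/-- `4 ^ n`. -/
def pow4 (n : M.N) : M.N := M.pow2 (n + n)

/-- `1 / 4 ^ n`. -/
noncomputable def eps4 (n : M.N) : M.RealLine := epsR (n + n)

theorem pow4_zero : pow4 (0 : M.N) = 1 := by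
  rw [pow4, add_zero, pow2_zero]

theorem pow4_succ (n : M.N) : pow4 (n + 1) = 4 * pow4 n := by
  rw [pow4, pow4, show n + 1 + (n + 1) = n + n + 1 + 1 by ring, pow2_succ, pow2_succ]
  ring

theorem pow4_add (m n : M.N) : pow4 (m + n) = pow4 m * pow4 n := by
  rw [pow4, pow4, pow4, ← pow2_add]
  congr 1
  ring

@[fun_prop]
theorem Rep.pow4 {X : Type*} [Asm M X] {f : X → M.N} (hf : Rep M f) :
    Rep M (fun x => TypeStructure.pow4 (f x)) := by
  unfold TypeStructure.pow4
  fun_prop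

theorem eps4_mul_pow4 (n : M.N) : eps4 n * num (pow4 n) = 1 := epsR_mul_pow2 _

theorem eps4_pos (n : M.N) : 0 < eps4 n := epsR_pos _

theorem eps4_add (m n : M.N) : eps4 (m + n) = eps4 m * eps4 n := by
  rw [eps4, eps4, eps4, ← epsR_add]
  congr 1
  ring

theorem eps4_succ (n : M.N) : 4 * eps4 (n + 1) = eps4 n := by
  rw [eps4, eps4, ← epsR_succ (n + n), ← epsR_succ (n + n + 1),
    show n + 1 + (n + 1) = n + n + 1 + 1 by ring]
  ring

theorem eps4_le (n : M.N) : eps4 n ≤ epsR n := epsR_anti (le_add_of_nonneg_left (zero_le_num n))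

theorem eps4_zero : eps4 (0 : M.N) = 1 := by rw [eps4, add_zero, epsR_zero]

theorem digitSum_add_bounds (A : M.El one) (n i : M.N) :
    digitSum A n * pow4 i ≤ digitSum A (n + i) ∧
      2 * digitSum A (n + i) + 1 ≤ (2 * digitSum A n + 1) * pow4 i := by
  refine induction_on (p := fun i => digitSum A n * pow4 i ≤ digitSum A (n + i) ∧
      2 * digitSum A (n + i) + 1 ≤ (2 * digitSum A n + 1) * pow4 i) (by fun_prop) ?_
      (fun i ih => ?_) i
  · rw [pow4_zero, add_zero, mul_one, mul_one]
    exact ⟨le_rfl, le_rfl⟩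
  · obtain ⟨h1, h2⟩ := ih
    rw [← add_assoc, digitSum_succ, pow4_succ]
    rw [← num_le] at h1 h2 ⊢
    rw [← num_le]
    simp only [map_add, map_mul, map_ofNat, map_one] at *
    have h3 : 0 ≤ num (digit A (n + i)) ∧ num (digit A (n + i)) ≤ 1 := by
      rcases digit_cases A (n + i) with h | h <;> rw [h.1] <;> simp
    constructor <;> nlinarith

/-- The approximations `(a + ∑_{j < n} A_j / 4 ^ (j + 1)) / 4 ^ k`, where the `A_j` are the digits
given by `A`. -/
noncomputable def pointSeq (A : M.El one) (k a n : M.N) : Frac M :=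
  M.dyadic (a * pow4 n + digitSum A n) ((k + n) + (k + n))

@[fun_prop]
theorem Rep.pointSeq {X : Type*} [Asm M X] {A : X → M.El one} {k a n : X → M.N} (hA : Rep M A)
    (hk : Rep M k) (ha : Rep M a) (hn : Rep M n) :
    Rep M (fun x => TypeStructure.pointSeq (A x) (k x) (a x) (n x)) := by
  unfold TypeStructure.pointSeq
  fun_prop

theorem pointSeq_den_pos (A : M.El one) (k a n : M.N) : 0 < (pointSeq A k a n).den :=
  dyadic_den_pos _ _

theorem pointSeq_real (A : M.El one) (k a n : M.N) :
    (pointSeq A k a n).real = (num a * num (pow4 n) + num (digitSum A n)) * eps4 (k + n) := by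
  rw [pointSeq, dyadic_real, map_add, map_mul]
  rfl

theorem pointSeq_bounds (A : M.El one) (k a n i : M.N) :
    (pointSeq A k a n).real ≤ (pointSeq A k a (n + i)).real ∧
      2 * (pointSeq A k a (n + i)).real ≤ 2 * (pointSeq A k a n).real + eps4 (k + n) := by
  obtain ⟨h1, h2⟩ := digitSum_add_bounds A n i
  rw [← num_le] at h1 h2
  simp only [map_add, map_mul, map_ofNat, map_one] at h1 h2
  rw [pointSeq_real, pointSeq_real, ← add_assoc, eps4_add (k + n) i, pow4_add, map_mul]
  have h3 := eps4_mul_pow4 i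
  have h4 := eps4_pos (k + n)
  have h5 := eps4_pos i
  have h6 : 0 < eps4 (k + n) * eps4 i := mul_pos h4 h5
  generalize eps4 (k + n) = c at *
  generalize eps4 i = d at *
  generalize num (pow4 i) = e at *
  constructor
  · calc (num a * num (pow4 n) + num (digitSum A n)) * c
        = (num a * num (pow4 n) + num (digitSum A n)) * c * (d * e) := by rw [h3, mul_one]
      _ = (num a * (num (pow4 n) * e) + num (digitSum A n) * e) * (c * d) := by ring
      _ ≤ _ := mul_le_mul_of_nonneg_right (by linarith) h6.le
  · calc 2 * ((num a * (num (pow4 n) * e) + num (digitSum A (n + i))) * (c * d))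
        = (2 * (num a * (num (pow4 n) * e)) + 2 * num (digitSum A (n + i))) * (c * d) := by ring
      _ ≤ (2 * (num a * (num (pow4 n) * e)) + (2 * num (digitSum A n) + 1) * e) * (c * d) := by
        refine mul_le_mul_of_nonneg_right ?_ h6.le
        linarith
      _ = (2 * (num a * num (pow4 n) + num (digitSum A n)) * c + c) * (d * e) := by ring
      _ = _ := by rw [h3]; ring

theorem isReal_point (A : M.El one) (k a : M.N) : M.IsReal (codeSeq (pointSeq A k a)) := by
  refine isReal_codeSeq (by fun_prop) (pointSeq_den_pos A k a) fun n i => ?_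
  obtain ⟨h1, h2⟩ := pointSeq_bounds A k a n i
  have h3 : eps4 (k + n) ≤ epsR n :=
    (eps4_le _).trans (epsR_anti (le_add_of_nonneg_left (zero_le_num k)))
  have h4 := eps4_pos (k + n)
  rw [abs_le]
  constructor <;> linarith

/-- The real `(a + ∑_j A_j / 4 ^ (j + 1)) / 4 ^ k`, where the `A_j` are the digits given by `A`. -/
noncomputable def point (A : M.El one) (k a : M.N) : M.Reals :=
  ⟨codeSeq (pointSeq A k a), isReal_point A k a⟩

theorem point_bounds (A : M.El one) (k a n : M.N) :
    (pointSeq A k a n).real ≤ (point A k a).val ∧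
      2 * (point A k a).val ≤ 2 * (pointSeq A k a n).real + eps4 (k + n) := by
  have hs : (point A k a).seq = pointSeq A k a :=
    seq_codeSeq (by fun_prop) (pointSeq_den_pos A k a) _
  constructor
  · refine Reals.le_val_of_forall_le n fun i => ?_
    rw [hs]
    exact (pointSeq_bounds A k a n i).1
  · refine le_of_forall_le_add fun m => ?_
    have h1 := (pointSeq_bounds A k a n (m + 1)).2
    have h2 := (abs_le.1 ((point A k a).abs_val_sub_seq_le (n + (m + 1)))).2
    have h3 : epsR (n + (m + 1)) ≤ epsR (m + 1) := epsR_anti (le_add_of_nonneg_left (zero_le_num n))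
    have h4 := epsR_succ m
    rw [hs] at h2
    linarith

theorem point_bounds_zero (A : M.El one) (k a : M.N) :
    num a * eps4 k ≤ (point A k a).val ∧ 2 * (point A k a).val ≤ (2 * num a + 1) * eps4 k := by
  have h := point_bounds A k a 0
  rw [pointSeq_real, digitSum_zero, pow4_zero, map_one, map_zero, mul_one, add_zero, add_zero] at h
  exact ⟨h.1, h.2.trans_eq (by ring)⟩

/-- The digit `1` stands at the `j`-th place of the expansion of `x ≥ 0` in base four. -/
def HasOneAt (x : M.El one) (j : M.N) : Prop :=
  ∃ i : M.N, LimLe (fun _ => M.dyadic (4 * i + 1) ((j + 1) + (j + 1))) (sq x) ∧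
    LimLt (sq x) (fun _ => M.dyadic (4 * i + 2) ((j + 1) + (j + 1)))

theorem hasOneAt_iff (x : M.Reals) (j : M.N) : HasOneAt x.1 j ↔
    ∃ i : M.N, (4 * num i + 1) * eps4 (j + 1) ≤ x.val ∧ x.val < (4 * num i + 2) * eps4 (j + 1) := by
  unfold HasOneAt
  refine exists_congr fun i => ?_
  rw [Reals.const_le_iff (dyadic_den_pos _ _), Reals.lt_const_iff (dyadic_den_pos _ _),
    dyadic_real, dyadic_real]
  simp only [map_add, map_mul, map_ofNat, map_one]
  rfl

theorem HasOneAt.congr {x y : M.Reals} (h : x.val = y.val) (j : M.N) :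
    HasOneAt x.1 j ↔ HasOneAt y.1 j := by
  rw [hasOneAt_iff, hasOneAt_iff, h]

theorem hasOneAt_point (A : M.El one) (k a l : M.N) :
    HasOneAt (point A k a).1 (k + l) ↔ A l ≠ 0 := by
  rw [hasOneAt_iff]
  obtain ⟨h1, h2⟩ := point_bounds A k a (l + 1)
  rw [pointSeq_real, ← add_assoc, digitSum_succ, pow4_succ] at h1 h2
  simp only [map_add, map_mul, map_ofNat] at h1 h2
  have h0 := eps4_pos (k + l + 1)
  set t : M.N := a * pow4 l + digitSum A l with ht
  have ht' : num t = num a * num (pow4 l) + num (digitSum A l) := by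
    rw [ht, map_add, map_mul]
  rcases digit_cases A l with ⟨hd, hA⟩ | ⟨hd, hA⟩
  · refine iff_of_false ?_ (not_not.2 hA)
    rintro ⟨i, h3, h4⟩
    rw [hd, map_zero] at h1 h2
    rcases lt_or_ge i t with hit | hit
    · have : num i + 1 ≤ num t := by
        rw [← map_one num, ← map_add, num_le]
        exact num_add_one_le.2 hit
      nlinarith
    · have : num t ≤ num i := num_le.2 hit
      nlinarith
  · refine iff_of_true ⟨t, ?_, ?_⟩ hA
    · rw [hd, map_one] at h1
      rw [ht']
      nlinarith
    · rw [hd, map_one] at h2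
      rw [ht']
      nlinarith

section Decoding

variable [HasE2 M] {X : Type*} [Asm M X]

@[fun_prop]
theorem Rep.hasOneAt {f : X → M.El one} {g : X → M.N} (hf : Rep M f) (hg : Rep M g) :
    Rep M (fun x => HasOneAt (f x) (g x)) := by
  unfold HasOneAt
  fun_prop

/-- The element of Baire space that is coded by the digits of `x` from the place `k` on: its value
at `n` is the least `m` such that the digit at the place `k + pair n m` is `1`. -/
noncomputable def readOff (x : M.El one) (k : M.N) : M.El one :=
  lam fun n => least fun m => HasOneAt x (k + M.pair n m)

@[fun_prop]
theorem Rep.readOff {f : X → M.El one} {g : X → M.N} (hf : Rep M f) (hg : Rep M g) :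
    Rep M (fun x => TypeStructure.readOff (f x) (g x)) := by
  unfold TypeStructure.readOff
  exact Rep.lam (f := fun x n => TypeStructure.least fun m => HasOneAt (f x) (g x + M.pair n m))
    (Rep.least (by fun_prop))

/-- The digits that code `g`: the digit `1` stands at the places `pair n (g n)`. -/
noncomputable def graphDigits (g : M.El one) : M.El one :=
  lam fun j => chi (¬ ∃ n, j = M.pair n (g n))

theorem graphDigits_ne_zero (g : M.El one) (j : M.N) :
    graphDigits g j ≠ 0 ↔ ∃ n, j = M.pair n (g n) := by
  have h : Rep M fun j : M.N => (chi (¬ ∃ n, j = M.pair n (g n)) : M.N) := by fun_prop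
  rw [graphDigits, Rep.lam_app h, Ne, Rep.chi_eq_zero, not_not]

theorem hasOneAt_graphDigits (g : M.El one) (k a n m : M.N) :
    HasOneAt (point (graphDigits g) k a).1 (k + M.pair n m) ↔ m = g n := by
  rw [hasOneAt_point, graphDigits_ne_zero]
  constructor
  · rintro ⟨n', h⟩
    obtain ⟨rfl, rfl⟩ := pair_inj.1 h
    rfl
  · rintro rfl
    exact ⟨n, rfl⟩

theorem readOff_point (g : M.El one) (k a : M.N) :
    readOff (point (graphDigits g) k a).1 k = g := by
  refine El.ext fun n => ?_
  have h : Rep M fun n => least fun m => HasOneAt (point (graphDigits g) k a).1 (k + M.pair n m) :=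
    Rep.least (by fun_prop)
  rw [readOff, Rep.lam_app h]
  simp only [hasOneAt_graphDigits]
  exact least_spec (p := fun m => m = g n) (by fun_prop) ⟨_, rfl⟩

/-- Some tail of the expansion of `x` codes a zero of `Y`. -/
def CodesZero (Y : M.El two) (x : M.El one) : Prop :=
  ∃ k : M.N, (∀ n : M.N, ∃ m : M.N, HasOneAt x (k + M.pair n m)) ∧ Y (readOff x k) = 0

@[fun_prop]
theorem Rep.codesZero {f : X → M.El two} {g : X → M.El one} (hf : Rep M f) (hg : Rep M g) :
    Rep M (fun x => CodesZero (f x) (g x)) := by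
  unfold CodesZero
  exact Rep.exists_num ((Rep.forall_num (by fun_prop)).and (by fun_prop))

omit [HasE2 M] in
theorem CodesZero.congr {Y : M.El two} {x y : M.Reals} (h : x.val = y.val) :
    CodesZero Y x.1 ↔ CodesZero Y y.1 := by
  unfold CodesZero readOff
  simp only [HasOneAt.congr h]

theorem codesZero_point {Y : M.El two} {g : M.El one} (h : Y g = 0) (k a : M.N) :
    CodesZero Y (point (graphDigits g) k a).1 :=
  ⟨k, fun n => ⟨g n, (hasOneAt_graphDigits g k a n _).2 rfl⟩, by rwa [readOff_point]⟩

/-- The sequence of digits `0`. -/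
noncomputable def zeroDigits (M : TypeStructure.{u}) : M.El one := M.K nat nat 0

omit [HasE2 M] in
theorem not_codesZero_point {Y : M.El two} (k a : M.N) :
    ¬ CodesZero Y (point (zeroDigits M) k a).1 := by
  rintro ⟨k', h, _⟩
  obtain ⟨m, hm⟩ := h k
  obtain ⟨l, hl⟩ := exists_add_of_le
    ((le_pair_left k m).trans (le_add_of_nonneg_left (zero_le_num k') : _ ≤ k' + M.pair k m))
  rw [hl, hasOneAt_point] at hm
  exact hm (hM.out.K_eq _ _ _ _)

open Classical in
/-- The functional that maps `Y` to the indicator function of the set of reals some tail of whose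
expansion codes a zero of `Y`. -/
noncomputable def indicator (Y : M.El two) : M.El (arr one one) :=
  lam fun x => codeSeq fun _ => if CodesZero Y x then 1 else 0

theorem Rep.indicator : Rep M (fun Y : M.El two => TypeStructure.indicator Y) := by
  unfold TypeStructure.indicator
  refine Rep.lam (Rep.codeSeq ?_)
  fun_prop

open Classical in
theorem indicator_app (Y : M.El two) (x : M.Reals) : indicator Y x.1 =
    if CodesZero Y x.1 then (ofFrac (M := M) 1 one_pos).1 else (ofFrac (M := M) 0 one_pos).1 := by
  have h : Rep M fun x : M.El one => codeSeq fun _ =>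
      if CodesZero Y x then (1 : Frac M) else 0 := by fun_prop
  rw [indicator, Rep.lam_app h]
  split_ifs <;> rfl

theorem indicator_congr {Y : M.El two} {x y : M.Reals} (h : x.val = y.val) :
    indicator Y x.1 = indicator Y y.1 := by
  have e : CodesZero Y x.1 ↔ CodesZero Y y.1 := CodesZero.congr h
  rw [indicator_app, indicator_app]
  split_ifs <;> tauto

/-- The indicator function as a function on the reals of the model. -/
noncomputable def indicatorFun (Y : M.El two) : M.RealFun where
  val := indicator Y
  isReal x := by
    rw [indicator_app]
    split_ifs
    · exact (ofFrac (M := M) 1 one_pos).2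
    · exact (ofFrac (M := M) 0 one_pos).2
  ext x y h := Reals.eq_iff.2 (congrArg Reals.val (Subtype.ext
    (indicator_congr (Reals.eq_iff.1 h))))

open Classical in
theorem val_indicatorFun (Y : M.El two) (x : M.Reals) :
    ((indicatorFun Y).at x).val = if CodesZero Y x.1 then 1 else 0 := by
  have h : ∀ (y : M.Reals), indicator Y x.1 = y.1 → ((indicatorFun Y).at x).val = y.val := by
    intro y h
    congr 1
    exact Subtype.ext h
  have h2 := indicator_app Y x
  split_ifs at h2 ⊢ with hc
  · rw [h _ h2, val_ofFrac, Frac.real_one]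
  · rw [h _ h2, val_ofFrac, Frac.real_zero]

end Decoding

end TypeStructure

/-! ### Two-valued functions with dense fibres are weakly continuous -/

namespace TypeStructure

open FinType OrderedCompletion

variable {M : TypeStructure.{u}} [hM : IsModel M]

/-- The constant function with a rational value. -/
noncomputable def constFun (q : Frac M) (hq : 0 < q.den) : M.RealFun where
  val := M.K one one (ofFrac q hq).1
  isReal x := by
    rw [hM.out.K_eq]
    exact (ofFrac q hq).2
  ext x y h := Reals.eq_iff.2 (congrArg Reals.val (Subtype.ext (by
    simp only [hM.out.K_eq])))

theorem val_constFun (q : Frac M) (hq : 0 < q.den) (x : M.Reals) :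
    ((constFun q hq).at x).val = q.real := by
  rw [← val_ofFrac q hq]
  exact congrArg Reals.val (Subtype.ext (hM.out.K_eq _ _ _ _))

theorem epsR_lt {m n : M.N} (h : m < n) : epsR n < epsR m := by
  have h1 := epsR_anti (num_add_one_le.2 h)
  have h2 := epsR_succ m
  have h3 := epsR_pos (m + 1)
  linarith

/-- `f` takes only the values `0` and `1`; it takes the value `0` at all fractions with
denominator `4 ^ k` and, unless it is constantly `0`, it takes the value `1` at all reals
whose expansion in base four has a certain tail. -/
structure HasDenseFibers (f : M.RealFun) : Prop where
  zero_or_one : ∀ x, (f.at x).val = 0 ∨ (f.at x).val = 1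
  zero : ∀ k a, (f.at (point (zeroDigits M) k a)).val = 0
  one : (∀ x, (f.at x).val = 0) ∨ ∃ A, ∀ k a, (f.at (point A k a)).val = 1

theorem hasDenseFibers_indicatorFun [HasE2 M] (Y : M.El two) :
    HasDenseFibers (indicatorFun Y) where
  zero_or_one x := by
    rw [val_indicatorFun]
    split_ifs <;> simp
  zero k a := by
    rw [val_indicatorFun, if_neg (not_codesZero_point k a)]
  one := by
    by_cases h : ∃ g, Y g = 0
    · obtain ⟨g, hg⟩ := h
      refine .inr ⟨graphDigits g, fun k a => ?_⟩
      rw [val_indicatorFun, if_pos (codesZero_point hg k a)]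
    · refine .inl fun x => ?_
      rw [val_indicatorFun, if_neg]
      rintro ⟨k, _, hk⟩
      exact h ⟨_, hk⟩

namespace HasDenseFibers

variable {f : M.RealFun} (hf : HasDenseFibers f)
include hf

theorem exists_digits (x : M.Reals) :
    ∃ A, ∀ k a, (f.at (point A k a)).val = (f.at x).val := by
  rcases hf.zero_or_one x with h | h
  · exact ⟨zeroDigits M, fun k a => by rw [h, hf.zero]⟩
  · rcases hf.one with h' | ⟨A, hA⟩
    · rw [h' x] at h
      exact absurd h zero_ne_one
    · exact ⟨A, fun k a => by rw [h, hA]⟩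

end HasDenseFibers

variable [HasE2 M]

theorem inUnit_point_ceilPred {x : M.Reals} (hx : x.InUnit) (A : M.El one) (k : M.N) :
    (point A k (ceilPred x.1 (k + k))).InUnit ∧
      |(point A k (ceilPred x.1 (k + k))).val - x.val| ≤ eps4 k := by
  obtain ⟨h0, h1⟩ := Reals.inUnit_iff.1 hx
  obtain ⟨h2, h3, h4⟩ := ceilPred_spec h0 h1 (k + k)
  obtain ⟨h5, h6⟩ := point_bounds_zero A k (ceilPred x.1 (k + k))
  have h7 := eps4_pos k
  have h8 := eps4_mul_pow4 k
  rw [← num_le, map_add, map_one] at h4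
  change num _ * eps4 k ≤ _ at h2
  change _ ≤ _ * eps4 k at h3
  change _ ≤ num (pow4 k) at h4
  have h9 := num_nonneg (ceilPred x.1 (k + k))
  generalize num (ceilPred x.1 (k + k)) = a at *
  rw [Reals.inUnit_iff, abs_le]
  refine ⟨⟨?_, ?_⟩, ?_, ?_⟩ <;> nlinarith

theorem exists_point_near {x : M.Reals} (hx : x.InUnit) (A : M.El one) (k : M.N) :
    ∃ j a, (point A j a).InUnit ∧ (point A j a).Near k x := by
  obtain ⟨h1, h2⟩ := inUnit_point_ceilPred hx A (k + 1)
  exact ⟨_, _, h1, Reals.near_iff.2 (h2.trans_lt ((eps4_le _).trans_lt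
    (epsR_lt (lt_add_of_pos_right k one_pos))))⟩

/-- The sequence of the reals `point A (j + n) (a n)`. -/
noncomputable def pointRealSeq (A : M.El one) (j : M.N) (a : M.N → M.N) (ha : Rep M a) :
    M.RealSeq where
  val := lam fun n => codeSeq (pointSeq A (j + n) (a n))
  isReal n := by
    have h : Rep M fun n => codeSeq (pointSeq A (j + n) (a n)) := by fun_prop
    rw [Rep.lam_app h]
    exact isReal_point _ _ _

omit [HasE2 M] in
theorem at_pointRealSeq (A : M.El one) (j : M.N) (a : M.N → M.N) (ha : Rep M a) (n : M.N) :
    (pointRealSeq A j a ha).at n = point A (j + n) (a n) := by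
  have h : Rep M fun n => codeSeq (pointSeq A (j + n) (a n)) := by fun_prop
  exact Subtype.ext (Rep.lam_app h n)

omit [HasE2 M] in
theorem tendsAlong_pointRealSeq {f : M.RealFun} {A : M.El one} {j : M.N} {a : M.N → M.N}
    (ha : Rep M a) {x : M.Reals} (hf : ∀ k b, (f.at (point A k b)).val = (f.at x).val)
    (h : ∀ n, 0 ≤ (point A (j + n) (a n)).val ∧ (point A (j + n) (a n)).val ≤ 1 ∧
      |(point A (j + n) (a n)).val - x.val| ≤ 2 * eps4 (j + n)) :
    f.TendsAlong (pointRealSeq A j a ha) x := by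
  refine ⟨fun n => ?_, fun k => ⟨k + 1 + 1, fun n hn => ?_⟩, fun k => ⟨0, fun n _ => ?_⟩⟩
  · rw [at_pointRealSeq, Reals.inUnit_iff]
    exact ⟨(h n).1, (h n).2.1⟩
  · rw [at_pointRealSeq, Reals.near_iff]
    have h1 := (eps4_le (j + n)).trans (epsR_anti (le_add_of_nonneg_left (zero_le_num j)))
    have h2 := epsR_anti hn
    have h3 := epsR_succ k
    have h4 := epsR_succ (k + 1)
    have h5 := epsR_pos (k + 1 + 1)
    linarith [(h n).2.2]
  · rw [at_pointRealSeq, Reals.near_iff, hf, sub_self, abs_zero]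
    exact epsR_pos k

theorem HasDenseFibers.young {f : M.RealFun} (hf : HasDenseFibers f) : f.Young := by
  intro x hx
  obtain ⟨hx0, hx1⟩ := Reals.inUnit_iff.1 hx
  obtain ⟨A, hA⟩ := hf.exists_digits x
  have hE : ∀ j n : M.N, eps4 (j + n) ≤ epsR j := fun j n =>
    (eps4_le _).trans (epsR_anti (le_add_of_nonneg_right (zero_le_num n)))
  constructor
  · intro h
    rw [limLt_iff .zero x.isCauchy, limit_zero] at h
    obtain ⟨j, hj⟩ := exists_epsR_lt h
    change epsR j < x.val at hj
    -- the greatest `a` with `(a + 1) / 4 ^ (j + n) < x`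
    have hrep : Rep M fun p : M.N × M.N => LimLe (sq x.1)
        (fun _ => M.dyadic (p.2 + 2) ((j + p.1) + (j + p.1))) := by fun_prop
    have key : ∀ n b, LimLe (sq x.1) (fun _ => M.dyadic (b + 2) ((j + n) + (j + n))) ↔
        x.val ≤ (num b + 2) * eps4 (j + n) := fun n b => by
      rw [Reals.le_const_iff (dyadic_den_pos _ _), dyadic_real, map_add, map_ofNat]
      rfl
    have ha : Rep M fun n => least fun b =>
        LimLe (sq x.1) (fun _ => M.dyadic (b + 2) ((j + n) + (j + n))) := Rep.least hrep
    have hb : ∀ n, ∃ b, b = (least fun b =>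
        LimLe (sq x.1) (fun _ => M.dyadic (b + 2) ((j + n) + (j + n)))) ∧
        (num b + 1) * eps4 (j + n) < x.val ∧ x.val ≤ (num b + 2) * eps4 (j + n) := fun n => by
      have hrep' : Rep M fun b => LimLe (sq x.1)
        (fun _ => M.dyadic (b + 2) ((j + n) + (j + n))) := by fun_prop
      have hs := least_spec hrep' ⟨pow4 (j + n), (key _ _).2 (by
        have h1 := eps4_mul_pow4 (j + n)
        have h2 := eps4_pos (j + n)
        nlinarith)⟩
      refine ⟨_, rfl, ?_, (key _ _).1 hs⟩
      rcases num_eq_zero_or_one_le (least fun b =>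
        LimLe (sq x.1) (fun _ => M.dyadic (b + 2) ((j + n) + (j + n)))) with h | h
      · rw [h, map_zero, zero_add, one_mul]
        exact (hE j n).trans_lt hj
      · obtain ⟨c, hc⟩ := exists_add_of_le h
        by_contra! hlt
        have hle := least_le (n := c) hrep' ((key _ _).2 (by
          rw [hc, map_add, map_one] at hlt
          linarith))
        rw [hc] at hle
        exact hle.not_gt (lt_add_of_pos_left c one_pos)
    have hbd : ∀ n, 0 ≤ (point A (j + n) (least fun b =>
        LimLe (sq x.1) (fun _ => M.dyadic (b + 2) ((j + n) + (j + n))))).val ∧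
        (point A (j + n) (least fun b =>
        LimLe (sq x.1) (fun _ => M.dyadic (b + 2) ((j + n) + (j + n))))).val < x.val ∧
        x.val ≤ (point A (j + n) (least fun b =>
        LimLe (sq x.1) (fun _ => M.dyadic (b + 2) ((j + n) + (j + n))))).val +
          2 * eps4 (j + n) := fun n => by
      obtain ⟨b, hb, h1, h2⟩ := hb n
      rw [← hb]
      obtain ⟨h3, h4⟩ := point_bounds_zero A (j + n) b
      have h5 := eps4_pos (j + n)
      have h6 := num_nonneg b
      refine ⟨?_, ?_, ?_⟩ <;> nlinarith
    refine ⟨pointRealSeq A j _ ha, fun n => ?_, tendsAlong_pointRealSeq ha hA fun n => ?_⟩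
    · rw [at_pointRealSeq, Reals.lt_iff]
      exact (hbd n).2.1
    · obtain ⟨h1, h2, h3⟩ := hbd n
      refine ⟨h1, h2.le.trans hx1, ?_⟩
      have h5 := eps4_pos (j + n)
      rw [abs_le]
      constructor <;> linarith
  · intro h
    rw [limLt_iff x.isCauchy .one, limit_one] at h
    have hx2 : x.val < 1 := h
    obtain ⟨j, hj⟩ := exists_epsR_lt (sub_pos.2 h)
    change epsR j < 1 - x.val at hj
    -- the least `a` with `x < a / 4 ^ (j + 1 + n)`
    have hrep : Rep M fun p : M.N × M.N => LimLt (sq x.1)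
        (fun _ => M.dyadic p.2 ((j + 1 + p.1) + (j + 1 + p.1))) := by fun_prop
    have key : ∀ n b, LimLt (sq x.1) (fun _ => M.dyadic b ((j + 1 + n) + (j + 1 + n))) ↔
        x.val < num b * eps4 (j + 1 + n) := fun n b => by
      rw [Reals.lt_const_iff (dyadic_den_pos _ _), dyadic_real]
      rfl
    have ha : Rep M fun n => least fun b =>
        LimLt (sq x.1) (fun _ => M.dyadic b ((j + 1 + n) + (j + 1 + n))) := Rep.least hrep
    have hb : ∀ n, ∃ b, b = (least fun b =>
        LimLt (sq x.1) (fun _ => M.dyadic b ((j + 1 + n) + (j + 1 + n)))) ∧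
        x.val < num b * eps4 (j + 1 + n) ∧ num b * eps4 (j + 1 + n) ≤ x.val + eps4 (j + 1 + n) :=
        fun n => by
      have hrep' : Rep M fun b => LimLt (sq x.1)
        (fun _ => M.dyadic b ((j + 1 + n) + (j + 1 + n))) := by fun_prop
      have hs := least_spec hrep' ⟨pow4 (j + 1 + n), (key _ _).2 (by
        have h1 := eps4_mul_pow4 (j + 1 + n)
        rw [mul_comm, h1]
        linarith)⟩
      refine ⟨_, rfl, (key _ _).1 hs, ?_⟩
      rcases num_eq_zero_or_one_le (least fun b =>
        LimLt (sq x.1) (fun _ => M.dyadic b ((j + 1 + n) + (j + 1 + n)))) with h | h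
      · rw [h, map_zero, zero_mul]
        exact add_nonneg hx0 (eps4_pos _).le
      · obtain ⟨c, hc⟩ := exists_add_of_le h
        by_contra! hlt
        have hle := least_le (n := c) hrep' ((key _ _).2 (by
          rw [hc, map_add, map_one] at hlt
          linarith))
        rw [hc] at hle
        exact hle.not_gt (lt_add_of_pos_left c one_pos)
    have hbd : ∀ n, x.val < (point A (j + 1 + n) (least fun b =>
        LimLt (sq x.1) (fun _ => M.dyadic b ((j + 1 + n) + (j + 1 + n))))).val ∧
        (point A (j + 1 + n) (least fun b =>
        LimLt (sq x.1) (fun _ => M.dyadic b ((j + 1 + n) + (j + 1 + n))))).val ≤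
          x.val + 2 * eps4 (j + 1 + n) := fun n => by
      obtain ⟨b, hb, h1, h2⟩ := hb n
      rw [← hb]
      obtain ⟨h3, h4⟩ := point_bounds_zero A (j + 1 + n) b
      have h5 := eps4_pos (j + 1 + n)
      refine ⟨?_, ?_⟩ <;> nlinarith
    refine ⟨pointRealSeq A (j + 1) _ ha, fun n => ?_, tendsAlong_pointRealSeq ha hA fun n => ?_⟩
    · rw [at_pointRealSeq, Reals.lt_iff]
      exact (hbd n).1
    · obtain ⟨h1, h2⟩ := hbd n
      have h5 := eps4_pos (j + 1 + n)
      have h6 := hE (j + 1) n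
      have h7 := epsR_succ j
      refine ⟨hx0.trans h1.le, by linarith, ?_⟩
      rw [abs_le]
      constructor <;> linarith

omit [HasE2 M] in
theorem RealSet.mem_congr (G : M.RealSet) {x y : M.Reals} (h : x.val = y.val) :
    G.Mem x ↔ G.Mem y := by
  unfold RealSet.Mem
  rw [G.ext x y (Reals.eq_iff.2 h)]

theorem HasDenseFibers.preContinuous {f : M.RealFun} (hf : HasDenseFibers f) :
    f.PreContinuous := by
  intro G _ x hx
  refine ⟨0, fun y hy _ k => ?_⟩
  obtain ⟨A, hA⟩ := hf.exists_digits x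
  obtain ⟨j, a, h1, h2⟩ := exists_point_near hy A k
  exact ⟨_, ⟨h1, (G.mem_congr (hA j a)).2 hx.2⟩, h2⟩

theorem HasDenseFibers.husain {f : M.RealFun} (hf : HasDenseFibers f) : f.Husain :=
  fun x hx G hG hGx => hf.preContinuous G hG x ⟨hx, hGx⟩

omit [HasE2 M] in
theorem continuous_of_val_eq {f : M.RealFun} {c : M.RealLine} (h : ∀ x, (f.at x).val = c) :
    f.Continuous := fun x _ k => ⟨0, fun y _ _ => by
  rw [Reals.near_iff, h, h, sub_self, abs_zero]
  exact epsR_pos k⟩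

theorem HasDenseFibers.graphContinuous {f : M.RealFun} (hf : HasDenseFibers f) :
    f.GraphContinuous := by
  refine ⟨constFun 0 one_pos, continuous_of_val_eq (val_constFun _ _), fun x hx k => ?_⟩
  obtain ⟨j, a, h1, h2⟩ := exists_point_near hx (zeroDigits M) k
  refine ⟨_, h1, h2, ?_⟩
  rw [Reals.near_iff, hf.zero, val_constFun, Frac.real_zero, sub_self, abs_zero]
  exact epsR_pos k

omit [HasE2 M] in
theorem HasDenseFibers.not_cesaroType {f : M.RealFun} (hf : HasDenseFibers f) :
    ¬ f.CesaroType := by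
  rintro ⟨U, V, -, hV, ⟨x, hx⟩, ⟨y, hy⟩, -, h⟩
  obtain ⟨k, hk⟩ := hV y hy
  -- one of three nearby rationals is neither `0` nor `1`
  suffices ∃ z : M.Reals, V.Mem z ∧ z.val ≠ 0 ∧ z.val ≠ 1 by
    obtain ⟨z, hz, h0, h1⟩ := this
    obtain ⟨w, ⟨_, hw⟩, _⟩ := h z hz x hx 0
    rw [Reals.eq_iff] at hw
    rcases hf.zero_or_one w with h2 | h2
    · exact h0 (hw ▸ h2)
    · exact h1 (hw ▸ h2)
  set q := y.seq (k + 1 + 1) with hq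
  have hqd : 0 < q.den := y.seq_den_pos _
  have h1 := y.abs_val_sub_seq_le (k + 1 + 1)
  have h2 := epsR_succ k
  have h3 := epsR_succ (k + 1)
  have h4 := epsR_succ (k + 1 + 1)
  have h5 := epsR_pos (k + 1 + 1 + 1)
  have hpos : ∀ j : M.N, 0 < (q + M.eps j).den := fun j => mul_pos hqd (pow2_pos j)
  have hval : ∀ j : M.N, (ofFrac (q + M.eps j) (hpos j)).val = q.real + epsR j := fun j => by
    rw [val_ofFrac, Frac.real_add hqd (pow2_pos j)]
    rfl
  have hmem : ∀ z : M.Reals, q.real ≤ z.val → z.val ≤ q.real + epsR (k + 1 + 1) → V.Mem z := by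
    intro z hz hz'
    refine hk z (Reals.near_iff.2 ?_)
    rw [abs_le] at h1
    rw [abs_lt]
    constructor <;> linarith
  by_cases hz0 : q.real = 0 ∨ q.real = 1
  · refine ⟨ofFrac _ (hpos (k + 1 + 1 + 1)), hmem _ ?_ ?_, ?_, ?_⟩ <;> rw [hval]
    · linarith
    · linarith
    · rcases hz0 with h | h <;> rw [h]
      · linarith
      · linarith
    · have h6 := epsR_le_one (k + 1 + 1)
      have h7 := epsR_le_one (k + 1)
      rcases hz0 with h | h <;> rw [h]
      · intro h8
        linarith
      · intro h8
        linarith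
  · push Not at hz0
    refine ⟨ofFrac q hqd, hmem _ ?_ ?_, ?_, ?_⟩ <;> rw [val_ofFrac]
    · linarith
    · exact hz0.1
    · exact hz0.2

theorem HasDenseFibers.holds {f : M.RealFun} (hf : HasDenseFibers f) :
    ∀ Γ : WeakContinuity, Γ.Holds f
  | .young => hf.young
  | .husain => hf.husain
  | .graphContinuous => hf.graphContinuous
  | .notCesaroType => hf.not_cesaroType
  | .preContinuous => hf.preContinuous

end TypeStructure

/-! ### Infima of decidable sets of dyadic rationals -/

namespace TypeStructure

open FinType OrderedCompletion

variable {M : TypeStructure.{u}} [hM : IsModel M] [HasE2 M]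

/-- A decidable set `Q` of dyadic rationals `a / 2 ^ n` that contains `1` has an infimum among
the reals. -/
theorem exists_inf {Q : M.N → M.N → Prop} (hQ : Rep M (fun p : M.N × M.N => Q p.1 p.2))
    (h1 : Q 1 0) : ∃ z : M.Reals, 0 ≤ z.val ∧ z.val ≤ 1 ∧ (∀ a n, Q a n → z.val ≤ num a * epsR n) ∧
      ∀ k, ∃ a n, Q a n ∧ num a * epsR n < z.val + epsR k := by
  -- `up b m` says that some element of `Q` is at most `b / 2 ^ m`
  let up : M.N → M.N → Prop := fun b m => ∃ a n, Q a n ∧ a * M.pow2 m ≤ b * M.pow2 n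
  have hup : Rep M (fun p : M.N × M.N => up p.1 p.2) := by
    have : Rep M (fun p : ((M.N × M.N) × M.N) × M.N => Q p.1.2 p.2) :=
      hQ.comp_curried (by fun_prop) (by fun_prop)
    exact Rep.exists_num (Rep.exists_num (by fun_prop))
  have up_iff : ∀ b m, up b m ↔ ∃ a n, Q a n ∧ num a * epsR n ≤ num b * epsR m := by
    intro b m
    refine exists₂_congr fun a n => and_congr_right fun _ => ?_
    rw [← num_le, map_mul, map_mul]
    have h1 := epsR_mul_pow2 m
    have h2 := epsR_mul_pow2 n
    have h3 := mul_pos (epsR_pos m) (epsR_pos n)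
    rw [← mul_le_mul_iff_left₀ h3]
    have e1 : num a * num (M.pow2 m) * (epsR m * epsR n) = num a * epsR n := by
      calc _ = num a * epsR n * (epsR m * num (M.pow2 m)) := by ring
        _ = _ := by rw [h1, mul_one]
    have e2 : num b * num (M.pow2 n) * (epsR m * epsR n) = num b * epsR m := by
      calc _ = num b * epsR m * (epsR n * num (M.pow2 n)) := by ring
        _ = _ := by rw [h2, mul_one]
    rw [e1, e2]
  have hup1 : ∀ m, up (M.pow2 m) m := fun m => (up_iff _ _).2 ⟨1, 0, h1, by
    rw [mul_comm _ (epsR m), epsR_mul_pow2, epsR_zero, map_one, mul_one]⟩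
  have hupn : ∀ n, Rep M fun b => up b n := fun n => hup.comp_curried (by fun_prop) (by fun_prop)
  let c : M.N → M.N := fun n => least fun b => up b n
  have hc : Rep M c := Rep.least (hup.comp_curried (f := fun p : M.N × M.N => p.2)
    (g := fun p : M.N × M.N => p.1) (by fun_prop) (by fun_prop))
  have hcu : ∀ n, up (c n) n := fun n => least_spec (hupn n) ⟨_, hup1 n⟩
  have hcl : ∀ n b, up b n → c n ≤ b := fun n b h => least_le (hupn n) h
  -- every element of `Q` is at least `(c n - 1) / 2 ^ n`
  have hlow : ∀ n a m, Q a m → num (c n) * epsR n ≤ num a * epsR m + epsR n := by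
    intro n a m hq
    rcases num_eq_zero_or_one_le (c n) with h | h
    · rw [h, map_zero, zero_mul]
      exact add_nonneg (mul_nonneg (num_nonneg _) (epsR_pos _).le) (epsR_pos _).le
    · obtain ⟨b, hb⟩ := exists_add_of_le h
      by_contra! hlt
      have := hcl n b ((up_iff _ _).2 ⟨a, m, hq, by
        rw [hb, map_add, map_one] at hlt
        linarith⟩)
      rw [hb] at this
      exact this.not_gt (lt_add_of_pos_left b one_pos)
  have hmono : ∀ n i, num (c (n + i)) * epsR (n + i) ≤ num (c n) * epsR n := by
    intro n i
    have h2 : epsR n = num (M.pow2 i) * epsR (n + i) := by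
      rw [epsR_add, mul_comm (epsR n), ← mul_assoc, mul_comm _ (epsR i), epsR_mul_pow2, one_mul]
    have h3 : up (c n * M.pow2 i) (n + i) := by
      obtain ⟨a, m, hq, h⟩ := (up_iff _ _).1 (hcu n)
      refine (up_iff _ _).2 ⟨a, m, hq, h.trans_eq ?_⟩
      rw [map_mul, h2, mul_assoc]
    have h4 := num_le.2 (hcl _ _ h3)
    rw [map_mul] at h4
    rw [h2, ← mul_assoc]
    exact mul_le_mul_of_nonneg_right h4 (epsR_pos _).le
  have hdrop : ∀ n i, num (c n) * epsR n ≤ num (c (n + i)) * epsR (n + i) + epsR n := by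
    intro n i
    obtain ⟨a, m, hq, h⟩ := (up_iff _ _).1 (hcu (n + i))
    have := hlow n a m hq
    linarith
  have hden : ∀ n, 0 < (M.dyadic (c n) n).den := fun n => dyadic_den_pos _ _
  have hrep : Rep M fun n => M.dyadic (c n) n := by fun_prop
  have hreal : M.IsReal (codeSeq fun n => M.dyadic (c n) n) := by
    refine isReal_codeSeq hrep hden fun n i => ?_
    rw [dyadic_real, dyadic_real, abs_le]
    have := hmono n i
    have := hdrop n i
    have := epsR_pos n
    constructor <;> linarith
  set z : M.Reals := ⟨_, hreal⟩ with hz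
  have hseq : ∀ n, (z.seq n).real = num (c n) * epsR n := fun n => by
    rw [hz, seq_codeSeq hrep hden, dyadic_real]
  have hz1 : ∀ n, z.val ≤ num (c n) * epsR n := fun n => Reals.val_le_of_forall_le n fun i => by
    rw [hseq]
    exact hmono n i
  have hz2 : ∀ n, num (c n) * epsR n ≤ z.val + epsR n := fun n => by
    rw [← sub_le_iff_le_add]
    refine Reals.le_val_of_forall_le n fun i => ?_
    rw [hseq]
    linarith [hdrop n i]
  refine ⟨z, ?_, ?_, fun a n hq => ?_, fun k => ?_⟩
  · refine Reals.le_val_of_forall_le 0 fun i => ?_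
    rw [hseq]
    exact mul_nonneg (num_nonneg _) (epsR_pos _).le
  · refine (hz1 0).trans ?_
    have := num_le.2 (hcl 0 _ (hup1 0))
    rw [epsR_zero, mul_one]
    rwa [pow2_zero, map_one] at this
  · refine le_of_forall_le_add fun k => ?_
    linarith [hz1 k, hlow k a n hq]
  · obtain ⟨a, n, hq, h⟩ := (up_iff _ _).1 (hcu (k + 1))
    have h1 := hz2 (k + 1)
    have h2 := epsR_lt (lt_add_of_pos_right k one_pos)
    exact ⟨a, n, hq, by linarith⟩

/-- A real in `[0, 1]` is approximated from below by dyadic rationals in `[0, 1]`. -/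
theorem exists_dyadic_le {x : M.Reals} (h0 : 0 ≤ x.val) (h1 : x.val ≤ 1) (k : M.N) :
    ∃ a, num a * epsR k ≤ x.val ∧ x.val ≤ num a * epsR k + epsR k ∧ num a * epsR k ≤ 1 := by
  obtain ⟨h2, h3, -⟩ := ceilPred_spec h0 h1 k
  exact ⟨_, h2, by linarith, h2.trans h1⟩

end TypeStructure

/-! ### The properties to be decided, in terms of the real line -/

namespace TypeStructure

open FinType OrderedCompletion

variable {M : TypeStructure.{u}} [hM : IsModel M]

theorem RealFun.val_congr (f : M.RealFun) {x y : M.Reals} (h : x.val = y.val) :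
    (f.at x).val = (f.at y).val :=
  Reals.eq_iff.1 (f.ext x y (Reals.eq_iff.2 h))

theorem RealFun.contAt_iff {f : M.RealFun} {x : M.Reals} : f.ContAt x ↔ ∀ k : M.N, ∃ m : M.N,
    ∀ y : M.Reals, y.InUnit → |y.val - x.val| < epsR m →
      |(f.at y).val - (f.at x).val| < epsR k := by
  unfold RealFun.ContAt
  simp only [Reals.near_iff]

theorem RealFun.isRiemannSum_iff {f : M.RealFun} {m : M.N} {r : M.Reals} :
    f.IsRiemannSum m r ↔ ∃ (l : M.N) (x t s : M.RealSeq), (x.at 0).val = 0 ∧ (x.at l).val = 1 ∧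
      (∀ i < l, (x.at i).val ≤ (t.at i).val ∧ (t.at i).val ≤ (x.at (i + 1)).val ∧
        |(x.at (i + 1)).val - (x.at i).val| < epsR m) ∧
      (s.at 0).val = 0 ∧
      (∀ i < l, (s.at (i + 1)).val = (s.at i).val +
        (f.at (t.at i)).val * ((x.at (i + 1)).val - (x.at i).val)) ∧
      r.val = (s.at l).val := by
  have h0 : ∀ y : M.Reals, LimEq y.seq (fun _ => 0) ↔ y.val = 0 := fun y => by
    rw [limEq_iff y.isCauchy .zero, limit_zero]
    rfl
  have h1 : ∀ y : M.Reals, LimEq y.seq (fun _ => 1) ↔ y.val = 1 := fun y => by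
    rw [limEq_iff y.isCauchy .one, limit_one]
    rfl
  have h2 : ∀ s' s t x' x : M.Reals, LimEq s'.seq
      (fun j => s.seq j + t.seq j * (x'.seq j - x.seq j)) ↔
      s'.val = s.val + t.val * (x'.val - x.val) := fun s' s t x' x => by
    have e1 := x'.isCauchy.sub x.isCauchy
    have e2 := t.isCauchy.mul e1
    rw [limEq_iff s'.isCauchy (s.isCauchy.add e2), limit_add s.isCauchy e2,
      limit_mul t.isCauchy e1, limit_sub x'.isCauchy x.isCauchy]
    rfl
  unfold RealFun.IsRiemannSum
  simp only [h0, h1, h2, Reals.le_iff, Reals.near_iff, Reals.eq_iff]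

theorem RealFun.riemannIntegrable_iff {f : M.RealFun} : f.RiemannIntegrable ↔ ∀ k : M.N,
    ∃ m : M.N, ∀ r r' : M.Reals, f.IsRiemannSum m r → f.IsRiemannSum m r' →
      |r.val - r'.val| ≤ epsR k := by
  have h : ∀ (k : M.N) (r r' : M.Reals), LimLe (fun n => (r.seq n - r'.seq n).abs)
      (fun _ => M.eps k) ↔ |r.val - r'.val| ≤ epsR k := fun k r r' => by
    have e := r.isCauchy.sub r'.isCauchy
    rw [limLe_iff e.abs (.eps k), limit_abs e, limit_sub r.isCauchy r'.isCauchy]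
    rfl
  unfold RealFun.RiemannIntegrable
  simp only [h]

theorem RealFun.continuousAE_iff {f : M.RealFun} : f.ContinuousAE ↔ ∀ k : M.N,
    ∃ a b s : M.RealSeq, (∀ n, (a.at n).val ≤ (b.at n).val) ∧ (s.at 0).val = 0 ∧
      (∀ n, (s.at (n + 1)).val = (s.at n).val + ((b.at n).val - (a.at n).val)) ∧
      (∀ n, (s.at n).val ≤ epsR k) ∧
      ∀ x : M.Reals, x.InUnit → ¬ f.ContAt x →
        ∃ n, (a.at n).val < x.val ∧ x.val < (b.at n).val := by
  have h0 : ∀ y : M.Reals, LimEq y.seq (fun _ => 0) ↔ y.val = 0 := fun y => by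
    rw [limEq_iff y.isCauchy .zero, limit_zero]
    rfl
  have h1 : ∀ (k : M.N) (y : M.Reals), LimLe y.seq (fun _ => M.eps k) ↔ y.val ≤ epsR k :=
    fun k y => limLe_iff y.isCauchy (.eps k)
  have h2 : ∀ s' s b a : M.Reals, LimEq s'.seq (fun i => s.seq i + (b.seq i - a.seq i)) ↔
      s'.val = s.val + (b.val - a.val) := fun s' s b a => by
    have e := b.isCauchy.sub a.isCauchy
    rw [limEq_iff s'.isCauchy (s.isCauchy.add e), limit_add s.isCauchy e,
      limit_sub b.isCauchy a.isCauchy]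
    rfl
  unfold RealFun.ContinuousAE
  simp only [h0, h1, h2, Reals.le_iff, Reals.lt_iff]

theorem RealFun.intermediateValue_iff {f : M.RealFun} : f.IntermediateValue ↔
    ∀ x y c : M.Reals, x.InUnit → y.InUnit → x.val < y.val →
      (((f.at x).val ≤ c.val ∧ c.val ≤ (f.at y).val) ∨
        ((f.at y).val ≤ c.val ∧ c.val ≤ (f.at x).val)) →
      ∃ z : M.Reals, x.val ≤ z.val ∧ z.val ≤ y.val ∧ (f.at z).val = c.val := by
  unfold RealFun.IntermediateValue
  simp only [Reals.le_iff, Reals.lt_iff, Reals.eq_iff]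

theorem PlaneSet.mem_congr (O : M.PlaneSet) {x x' y y' : M.Reals} (hx : x.val = x'.val)
    (hy : y.val = y'.val) : O.Mem x y ↔ O.Mem x' y' := by
  unfold PlaneSet.Mem
  rw [O.ext x x' y y' (Reals.eq_iff.2 hx) (Reals.eq_iff.2 hy)]

/-- The properties to be decided only depend on the values of the function. -/
theorem DecidedProperty.holds_congr {f g : M.RealFun} (h : ∀ x, (f.at x).val = (g.at x).val)
    (P : DecidedProperty) : P.Holds f ↔ P.Holds g := by
  have hc : ∀ x, f.ContAt x ↔ g.ContAt x := fun x => by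
    simp only [RealFun.contAt_iff, h]
  cases P with
  | stallings =>
    have e : ∀ (O : M.PlaneSet) x, O.Mem x (f.at x) ↔ O.Mem x (g.at x) :=
      fun O x => O.mem_congr rfl (h x)
    simp only [Holds, RealFun.Stallings, e]
  | continuous => simp only [Holds, RealFun.Continuous, hc]
  | continuousAE => simp only [Holds, RealFun.ContinuousAE, hc]
  | riemannIntegrable =>
    simp only [Holds, RealFun.RiemannIntegrable, RealFun.isRiemannSum_iff, h]
  | intermediateValue => simp only [Holds, RealFun.intermediateValue_iff, h]

/-! ### The zero function has all properties -/

/-- The constant sequence with value `x`. -/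
def constSeq (x : M.Reals) : M.RealSeq where
  val := M.K _ _ x.1
  isReal n := by
    rw [hM.out.K_eq]
    exact x.2

theorem at_constSeq (x : M.Reals) (n : M.N) : (constSeq x).at n = x :=
  Subtype.ext (hM.out.K_eq _ _ _ _)

theorem DecidedProperty.holds_of_val_eq_zero [HasE2 M] {f : M.RealFun}
    (h : ∀ x, (f.at x).val = 0) (P : DecidedProperty) : P.Holds f := by
  have hcont : f.Continuous := continuous_of_val_eq h
  cases P with
  | stallings => exact fun O _ hO => ⟨f, hcont, hO⟩
  | continuous => exact hcont
  | continuousAE =>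
    refine RealFun.continuousAE_iff.2 fun k => ?_
    have h0 : (ofFrac (M := M) 0 one_pos).val = 0 := by rw [val_ofFrac, Frac.real_zero]
    refine ⟨constSeq (ofFrac 0 one_pos), constSeq (ofFrac 0 one_pos),
      constSeq (ofFrac 0 one_pos), ?_, ?_, ?_, ?_, fun x hx hx' => absurd (hcont x hx) hx'⟩ <;>
      simp only [at_constSeq, h0, le_refl, sub_self, add_zero, implies_true]
    exact fun _ => (epsR_pos k).le
  | riemannIntegrable =>
    have key : ∀ (m : M.N) (r : M.Reals), f.IsRiemannSum m r → r.val = 0 := by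
      intro m r hr
      obtain ⟨l, x, t, s, -, -, -, h0, hs, hr⟩ := RealFun.isRiemannSum_iff.1 hr
      rw [hr]
      have hrep : Rep M fun i => i ≤ l → LimEq (sq (s.val i)) fun _ => 0 :=
        Rep.imp (by fun_prop) (by fun_prop)
      have hiff : ∀ i, LimEq (sq (s.val i)) (fun _ => 0) ↔ (s.at i).val = 0 := fun i => by
        have := limEq_iff (s.at i).isCauchy .zero
        rwa [limit_zero] at this
      simp only [hiff] at hrep
      refine induction_on hrep (fun _ => h0) (fun i ih hi => ?_) l le_rfl
      have hi' : i < l := num_add_one_le.1 hi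
      rw [hs i hi', ih hi'.le, h, zero_mul, add_zero]
    refine RealFun.riemannIntegrable_iff.2 fun k => ⟨0, fun r r' hr hr' => ?_⟩
    rw [key 0 r hr, key 0 r' hr', sub_self, abs_zero]
    exact (epsR_pos k).le
  | intermediateValue =>
    refine RealFun.intermediateValue_iff.2 fun x y c _ _ hxy hc => ⟨x, le_rfl, hxy.le, ?_⟩
    rw [h] at *
    rw [h] at hc
    rcases hc with hc | hc <;> exact le_antisymm hc.1 hc.2

end TypeStructure

/-! ### Functions with two dense fibres fail to be continuous, integrable or Darboux -/

namespace TypeStructure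

open FinType OrderedCompletion

variable {M : TypeStructure.{u}} [hM : IsModel M] [HasE2 M]

omit [HasE2 M] in
theorem epsR_one : epsR (1 : M.N) + epsR 1 = 1 := by
  have := epsR_succ (0 : M.N)
  rwa [zero_add, epsR_zero] at this

/-- The sequence of reals given by a sequence of fractions. -/
noncomputable def fracSeq (q : M.N → Frac M) (hq : Rep M q) (hden : ∀ n, 0 < (q n).den) :
    M.RealSeq where
  val := lam fun n => codeSeq fun _ => q n
  isReal n := by
    have h : Rep M fun n => codeSeq fun _ => q n := by fun_prop
    rw [Rep.lam_app h]
    exact (ofFrac (q n) (hden n)).2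

omit [HasE2 M] in
theorem val_at_fracSeq (q : M.N → Frac M) (hq : Rep M q) (hden : ∀ n, 0 < (q n).den) (n : M.N) :
    ((fracSeq q hq hden).at n).val = (q n).real := by
  have h : Rep M fun n => codeSeq fun _ => q n := by fun_prop
  rw [← val_ofFrac (q n) (hden n)]
  exact congrArg Reals.val (Subtype.ext (Rep.lam_app h n))

omit [HasE2 M] in
theorem point_zeroDigits_bounds (A : M.El one) : 0 ≤ (point (zeroDigits M) 1 0).val ∧
    (point (zeroDigits M) 1 0).val < (point A 1 1).val ∧ (point A 1 1).val ≤ 1 := by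
  obtain ⟨h1, h2⟩ := point_bounds_zero (zeroDigits M) 1 0
  obtain ⟨h3, h4⟩ := point_bounds_zero A 1 1
  have h5 := eps4_succ (0 : M.N)
  rw [zero_add, eps4_zero] at h5
  rw [map_zero] at h1 h2
  rw [map_one] at h3 h4
  refine ⟨?_, ?_, ?_⟩ <;> linarith

omit [HasE2 M] in
/-- If `f` has the value `c` at the points with tail `B`, then `c` is a Riemann sum of `f`. -/
theorem exists_isRiemannSum {f : M.RealFun} {B : M.El one} {c : M.RealLine}
    (hB : ∀ k a, (f.at (point B k a)).val = c) {m : M.N} {s : M.RealSeq}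
    (hs : ∀ i, (s.at i).val = c * (num i * eps4 (m + 1))) :
    ∃ r, f.IsRiemannSum m r ∧ r.val = c := by
  have hl : num (pow4 (m + 1)) * eps4 (m + 1) = 1 := by rw [mul_comm, eps4_mul_pow4]
  have hq : Rep M fun i => M.dyadic i ((m + 1) + (m + 1)) := by fun_prop
  have ht : Rep M fun i => codeSeq (pointSeq B (m + 1) i) := by fun_prop
  let x := fracSeq (fun i => M.dyadic i ((m + 1) + (m + 1))) hq fun _ => dyadic_den_pos _ _
  let t : M.RealSeq := ⟨lam fun i => codeSeq (pointSeq B (m + 1) i), fun n => by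
    rw [Rep.lam_app ht]
    exact isReal_point _ _ _⟩
  have hx : ∀ i, (x.at i).val = num i * eps4 (m + 1) := fun i => by
    rw [val_at_fracSeq, dyadic_real]
    rfl
  have htv : ∀ i, t.at i = point B (m + 1) i := fun i => Subtype.ext (Rep.lam_app ht i)
  refine ⟨s.at (pow4 (m + 1)), RealFun.isRiemannSum_iff.2 ⟨pow4 (m + 1), x, t, s, ?_, ?_,
    fun i _ => ?_, ?_, fun i _ => ?_, rfl⟩, ?_⟩
  · rw [hx, map_zero, zero_mul]
  · rw [hx, hl]
  · obtain ⟨h1, h2⟩ := point_bounds_zero B (m + 1) i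
    have h3 := eps4_pos (m + 1)
    have h4 := (eps4_le (m + 1)).trans_lt (epsR_lt (lt_add_of_pos_right m one_pos))
    rw [hx, hx, htv, map_add, map_one]
    refine ⟨h1, by linarith, ?_⟩
    rw [add_mul, one_mul, add_sub_cancel_left, abs_of_pos h3]
    exact h4
  · rw [hs, map_zero, zero_mul, mul_zero]
  · rw [hs, hs, hx, hx, htv, hB, map_add, map_one]
    ring
  · rw [hs, hl, mul_one]

namespace HasDenseFibers

variable {f : M.RealFun} (hf : HasDenseFibers f) {A : M.El FinType.one}
  (hA : ∀ k a, (f.at (point A k a)).val = 1)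
include hf hA

theorem not_contAt {x : M.Reals} (hx : x.InUnit) : ¬ f.ContAt x := by
  intro h
  obtain ⟨m, hm⟩ := RealFun.contAt_iff.1 h 0
  obtain ⟨j, a, h1, h2⟩ := exists_point_near hx (zeroDigits M) m
  obtain ⟨j', a', h1', h2'⟩ := exists_point_near hx A m
  have h3 := hm _ h1 (Reals.near_iff.1 h2)
  have h3' := hm _ h1' (Reals.near_iff.1 h2')
  rw [hf.zero, epsR_zero] at h3
  rw [hA, epsR_zero] at h3'
  rcases hf.zero_or_one x with h | h <;> simp [h] at h3 h3'

theorem not_continuous : ¬ f.Continuous := by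
  intro h
  have hx : (point A 1 1).InUnit := by
    obtain ⟨h1, h2, h3⟩ := point_zeroDigits_bounds A
    exact Reals.inUnit_iff.2 ⟨by linarith, h3⟩
  exact hf.not_contAt hA hx (h _ hx)

omit [HasE2 M] in
theorem not_intermediateValue : ¬ f.IntermediateValue := by
  intro h
  obtain ⟨h1, h2, h3⟩ := point_zeroDigits_bounds A
  have h4 := epsR_one (M := M)
  have hc : (ofFrac (M.dyadic 1 1) (dyadic_den_pos 1 1)).val = epsR 1 := by
    rw [val_ofFrac, dyadic_real, map_one, one_mul]
  obtain ⟨z, -, -, hz⟩ := RealFun.intermediateValue_iff.1 h (point (zeroDigits M) 1 0)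
    (point A 1 1) (ofFrac (M.dyadic 1 1) (dyadic_den_pos 1 1))
    (Reals.inUnit_iff.2 ⟨by linarith, by linarith⟩) (Reals.inUnit_iff.2 ⟨by linarith, by linarith⟩)
    h2 (.inl (by rw [hf.zero, hA, hc]; constructor <;> linarith))
  rw [hc] at hz
  rcases hf.zero_or_one z with h | h <;> rw [h] at hz <;> linarith

omit [HasE2 M] in
theorem not_riemannIntegrable : ¬ f.RiemannIntegrable := by
  intro h
  obtain ⟨m, hm⟩ := RealFun.riemannIntegrable_iff.1 h 1
  obtain ⟨r, hr, hr0⟩ := exists_isRiemannSum (m := m) (f := f) hf.zero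
    (s := constSeq (ofFrac 0 one_pos)) fun i => by
      rw [at_constSeq, val_ofFrac, Frac.real_zero, zero_mul]
  have hq : Rep M fun i => M.dyadic i ((m + 1) + (m + 1)) := by fun_prop
  obtain ⟨r', hr', hr1⟩ := exists_isRiemannSum (m := m) (f := f) hA
    (s := fracSeq (fun i => M.dyadic i ((m + 1) + (m + 1))) hq fun _ => dyadic_den_pos _ _)
    fun i => by
      rw [val_at_fracSeq, dyadic_real, one_mul]
      rfl
  have h1 := hm r' r hr' hr
  have h2 := epsR_one (M := M)
  rw [hr0, hr1, sub_zero, abs_one] at h1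
  linarith [epsR_pos (1 : M.N)]

end HasDenseFibers

end TypeStructure

/-! ### Covers of the unit interval by short intervals -/

namespace TypeStructure

open FinType OrderedCompletion

variable {M : TypeStructure.{u}} [hM : IsModel M] [HasE2 M]

omit [HasE2 M] in
theorem Frac.le_iff_real {q r : Frac M} (hq : 0 < q.den) (hr : 0 < r.den) :
    q ≤ r ↔ q.real ≤ r.real := by
  rw [Frac.le_iff hq hr, Frac.real_le]

/-- Sequences of fractions can be summed. -/
theorem exists_fracSum {X : Type*} [Asm M X] {c : X → M.N → Frac M}
    (hc : Rep M fun p : X × M.N => c p.1 p.2) (hden : ∀ x n, 0 < (c x n).den) :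
    ∃ T : X → M.N → Frac M, Rep M (fun p : X × M.N => T p.1 p.2) ∧ (∀ x n, 0 < (T x n).den) ∧
      (∀ x, (T x 0).real = 0) ∧ ∀ x n, (T x (n + 1)).real = (T x n).real + (c x n).real := by
  have hs : Rep M fun p : (X × M.N) × M.N => c p.1.1 p.1.2 :=
    hc.comp_curried (by fun_prop) (by fun_prop)
  obtain ⟨φ, hφ, h0, h1⟩ := exists_recursion (z := fun _ : X => (0 : Frac M).code)
    (s := fun x n e => (M.decode e + c x n).code) (by fun_prop) (by fun_prop)
  refine ⟨fun x n => M.decode (φ x n), by fun_prop, fun x n => decode_den_pos _, fun x => ?_,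
    fun x n => ?_⟩
  · change (M.decode (φ x 0)).real = 0
    rw [h0, decode_code one_pos, Frac.real_zero]
  · change (M.decode (φ x (n + 1))).real = (M.decode (φ x n)).real + _
    have h := decode_den_pos (φ x n)
    rw [h1, decode_code (mul_pos h (hden x n)), Frac.real_add h (hden x n)]

/-- The minimum of two fractions. -/
noncomputable def Frac.min (q r : Frac M) : Frac M := open Classical in if q ≤ r then q else r

@[fun_prop]
theorem Rep.frac_min {X : Type*} [Asm M X] {f g : X → Frac M} (hf : Rep M f) (hg : Rep M g) :
    Rep M (fun x => (f x).min (g x)) := by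
  classical
  refine Rep.congr (f := fun x => if f x ≤ g x then f x else g x) (by fun_prop) fun x => ?_
  unfold Frac.min
  congr

omit hM [HasE2 M] in
theorem Frac.min_den_pos {q r : Frac M} (hq : 0 < q.den) (hr : 0 < r.den) : 0 < (q.min r).den := by
  unfold Frac.min
  split_ifs
  exacts [hq, hr]

omit [HasE2 M] in
theorem Frac.real_min {q r : Frac M} (hq : 0 < q.den) (hr : 0 < r.den) :
    (q.min r).real = Min.min q.real r.real := by
  unfold Frac.min
  split_ifs with h
  · rw [min_eq_left ((le_iff_real hq hr).1 h)]
  · rw [min_eq_right (not_le.1 fun h' => h ((le_iff_real hq hr).2 h')).le]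

/-- A real in `(0, 1]` is approximated strictly from below by dyadic rationals in `[0, 1]`. -/
theorem exists_dyadic_lt {x : M.Reals} (h0 : 0 < x.val) (h1 : x.val ≤ 1) (k : M.N) :
    ∃ a, num a * epsR k < x.val ∧ x.val ≤ num a * epsR k + epsR k := by
  obtain ⟨a, h2, h3, -⟩ := exists_dyadic_le h0.le h1 k
  rcases h2.lt_or_eq with h2 | h2
  · exact ⟨a, h2, h3⟩
  · rcases num_eq_zero_or_one_le a with rfl | ha
    · rw [map_zero, zero_mul] at h2
      exact absurd h2 h0.ne
    · obtain ⟨b, rfl⟩ := exists_add_of_le ha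
      rw [map_add, map_one] at h2
      have := epsR_pos k
      exact ⟨b, by linarith, by linarith⟩

/-- Intervals with fractions as end points that cover `[0, 1]` have a finite part of total length
at least `1`.  For `q ∈ [0, 1]` let `T q m` be the total length of the parts of the first `m`
intervals to the left of `q`.  The infimum of the `q` with `T q m < q` for all `m` cannot lie in
one of the intervals, since on that interval `T q m - q` does not decrease, for large `m`. -/
theorem one_le_fracSum {a b : M.N → Frac M} (ha : Rep M a) (hb : Rep M b)
    (had : ∀ n, 0 < (a n).den) (hbd : ∀ n, 0 < (b n).den)
    (hab : ∀ n, (a n).real ≤ (b n).real)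
    (hcov : ∀ x : M.Reals, x.InUnit → ∃ n, (a n).real < x.val ∧ x.val < (b n).real)
    {s : M.N → Frac M} (hs : Rep M s) (hsd : ∀ n, 0 < (s n).den) (hs0 : (s 0).real = 0)
    (hs1 : ∀ n, (s (n + 1)).real = (s n).real + ((b n).real - (a n).real)) :
    ∃ m, 1 ≤ (s m).real := by
  by_contra! hlt
  have hmd := fun (q : Frac M) (hq : 0 < q.den) n =>
    (⟨Frac.min_den_pos (hbd n) hq, Frac.min_den_pos (had n) hq⟩ :
      0 < ((b n).min q).den ∧ 0 < ((a n).min q).den)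
  obtain ⟨T, hT, hTd, hT0, hT1⟩ := exists_fracSum (X := M.N × M.N)
    (c := fun p n => (b n).min (M.dyadic p.1 p.2) - (a n).min (M.dyadic p.1 p.2))
    (by fun_prop) fun p n => mul_pos (hmd _ (dyadic_den_pos _ _) n).1
      (hmd _ (dyadic_den_pos _ _) n).2
  have hT2 : ∀ p n, (T p (n + 1)).real = (T p n).real +
      (min (b n).real (num p.1 * epsR p.2) - min (a n).real (num p.1 * epsR p.2)) := by
    intro p n
    have h := dyadic_den_pos p.1 p.2
    rw [hT1, Frac.real_sub (hmd _ h n).1 (hmd _ h n).2, Frac.real_min (hbd n) h,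
      Frac.real_min (had n) h, dyadic_real]
  -- monotonicity in `m` and in `q`
  have hmono : ∀ p m i, (T p m).real ≤ (T p (m + i)).real := fun p m i => by
    have hTp : Rep M fun i => T p (m + i) := hT.comp_curried (by fun_prop) (by fun_prop)
    have h := induction_on (p := fun i => T p m ≤ T p (m + i)) (by fun_prop)
      (by rw [add_zero, Frac.le_iff_real (hTd _ _) (hTd _ _)]) (fun i ih => by
        rw [Frac.le_iff_real (hTd _ _) (hTd _ _)] at ih ⊢
        rw [← add_assoc, hT2]
        have := min_le_min_right (num p.1 * epsR p.2) (hab (m + i))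
        linarith) i
    rwa [Frac.le_iff_real (hTd _ _) (hTd _ _)] at h
  have hmin : ∀ {c d x y : M.RealLine}, c ≤ d → x ≤ y →
      min d x - min c x ≤ min d y - min c y := by
    intro c d x y hcd hxy
    rcases le_total d x with h1 | h1 <;> rcases le_total c x with h2 | h2 <;>
      rcases le_total d y with h3 | h3 <;> rcases le_total c y with h4 | h4 <;>
      simp only [min_eq_left, min_eq_right, h1, h2, h3, h4] <;> linarith
  have hmonoq : ∀ p p' : M.N × M.N, num p.1 * epsR p.2 ≤ num p'.1 * epsR p'.2 → ∀ m,
      (T p m).real ≤ (T p' m).real := fun p p' hp m => by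
    have hTp : ∀ p, Rep M fun i => T p i := fun p => hT.comp_curried (by fun_prop) (by fun_prop)
    have h1 := hTp p
    have h2 := hTp p'
    have h := induction_on (p := fun i => T p i ≤ T p' i) (by fun_prop)
      (by rw [Frac.le_iff_real (hTd _ _) (hTd _ _), hT0, hT0]) (fun i ih => by
        rw [Frac.le_iff_real (hTd _ _) (hTd _ _)] at ih ⊢
        rw [hT2, hT2]
        have := hmin (hab i) hp
        linarith) m
    rwa [Frac.le_iff_real (hTd _ _) (hTd _ _)] at h
  -- the parts to the left of `p` have total length at most `s m`
  have hTs : ∀ p m, (T p m).real ≤ (s m).real := fun p m => by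
    have hTp : Rep M fun i => T p i := hT.comp_curried (by fun_prop) (by fun_prop)
    have h := induction_on (p := fun i => T p i ≤ s i) (by fun_prop)
      (by rw [Frac.le_iff_real (hTd _ _) (hsd _), hT0, hs0]) (fun i ih => by
        rw [Frac.le_iff_real (hTd _ _) (hsd _)] at ih ⊢
        rw [hT2, hs1]
        have h1 := hab i
        have : min (b i).real (num p.1 * epsR p.2) - min (a i).real (num p.1 * epsR p.2) ≤
            (b i).real - (a i).real := by
          rcases le_total (b i).real (num p.1 * epsR p.2) with h2 | h2 <;>
            rcases le_total (a i).real (num p.1 * epsR p.2) with h3 | h3 <;>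
            simp only [min_eq_left, min_eq_right, h2, h3] <;> linarith
        linarith) m
    rwa [Frac.le_iff_real (hTd _ _) (hsd _)] at h
  -- the infimum
  have hQ : Rep M fun p : M.N × M.N => ∀ m, ¬ M.dyadic p.1 p.2 ≤ T p m :=
    Rep.forall_num (by fun_prop)
  have hQ' : ∀ a n, (∀ m, ¬ M.dyadic a n ≤ T (a, n) m) ↔
      ∀ m, (T (a, n) m).real < num a * epsR n := fun a n => by
    simp only [Frac.le_iff_real (dyadic_den_pos _ _) (hTd _ _), dyadic_real, not_le]
  obtain ⟨z, hz0, hz1, hzl, hzg⟩ := exists_inf (Q := fun a n => ∀ m, ¬ M.dyadic a n ≤ T (a, n) m)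
    hQ ((hQ' _ _).2 fun m => by
      rw [map_one, epsR_zero, one_mul]
      exact (hTs _ m).trans_lt (hlt m))
  simp only [hQ'] at hzl hzg
  obtain ⟨n, hn1, hn2⟩ := hcov z (Reals.inUnit_iff.2 ⟨hz0, hz1⟩)
  -- a dyadic rational `q ≤ z` in the interval around `z` with `q ≤ T q m` for some `m`
  obtain ⟨p, hpz, hpa, m, hm⟩ : ∃ p : M.N × M.N, num p.1 * epsR p.2 ≤ z.val ∧
      (a n).real ≤ num p.1 * epsR p.2 ∧ ∃ m, num p.1 * epsR p.2 ≤ (T p m).real := by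
    rcases hz0.lt_or_eq with hz | hz
    · obtain ⟨k, hk⟩ := exists_epsR_lt (sub_pos.2 hn1)
      obtain ⟨c, hc1, hc2⟩ := exists_dyadic_lt hz hz1 k
      refine ⟨(c, k), hc1.le, by linarith, ?_⟩
      by_contra! hcon
      exact (hzl c k hcon).not_gt hc1
    · refine ⟨(0, 0), ?_, ?_, 0, ?_⟩
      · rw [map_zero, zero_mul]
        exact hz0
      · rw [map_zero, zero_mul, hz]
        exact hn1.le
      · rw [map_zero, zero_mul, hT0]
  obtain ⟨k, hk⟩ := exists_epsR_lt (sub_pos.2 hn2)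
  obtain ⟨a', n', h1, h2⟩ := hzg k
  have h3 := hzl a' n' h1
  have h4 : ∀ i, (T p (n + 1 + i)).real + (num a' * epsR n' - num p.1 * epsR p.2) ≤
      (T (a', n') (n + 1 + i)).real := fun i => by
    have hTp : ∀ p, Rep M fun i => T p (n + 1 + i) := fun p =>
      hT.comp_curried (by fun_prop) (by fun_prop)
    have e1 := hTp p
    have e2 := hTp (a', n')
    have hle : ∀ i, T p (n + 1 + i) + (M.dyadic a' n' - M.dyadic p.1 p.2) ≤
        T (a', n') (n + 1 + i) ↔
        (T p (n + 1 + i)).real + (num a' * epsR n' - num p.1 * epsR p.2) ≤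
        (T (a', n') (n + 1 + i)).real := fun i => by
      have d1 := dyadic_den_pos a' n'
      have d2 := dyadic_den_pos p.1 p.2
      have d3 : 0 < (M.dyadic a' n' - M.dyadic p.1 p.2).den := mul_pos d1 d2
      rw [Frac.le_iff_real (mul_pos (hTd _ _) d3) (hTd _ _),
        Frac.real_add (hTd _ _) d3, Frac.real_sub d1 d2, dyadic_real, dyadic_real]
    have h := induction_on (p := fun i => T p (n + 1 + i) +
      (M.dyadic a' n' - M.dyadic p.1 p.2) ≤ T (a', n') (n + 1 + i)) (by fun_prop) (by
        rw [hle, add_zero, hT2, hT2]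
        have h5 := hmonoq p (a', n') (hpz.trans h3) n
        dsimp only
        rw [min_eq_right (hpz.trans hn2.le), min_eq_left hpa,
          min_eq_right (b := num a' * epsR n') (by linarith),
          min_eq_left (b := num a' * epsR n') (by linarith)]
        linarith) (fun i ih => by
        rw [hle] at ih ⊢
        rw [← add_assoc, hT2, hT2]
        have := hmin (hab (n + 1 + i)) (hpz.trans h3)
        dsimp only
        linarith) i
    rwa [hle] at h
  have h5 := h4 m
  have h6 := hmono p m (n + 1)
  rw [add_comm m] at h6
  have h7 := h1 (n + 1 + m)
  linarith

/-- The unit interval is not covered by open intervals of total length at most `1 / 4`. -/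
theorem not_cover {a b s : M.RealSeq} (hab : ∀ n, (a.at n).val ≤ (b.at n).val)
    (hs0 : (s.at 0).val = 0)
    (hs1 : ∀ n, (s.at (n + 1)).val = (s.at n).val + ((b.at n).val - (a.at n).val))
    (hs2 : ∀ n, (s.at n).val ≤ epsR (1 + 1)) :
    ¬ ∀ x : M.Reals, x.InUnit → ∃ n, (a.at n).val < x.val ∧ x.val < (b.at n).val := by
  intro hcov
  -- the end points are moved apart, to fractions, by at most `1 / 2 ^ (n + 3)`
  let a' : M.N → Frac M := fun n => sq (a.val n) (n + 4) - M.eps (n + 4)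
  let b' : M.N → Frac M := fun n => sq (b.val n) (n + 4) + M.eps (n + 4)
  have ha' : Rep M a' := by fun_prop
  have hb' : Rep M b' := by fun_prop
  have had : ∀ n, 0 < (a' n).den := fun n => mul_pos (decode_den_pos _) (pow2_pos _)
  have hbd : ∀ n, 0 < (b' n).den := fun n => mul_pos (decode_den_pos _) (pow2_pos _)
  have har : ∀ n, (a.at n).val - 2 * epsR (n + 4) ≤ (a' n).real ∧ (a' n).real ≤ (a.at n).val :=
    fun n => by
      have h := (a.at n).abs_val_sub_seq_le (n + 4)
      have e : (a' n).real = ((a.at n).seq (n + 4)).real - epsR (n + 4) :=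
        Frac.real_sub (decode_den_pos _) (pow2_pos _)
      rw [abs_le] at h
      constructor <;> linarith
  have hbr : ∀ n, (b.at n).val ≤ (b' n).real ∧ (b' n).real ≤ (b.at n).val + 2 * epsR (n + 4) :=
    fun n => by
      have h := (b.at n).abs_val_sub_seq_le (n + 4)
      have e : (b' n).real = ((b.at n).seq (n + 4)).real + epsR (n + 4) :=
        Frac.real_add (decode_den_pos _) (pow2_pos _)
      rw [abs_le] at h
      constructor <;> linarith
  obtain ⟨S, hS, hSd, hS0, hS1⟩ := exists_fracSum (X := M.N) (c := fun _ n => b' n - a' n)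
    (by fun_prop) fun _ n => mul_pos (hbd n) (had n)
  have hS2 : ∀ n, (S 0 (n + 1)).real = (S 0 n).real + ((b' n).real - (a' n).real) := fun n => by
    rw [hS1, Frac.real_sub (hbd n) (had n)]
  have hSr := hS.curry_left 0
  obtain ⟨m, hm⟩ := one_le_fracSum ha' hb' had hbd
    (fun n => (har n).2.trans ((hab n).trans (hbr n).1))
    (fun x hx => by
      obtain ⟨n, h1, h2⟩ := hcov x hx
      exact ⟨n, (har n).2.trans_lt h1, h2.trans_le (hbr n).1⟩) hSr (hSd 0) (hS0 0) hS2
  have hle : ∀ m, LimLe (fun _ => S 0 m + M.eps (m + 1)) (fun i => sq (s.val m) i + M.eps 1) ↔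
      (S 0 m).real + epsR (m + 1) ≤ (s.at m).val + epsR 1 := fun m => by
    have h1 : IsCauchy fun _ : M.N => S 0 m + M.eps (m + 1) :=
      .const (mul_pos (hSd 0 m) (pow2_pos _))
    have h2 := (s.at m).isCauchy.add (.eps 1)
    have h3 := limLe_iff h1 h2
    rw [limit_add (.const (hSd 0 m)) (.eps _), limit_add (s.at m).isCauchy (.eps 1)] at h3
    exact h3
  have hind : ∀ m, LimLe (fun _ => S 0 m + M.eps (m + 1)) (fun i => sq (s.val m) i + M.eps 1) := by
    refine induction_on (by fun_prop) ?_ fun n ih => ?_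
    · rw [hle, hS0, hs0, zero_add (1 : M.N)]
    · rw [hle] at ih ⊢
      rw [hS2, hs1]
      have h1 := epsR_succ (n + 1)
      have h2 := epsR_succ (n + 1 + 1)
      have h3 := epsR_succ (n + 1 + 1 + 1)
      rw [show n + 1 + 1 + 1 + 1 = n + 4 by ring] at h3
      linarith [har n, hbr n]
  have h1 := (hle m).1 (hind m)
  have h2 := hs2 m
  have h3 := epsR_one (M := M)
  have h4 := epsR_succ (1 : M.N)
  have h5 := epsR_pos (m + 1)
  have h6 := epsR_pos (1 + 1 : M.N)
  linarith

theorem HasDenseFibers.not_continuousAE {f : M.RealFun} (hf : HasDenseFibers f)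
    {A : M.El FinType.one} (hA : ∀ k a, (f.at (point A k a)).val = 1) : ¬ f.ContinuousAE := by
  intro h
  obtain ⟨a, b, s, hab, hs0, hs1, hs2, hc⟩ := RealFun.continuousAE_iff.1 h (1 + 1)
  exact not_cover hab hs0 hs1 hs2 fun x hx => hc x hx (hf.not_contAt hA hx)

end TypeStructure

/-! ### Plane sets, and the failure of Stallings' property -/

namespace TypeStructure

open FinType OrderedCompletion

variable {M : TypeStructure.{u}} [hM : IsModel M]

section PlaneSets

variable {P : M.El one → M.El one → Prop} (hP : Rep M fun p : M.El one × M.El one => P p.1 p.2)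
  (hext : ∀ x x' y y' : M.Reals, x.val = x'.val → y.val = y'.val → (P x.1 y.1 ↔ P x'.1 y'.1))

open Classical in
theorem planeSet_app (hP : Rep M fun p : M.El one × M.El one => P p.1 p.2) (x y : M.El one) :
    (lam (fun x : M.El one => lam fun y : M.El one => if P x y then (1 : M.N) else 0) :
      M.El (arr one two)) x y = if P x y then 1 else 0 := by
  have h1 : Rep M fun x : M.El one => lam fun y : M.El one => if P x y then (1 : M.N) else 0 := by
    fun_prop
  have h2 : Rep M fun y : M.El one => P x y := hP.curry_left x
  have h3 : Rep M fun y : M.El one => if P x y then (1 : M.N) else 0 := by fun_prop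
  rw [Rep.lam_app h1, Rep.lam_app h3]

open Classical in
/-- The subset of the plane given by a decidable predicate that respects equality of reals. -/
noncomputable def planeSet : M.PlaneSet where
  val := lam fun x : M.El one => lam fun y : M.El one => if P x y then (1 : M.N) else 0
  zero_or_one x y := by
    rw [planeSet_app hP]
    split_ifs <;> simp
  ext x x' y y' hx hy := by
    rw [planeSet_app hP, planeSet_app hP]
    congr 1
    exact propext (hext x x' y y' (Reals.eq_iff.1 hx) (Reals.eq_iff.1 hy))

theorem mem_planeSet {x y : M.Reals} : (planeSet hP hext).Mem x y ↔ P x.1 y.1 := by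
  have h : (planeSet hP hext).val x.1 y.1 = _ := planeSet_app hP x.1 y.1
  unfold PlaneSet.Mem
  rw [h]
  split_ifs with h' <;> simp [h']

end PlaneSets

variable [HasE2 M]

/-- A continuous function that is below `1 / 2` at a point `x₀` and above `1 / 2` at a later
point takes the value `1 / 2`. -/
theorem exists_eq_half {g : M.RealFun} (hg : g.Continuous) {x₀ x₁ : M.Reals} (h0 : 0 ≤ x₀.val)
    (h01 : x₀.val < x₁.val) (h1 : x₁.val ≤ 1) (hg0 : (g.at x₀).val < epsR 1)
    (hg1 : epsR 1 < (g.at x₁).val) : ∃ z : M.Reals, z.InUnit ∧ (g.at z).val = epsR 1 := by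
  let d : M.N → M.N → M.Reals := fun a n => ofFrac (M.dyadic a n) (dyadic_den_pos a n)
  have hd : ∀ a n, (d a n).val = num a * epsR n := fun a n => by
    rw [val_ofFrac, dyadic_real]
  let Q : M.N → M.N → Prop := fun a n => LimLe (sq x₁.1) (sq (d a n).1) ∨
    LimLe (sq x₀.1) (sq (d a n).1) ∧ LimLt (fun _ => M.eps 1) (sq (g.val (d a n).1))
  have hQ : Rep M fun p : M.N × M.N => Q p.1 p.2 := by
    dsimp only [Q, d, ofFrac]
    fun_prop
  have hQ' : ∀ a n, Q a n ↔ x₁.val ≤ num a * epsR n ∨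
      x₀.val ≤ num a * epsR n ∧ epsR 1 < (g.at (d a n)).val := fun a n => by
    rw [← hd]
    exact or_congr (limLe_iff x₁.isCauchy (d a n).isCauchy)
      (and_congr (limLe_iff x₀.isCauchy (d a n).isCauchy)
        (limLt_iff (.eps 1) (g.at (d a n)).isCauchy))
  obtain ⟨z, hz0, hz1, hzl, hzg⟩ := exists_inf hQ ((hQ' _ _).2 (.inl (by
    rw [map_one, epsR_zero, one_mul]
    exact h1)))
  simp only [hQ'] at hzl hzg
  have hzu : z.InUnit := Reals.inUnit_iff.2 ⟨hz0, hz1⟩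
  refine ⟨z, hzu, ?_⟩
  have hcont := RealFun.contAt_iff.1 (hg z hzu)
  have hx₀z : x₀.val ≤ z.val := le_of_forall_le_add fun k => by
    obtain ⟨a, n, h, h'⟩ := hzg k
    rcases h with h | h
    · linarith
    · linarith [h.1]
  have hzx₁ : z.val ≤ x₁.val := le_of_forall_le_add fun k => by
    obtain ⟨a, h2, h3, -⟩ := exists_dyadic_le (h0.trans h01.le) h1 k
    have := hzl (a + 1) k (.inl (by rw [map_add, map_one]; linarith))
    rw [map_add, map_one] at this
    linarith
  rcases lt_trichotomy (g.at z).val (epsR 1) with h | h | h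
  · exfalso
    obtain ⟨k, hk⟩ := exists_epsR_lt (sub_pos.2 h)
    obtain ⟨m, hm⟩ := hcont k
    have hne : z.val < x₁.val := hzx₁.lt_of_ne fun e => by
      rw [g.val_congr e] at h
      exact h.not_gt hg1
    obtain ⟨l, hl⟩ := exists_epsR_lt (lt_min (sub_pos.2 hne) (epsR_pos m))
    obtain ⟨a, n, h2, h3⟩ := hzg l
    have h4 := hzl a n h2
    obtain ⟨h5, h6⟩ := lt_min_iff.1 hl
    rcases h2 with h2 | ⟨-, h2⟩
    · linarith
    · have h7 := hm (d a n) (Reals.inUnit_iff.2 ⟨by rw [hd]; linarith, by rw [hd]; linarith⟩) (by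
        rw [hd, abs_lt]
        constructor <;> linarith)
      rw [abs_lt] at h7
      linarith
  · exact h
  · exfalso
    obtain ⟨k, hk⟩ := exists_epsR_lt (sub_pos.2 h)
    obtain ⟨m, hm⟩ := hcont k
    have hne : x₀.val < z.val := hx₀z.lt_of_ne fun e => by
      rw [← g.val_congr e] at h
      exact h.not_gt hg0
    obtain ⟨l, hl⟩ := exists_epsR_lt (lt_min (sub_pos.2 hne) (epsR_pos m))
    obtain ⟨a, h2, h3⟩ := exists_dyadic_lt (h0.trans_lt hne) hz1 l
    obtain ⟨h5, h6⟩ := lt_min_iff.1 hl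
    have h7 := hm (d a l) (Reals.inUnit_iff.2 ⟨by rw [hd]; linarith, by rw [hd]; linarith⟩) (by
      rw [hd, abs_lt]
      constructor <;> linarith)
    rw [abs_lt] at h7
    have h8 := hzl a l (.inr ⟨by linarith, by linarith⟩)
    linarith

namespace HasDenseFibers

variable {f : M.RealFun} (hf : HasDenseFibers f) {A : M.El FinType.one}
  (hA : ∀ k a, (f.at (point A k a)).val = 1)
include hf hA

theorem not_stallings : ¬ f.Stallings := by
  intro h
  obtain ⟨h1, h2, h3⟩ := point_zeroDigits_bounds A
  set x₀ := point (zeroDigits M) 1 0 with hx₀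
  set x₁ := point A 1 1 with hx₁
  -- the plane without the line at height `1 / 2` and without the half-lines from that line through
  -- `(x₁, 0)` and `(x₀, 1)`, so that functions in this set change sides between `x₀` and `x₁`
  let P : M.El FinType.one → M.El FinType.one → Prop := fun x y =>
    (LimLt (sq y) (fun _ => M.eps 1) ∧ ¬ LimEq (sq x) (sq x₁.1)) ∨
      (LimLt (fun _ => M.eps 1) (sq y) ∧ ¬ LimEq (sq x) (sq x₀.1))
  have hP : Rep M fun p : M.El FinType.one × M.El FinType.one => P p.1 p.2 := by fun_prop
  have hP' : ∀ x y : M.Reals, P x.1 y.1 ↔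
      (y.val < epsR 1 ∧ x.val ≠ x₁.val) ∨ (epsR 1 < y.val ∧ x.val ≠ x₀.val) := fun x y =>
    or_congr (and_congr (limLt_iff y.isCauchy (.eps 1))
      (not_congr (limEq_iff x.isCauchy x₁.isCauchy)))
      (and_congr (limLt_iff (.eps 1) y.isCauchy) (not_congr (limEq_iff x.isCauchy x₀.isCauchy)))
  have hext : ∀ x x' y y' : M.Reals, x.val = x'.val → y.val = y'.val →
      (P x.1 y.1 ↔ P x'.1 y'.1) := fun x x' y y' hx hy => by
    rw [hP', hP', hx, hy]
  have hmem : ∀ x y : M.Reals, (planeSet hP hext).Mem x y ↔ _ := fun x y =>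
    (mem_planeSet hP hext).trans (hP' x y)
  have hhalf := epsR_one (M := M)
  have hpos := epsR_pos (1 : M.N)
  obtain ⟨g, hg, hgO⟩ := h (planeSet hP hext) (fun x y hxy => by
    simp only [hmem, Reals.near_iff] at hxy ⊢
    have hopen : ∀ {u v : M.Reals} {c : M.RealLine}, u.val ≠ c → v.val ≠ epsR 1 →
        ∃ k : M.N, epsR k < |u.val - c| ∧ epsR k < |v.val - epsR 1| := by
      intro u v c hu hv
      obtain ⟨k, hk⟩ := exists_epsR_lt
        (lt_min (abs_pos.2 (sub_ne_zero.2 hu)) (abs_pos.2 (sub_ne_zero.2 hv)))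
      exact ⟨k, lt_min_iff.1 hk⟩
    rcases hxy with ⟨hy, hx⟩ | ⟨hy, hx⟩
    · obtain ⟨k, hk1, hk2⟩ := hopen hx hy.ne
      rw [abs_of_neg (sub_neg.2 hy)] at hk2
      refine ⟨k, fun x' y' hx' hy' => .inl ⟨?_, fun e => ?_⟩⟩
      · rw [abs_lt] at hy'
        linarith
      · rw [e, abs_sub_comm] at hx'
        exact hx'.not_gt hk1
    · obtain ⟨k, hk1, hk2⟩ := hopen hx hy.ne'
      rw [abs_of_pos (sub_pos.2 hy)] at hk2
      refine ⟨k, fun x' y' hx' hy' => .inr ⟨?_, fun e => ?_⟩⟩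
      · rw [abs_lt] at hy'
        linarith
      · rw [e, abs_sub_comm] at hx'
        exact hx'.not_gt hk1) fun x _ => by
    rw [hmem]
    rcases hf.zero_or_one x with hx | hx
    · refine .inl ⟨by rw [hx]; exact hpos, fun e => ?_⟩
      rw [f.val_congr e, hA] at hx
      exact one_ne_zero hx
    · refine .inr ⟨by rw [hx]; linarith, fun e => ?_⟩
      rw [f.val_congr e, hf.zero] at hx
      exact zero_ne_one hx
  simp only [hmem] at hgO
  have hg0 : (g.at x₀).val < epsR 1 := by
    rcases hgO x₀ (Reals.inUnit_iff.2 ⟨h1, h2.le.trans h3⟩) with h | h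
    · exact h.1
    · exact absurd rfl h.2
  have hg1 : epsR 1 < (g.at x₁).val := by
    rcases hgO x₁ (Reals.inUnit_iff.2 ⟨h1.trans h2.le, h3⟩) with h | h
    · exact absurd rfl h.2
    · exact h.1
  obtain ⟨z, hz, hgz⟩ := exists_eq_half hg h1 h2 h3 hg0 hg1
  rcases hgO z hz with h | h
  · exact h.1.ne hgz
  · exact h.1.ne' hgz

/-- A function with two dense fibres has none of the properties to be decided. -/
theorem not_holds : ∀ P : DecidedProperty, ¬ P.Holds f
  | .stallings => hf.not_stallings hA
  | .continuous => hf.not_continuous hA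
  | .continuousAE => hf.not_continuousAE hA
  | .riemannIntegrable => hf.not_riemannIntegrable hA
  | .intermediateValue => hf.not_intermediateValue hA

end HasDenseFibers

/-! ### From a decision functional to `(∃³)` -/

theorem holds_indicatorFun_iff (Y : M.El two) (P : DecidedProperty) :
    P.Holds (indicatorFun Y) ↔ ¬ ∃ g, Y g = 0 := by
  constructor
  · rintro h ⟨g, hg⟩
    exact (hasDenseFibers_indicatorFun Y).not_holds (A := graphDigits g) (fun k a => by
      rw [val_indicatorFun, if_pos (codesZero_point hg k a)]) P h
  · refine fun h => DecidedProperty.holds_of_val_eq_zero (fun x => ?_) P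
    rw [val_indicatorFun, if_neg]
    rintro ⟨k, -, hk⟩
    exact h ⟨_, hk⟩

theorem RealFunctional.Decides.kleeneE3 {Ξ : M.RealFunctional} {P : DecidedProperty}
    {Γ : WeakContinuity} (h : Ξ.Decides P Γ) : M.KleeneE3 := by
  have hrep : Rep M fun Y : M.El two =>
      (chi (¬ LimEq (sq (Ξ.val (indicator Y))) fun _ => 0) : M.N) := by
    have := Rep.indicator (M := M)
    fun_prop
  refine ⟨lam fun Y => chi (¬ LimEq (sq (Ξ.val (indicator Y))) fun _ => 0), fun Y => ?_⟩
  rw [Rep.lam_app hrep, Rep.chi_eq_zero]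
  have h1 := h (indicatorFun Y) ((hasDenseFibers_indicatorFun Y).holds Γ)
  rw [holds_indicatorFun_iff] at h1
  exact (not_congr h1).trans not_not

end TypeStructure

/-! ### Quantifiers over reals and sequences of reals -/

namespace TypeStructure

open FinType OrderedCompletion

variable {M : TypeStructure.{u}} [hM : IsModel M] {X : Type*} [Asm M X]

/-- Reals are represented by themselves, as elements of type `1`. -/
instance : Asm M M.Reals := ⟨one, fun a x => a = x.1, fun x => ⟨x.1, rfl⟩⟩

/-- Real functions are represented by the underlying elements of type `1 → 1`. -/
instance : Asm M M.RealFun := ⟨arr one one, fun F f => F = f.val, fun f => ⟨f.val, rfl⟩⟩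

/-- Sequences of reals are represented by the underlying elements of type `0 → 1`. -/
instance : Asm M M.RealSeq := ⟨arr nat one, fun S s => S = s.val, fun s => ⟨s.val, rfl⟩⟩

namespace Rep

omit hM in
theorem real_iff {f : X → M.Reals} : Rep M f ↔ Rep M (fun x => (f x).1) := Iff.rfl

omit hM in
theorem realFun_iff {f : X → M.RealFun} : Rep M f ↔ Rep M (fun x => (f x).val) := Iff.rfl

omit hM in
theorem realSeq_iff {f : X → M.RealSeq} : Rep M f ↔ Rep M (fun x => (f x).val) := Iff.rfl

@[fun_prop]
theorem realFun_at {f : X → M.RealFun} {g : X → M.Reals} (hf : Rep M f) (hg : Rep M g) :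
    Rep M (fun x => (f x).at (g x)) := by
  rw [realFun_iff] at hf
  rw [real_iff] at hg ⊢
  exact hf.app hg

@[fun_prop]
theorem realSeq_at {f : X → M.RealSeq} {g : X → M.N} (hf : Rep M f) (hg : Rep M g) :
    Rep M (fun x => (f x).at (g x)) := by
  rw [realSeq_iff] at hf
  rw [real_iff]
  exact hf.app hg

variable [HasE2 M]

@[fun_prop]
theorem seq {f : X → M.Reals} {g : X → M.N} (hf : Rep M f) (hg : Rep M g) :
    Rep M (fun x => (f x).seq (g x)) := (real_iff.1 hf).sq hg

@[fun_prop]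
theorem real_eq {f g : X → M.Reals} (hf : Rep M f) (hg : Rep M g) :
    Rep M (fun x => (f x).Eq (g x)) := by
  unfold Reals.Eq
  fun_prop

@[fun_prop]
theorem real_le {f g : X → M.Reals} (hf : Rep M f) (hg : Rep M g) :
    Rep M (fun x => (f x).Le (g x)) := by
  unfold Reals.Le
  fun_prop

@[fun_prop]
theorem real_lt {f g : X → M.Reals} (hf : Rep M f) (hg : Rep M g) :
    Rep M (fun x => (f x).Lt (g x)) := by
  unfold Reals.Lt
  fun_prop

@[fun_prop]
theorem near {k : X → M.N} {f g : X → M.Reals} (hk : Rep M k) (hf : Rep M f) (hg : Rep M g) :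
    Rep M (fun x => (f x).Near (k x) (g x)) := by
  unfold Reals.Near
  fun_prop

@[fun_prop]
theorem inUnit {f : X → M.Reals} (hf : Rep M f) : Rep M (fun x => (f x).InUnit) := by
  unfold Reals.InUnit
  fun_prop

variable [HasE3 M]

omit [HasE2 M] [HasE3 M] in
theorem mkPair {σ τ : FinType} {f : X → M.El σ} {g : X → M.El τ} (hf : Rep M f) (hg : Rep M g) :
    Rep M (fun x => TypeStructure.mkPair (f x) (g x)) := by
  unfold TypeStructure.mkPair
  fun_prop

omit [HasE2 M] in
/-- The quantifier over a represented type is decidable if its elements are represented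
by elements of type `1` from a decidable set. -/
theorem exists_of_codes {Y : Type*} [Asm M Y] {code : M.El one → M.El (Asm.ty M Y)}
    (hcode : Rep M code) {D : M.El one → Prop} (hD : Rep M D)
    (h1 : ∀ a, D a → ∃ y : Y, Asm.rel (code a) y) (h2 : ∀ y : Y, ∃ a, D a ∧ Asm.rel (code a) y)
    {p : X → Y → Prop} (hp : Rep M fun q : X × Y => p q.1 q.2) : Rep M fun x => ∃ y, p x y := by
  obtain ⟨G, hG⟩ := hp.exists_char
  let P : M.El (Asm.ty M X) → Prop := fun c => ∃ a, D a ∧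
    M.app (σ := pairTy (Asm.ty M X) (Asm.ty M Y)) (τ := nat) G
      (TypeStructure.mkPair c (code a)) = 0
  have hP : Rep M P := by
    refine exists_one (p := fun c a => D a ∧
      M.app (σ := pairTy (Asm.ty M X) (Asm.ty M Y)) (τ := nat) G
      (TypeStructure.mkPair c (code a)) = 0) (and (by fun_prop) (eq (app (const _)
        (mkPair (by fun_prop) (by fun_prop))) (const _)))
  obtain ⟨H, hH⟩ := hP.exists_char
  refine ⟨H, fun c x hcx => (hH c c rfl).trans ?_⟩
  have key : ∀ a y, Asm.rel (code a) y → ((M.app (σ := pairTy (Asm.ty M X) (Asm.ty M Y))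
      (τ := nat) G (TypeStructure.mkPair c (code a)) = 0) ↔ p x y) := fun a y h =>
    hG _ (x, y) ⟨c, code a, hcx, h, rfl⟩
  constructor
  · rintro ⟨a, ha, h⟩
    obtain ⟨y, hy⟩ := h1 a ha
    exact ⟨y, (key a y hy).1 h⟩
  · rintro ⟨y, h⟩
    obtain ⟨a, ha, hy⟩ := h2 y
    exact ⟨a, ha, (key a y hy).2 h⟩

theorem exists_real {p : X → M.Reals → Prop} (hp : Rep M fun q : X × M.Reals => p q.1 q.2) :
    Rep M fun x => ∃ r, p x r :=
  exists_of_codes (code := fun a => a) (D := M.IsReal) (by fun_prop) (by fun_prop)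
    (fun a ha => ⟨⟨a, ha⟩, rfl⟩) (fun y => ⟨y.1, y.2, rfl⟩) hp

theorem forall_real {p : X → M.Reals → Prop} (hp : Rep M fun q : X × M.Reals => p q.1 q.2) :
    Rep M fun x => ∀ r, p x r :=
  (exists_real (p := fun x r => ¬ p x r) hp.not).not.congr_prop fun x => by push Not; rfl

theorem exists_realSeq {p : X → M.RealSeq → Prop}
    (hp : Rep M fun q : X × M.RealSeq => p q.1 q.2) : Rep M fun x => ∃ s, p x s := by
  have h1 : Rep M fun q : M.El one × M.N => TypeStructure.lam fun m => q.1 (M.pair q.2 m) :=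
    lam (f := fun (q : M.El one × M.N) m => q.1 (M.pair q.2 m)) (by fun_prop)
  let S : M.El one → M.El (arr nat one) := fun a =>
    TypeStructure.lam fun n => TypeStructure.lam fun m => a (M.pair n m)
  have hS : Rep M S := lam (f := fun (a : M.El one) n =>
    TypeStructure.lam fun m => a (M.pair n m)) h1
  refine exists_of_codes (code := S) (D := fun a => ∀ n, M.IsReal (S a n)) hS
    (forall_num (by fun_prop)) (fun a ha => ⟨⟨S a, ha⟩, rfl⟩) (fun s => ?_) hp
  let a : M.El one := TypeStructure.lam fun c =>
    s.val (TypeStructure.unpairFst c) (TypeStructure.unpairSnd c)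
  have h2 : Rep M fun c => s.val (TypeStructure.unpairFst c) (TypeStructure.unpairSnd c) := by
    fun_prop
  have e : S a = s.val := by
    refine El.ext fun n => El.ext fun m => ?_
    have h3 : ∀ a : M.El one, Rep M fun n => TypeStructure.lam fun m => a (M.pair n m) :=
      fun a => h1.comp_curried (v := fun (a : M.El one) n =>
        TypeStructure.lam fun m => a (M.pair n m)) (by fun_prop) (by fun_prop)
    have h4 : ∀ (a : M.El one) n, Rep M fun m => a (M.pair n m) := fun a n => by fun_prop
    dsimp only [S, a]
    rw [lam_app (h3 _), lam_app (h4 _ _), lam_app h2, unpairFst_pair, unpairSnd_pair]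
  exact ⟨a, fun n => by rw [e]; exact s.isReal n, e⟩

end Rep

/-! ### Deciding continuity, integrability and the intermediate value property -/

variable [HasE2 M] [HasE3 M]

@[fun_prop]
theorem Rep.contAt {f : X → M.RealFun} {g : X → M.Reals} (hf : Rep M f) (hg : Rep M g) :
    Rep M fun x => (f x).ContAt (g x) := by
  unfold RealFun.ContAt
  exact forall_num (exists_num (forall_real (imp (by fun_prop) (imp (by fun_prop) (by fun_prop)))))

theorem rep_continuous : Rep M fun f : M.RealFun => f.Continuous := by
  unfold RealFun.Continuous
  exact Rep.forall_real (.imp (by fun_prop) (by fun_prop))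

theorem rep_intermediateValue : Rep M fun f : M.RealFun => f.IntermediateValue := by
  unfold RealFun.IntermediateValue
  exact .forall_real (.forall_real (.forall_real (.imp (by fun_prop) (.imp (by fun_prop)
    (.imp (by fun_prop) (.imp (by fun_prop) (.exists_real (by fun_prop))))))))

theorem rep_continuousAE : Rep M fun f : M.RealFun => f.ContinuousAE := by
  unfold RealFun.ContinuousAE
  refine .forall_num (.exists_realSeq (.exists_realSeq (.exists_realSeq (.and (.forall_num ?_)
    (.and ?_ (.and (.forall_num ?_) (.and (.forall_num ?_)
      (.forall_real (.imp ?_ (.imp ?_ ?_))))))))))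
  all_goals fun_prop

@[fun_prop]
theorem Rep.isRiemannSum {f : X → M.RealFun} {m : X → M.N} {r : X → M.Reals} (hf : Rep M f)
    (hm : Rep M m) (hr : Rep M r) : Rep M fun x => (f x).IsRiemannSum (m x) (r x) := by
  unfold RealFun.IsRiemannSum
  refine .exists_num (.exists_realSeq (.exists_realSeq (.exists_realSeq (.and ?_ (.and ?_
    (.and (.forall_num (.imp ?_ ?_)) (.and ?_ (.and (.forall_num (.imp ?_ ?_)) ?_))))))))
  all_goals fun_prop

theorem rep_riemannIntegrable : Rep M fun f : M.RealFun => f.RiemannIntegrable := by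
  unfold RealFun.RiemannIntegrable
  refine .forall_num (.exists_num (.forall_real (.forall_real (.imp ?_ (.imp ?_ ?_)))))
  all_goals fun_prop

end TypeStructure

/-! ### Definite descriptions of reals -/

namespace TypeStructure

open FinType OrderedCompletion

variable {M : TypeStructure.{u}} [hM : IsModel M] {X : Type*} [Asm M X] [HasE2 M] [HasE3 M]

/-- The real with the property `L`, if there is exactly one (up to equality of reals): the `n`-th
approximation is the rational with the least code that is close to a real with the property. -/
noncomputable def theReal (L : M.Reals → Prop) : M.El one :=
  codeSeq fun n => M.decode (least fun c => ∃ y : M.Reals, L y ∧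
    LimLe (fun i => (M.decode c - y.seq i).abs) (fun _ => M.eps (n + 1)))

section TheReal

theorem rep_close {L : X → M.Reals → Prop} (hL : Rep M fun p : X × M.Reals => L p.1 p.2) :
    Rep M fun q : (X × M.N) × M.N => ∃ y : M.Reals, L q.1.1 y ∧
      LimLe (fun i => (M.decode q.2 - y.seq i).abs) (fun _ => M.eps (q.1.2 + 1)) := by
  have h : Rep M fun p : ((X × M.N) × M.N) × M.Reals => L p.1.1.1 p.2 :=
    hL.comp_curried (by fun_prop) (by fun_prop)
  exact Rep.exists_real (Rep.and h (by fun_prop))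

theorem Rep.theReal {L : X → M.Reals → Prop} (hL : Rep M fun p : X × M.Reals => L p.1 p.2) :
    Rep M fun x => TypeStructure.theReal (L x) := by
  have h := Rep.least (X := X × M.N) (p := fun q c => ∃ y : M.Reals, L q.1 y ∧
    LimLe (fun i => (M.decode c - y.seq i).abs) (fun _ => M.eps (q.2 + 1))) (rep_close hL)
  unfold TypeStructure.theReal
  exact Rep.codeSeq h.decode

theorem theReal_spec {L : M.Reals → Prop} (hL : Rep M L) {y : M.Reals} (hy : L y)
    (huniq : ∀ z, L z → z.val = y.val) :
    ∃ h : M.IsReal (theReal L), Reals.val ⟨theReal L, h⟩ = y.val := by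
  have hL' : Rep M fun p : M.N × M.Reals => L p.2 := hL.comp (f := fun p : M.N × M.Reals => p.2)
    (by fun_prop)
  have hclose := rep_close (L := fun _ : M.N => L) hL'
  have hrep : Rep M fun n : M.N => M.decode (least fun c => ∃ y : M.Reals, L y ∧
      LimLe (fun i => (M.decode c - y.seq i).abs) (fun _ => M.eps (n + 1))) :=
    (Rep.least (X := M.N) (p := fun n c => ∃ y : M.Reals, L y ∧
      LimLe (fun i => (M.decode c - y.seq i).abs) (fun _ => M.eps (n + 1)))
      (hclose.comp (f := fun q : M.N × M.N => ((0, q.1), q.2)) (by fun_prop))).decode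
  have hlim : ∀ (c n : M.N) (z : M.Reals), LimLe (fun i => (M.decode c - z.seq i).abs)
      (fun _ => M.eps (n + 1)) ↔ |(M.decode c).real - z.val| ≤ epsR (n + 1) := fun c n z => by
    have h1 : IsCauchy fun _ : M.N => M.decode c := .const (decode_den_pos c)
    have h2 := h1.sub z.isCauchy
    rw [limLe_iff h2.abs (.eps _), limit_abs h2, limit_sub h1 z.isCauchy]
    rfl
  have happ : ∀ n, |(M.decode (least fun c => ∃ y : M.Reals, L y ∧
      LimLe (fun i => (M.decode c - y.seq i).abs) (fun _ => M.eps (n + 1)))).real - y.val| ≤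
      epsR (n + 1) := fun n => by
    obtain ⟨z, hz, h⟩ := least_spec (p := fun c => ∃ y : M.Reals, L y ∧
      LimLe (fun i => (M.decode c - y.seq i).abs) (fun _ => M.eps (n + 1)))
      (hclose.comp (f := fun c : M.N => (((0 : M.N), n), c)) (by fun_prop))
      ⟨y.1 (n + 1), y, hy, (hlim _ _ _).2 (by
        rw [abs_sub_comm]
        exact y.abs_val_sub_seq_le (n + 1))⟩
    rw [hlim, huniq z hz] at h
    exact h
  have hreal := isReal_codeSeq_of_approx hrep (fun n => decode_den_pos _) happ
  exact ⟨hreal, val_codeSeq hrep (fun n => decode_den_pos _) happ hreal⟩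

end TheReal

/-! ### Deciding Stallings' property: codes for open sets and for continuous functions -/

/-- `y` is the limit at `x` of the values coded by `b`: here `b (pair c n)` codes the `n`-th
approximation to the value at the rational number in `[0, 1]` with code `c`. -/
def IsLimitAt (b : M.El one) (x y : M.Reals) : Prop :=
  ∀ k : M.N, ∃ m : M.N, ∀ c n : M.N, m ≤ n → LimLe (fun _ => 0) (fun _ : M.N => M.decode c) →
    LimLe (fun _ : M.N => M.decode c) (fun _ => 1) →
    LimLt (fun i => (M.decode c - x.seq i).abs) (fun _ => M.eps m) →
    LimLe (fun i => (M.decode (b (M.pair c n)) - y.seq i).abs) (fun _ => M.eps k)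

/-- `(x, y)` is in the open set coded by `a`, which is the union of the squares with rational
centre `(decode c, decode d)` and radius `1 / 2 ^ k` for which `a (pair (pair c d) k) = 0`. -/
def InCodedSet (a : M.El one) (x y : M.Reals) : Prop :=
  ∃ c d k : M.N, a (M.pair (M.pair c d) k) = 0 ∧
    LimLt (fun i => (M.decode c - x.seq i).abs) (fun _ => M.eps k) ∧
    LimLt (fun i => (M.decode d - y.seq i).abs) (fun _ => M.eps k)

omit [HasE3 M] in
@[fun_prop]
theorem Rep.isLimitAt {b : X → M.El one} {x y : X → M.Reals} (hb : Rep M b) (hx : Rep M x)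
    (hy : Rep M y) : Rep M fun z => IsLimitAt (b z) (x z) (y z) := by
  unfold IsLimitAt
  refine forall_num (exists_num (forall_num (forall_num (imp ?_ (imp ?_ (imp ?_ (imp ?_ ?_)))))))
  all_goals fun_prop

omit [HasE3 M] in
@[fun_prop]
theorem Rep.inCodedSet {a : X → M.El one} {x y : X → M.Reals} (ha : Rep M a) (hx : Rep M x)
    (hy : Rep M y) : Rep M fun z => InCodedSet (a z) (x z) (y z) := by
  unfold InCodedSet
  fun_prop

omit [HasE2 M] [HasE3 M] in
theorem limLt_abs_sub_iff {q : Frac M} (hq : 0 < q.den) {x : M.Reals} {k : M.N} :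
    LimLt (fun i => (q - x.seq i).abs) (fun _ => M.eps k) ↔ |q.real - x.val| < epsR k := by
  have h := (IsCauchy.const hq).sub x.isCauchy
  rw [limLt_iff h.abs (.eps k), limit_abs h, limit_sub (.const hq) x.isCauchy]
  rfl

omit [HasE2 M] [HasE3 M] in
theorem limLe_abs_sub_iff {q : Frac M} (hq : 0 < q.den) {x : M.Reals} {k : M.N} :
    LimLe (fun i => (q - x.seq i).abs) (fun _ => M.eps k) ↔ |q.real - x.val| ≤ epsR k := by
  have h := (IsCauchy.const hq).sub x.isCauchy
  rw [limLe_iff h.abs (.eps k), limit_abs h, limit_sub (.const hq) x.isCauchy]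
  rfl

omit [HasE2 M] [HasE3 M] in
theorem isLimitAt_iff {b : M.El one} {x y : M.Reals} : IsLimitAt b x y ↔ ∀ k : M.N, ∃ m : M.N,
    ∀ c n : M.N, m ≤ n → 0 ≤ (M.decode c).real → (M.decode c).real ≤ 1 →
      |(M.decode c).real - x.val| < epsR m →
      |(M.decode (b (M.pair c n))).real - y.val| ≤ epsR k := by
  have h0 : ∀ c, LimLe (fun _ => 0) (fun _ : M.N => M.decode c) ↔
      0 ≤ (M.decode c).real := fun c => by
    rw [limLe_iff .zero (.const (decode_den_pos c)), limit_zero]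
    rfl
  have h1 : ∀ c, LimLe (fun _ : M.N => M.decode c) (fun _ => 1) ↔
      (M.decode c).real ≤ 1 := fun c => by
    rw [limLe_iff (.const (decode_den_pos c)) .one, limit_one]
    rfl
  unfold IsLimitAt
  simp only [h0, h1, limLt_abs_sub_iff (decode_den_pos _), limLe_abs_sub_iff (decode_den_pos _)]

omit [HasE2 M] [HasE3 M] in
theorem inCodedSet_iff {a : M.El one} {x y : M.Reals} : InCodedSet a x y ↔ ∃ c d k : M.N,
    a (M.pair (M.pair c d) k) = 0 ∧ |(M.decode c).real - x.val| < epsR k ∧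
      |(M.decode d).real - y.val| < epsR k := by
  unfold InCodedSet
  simp only [limLt_abs_sub_iff (decode_den_pos _)]

omit [HasE3 M] in
/-- Rational numbers in `[0, 1]` are dense in `[0, 1]`. -/
theorem exists_decode_near {x : M.Reals} (hx : x.InUnit) (k : M.N) : ∃ c,
    0 ≤ (M.decode c).real ∧ (M.decode c).real ≤ 1 ∧ |(M.decode c).real - x.val| ≤ epsR k := by
  obtain ⟨h0, h1⟩ := Reals.inUnit_iff.1 hx
  obtain ⟨a, h2, h3, h4⟩ := exists_dyadic_le h0 h1 k
  refine ⟨(M.dyadic a k).code, ?_⟩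
  rw [decode_code (dyadic_den_pos _ _), dyadic_real, abs_le]
  have := mul_nonneg (num_nonneg a) (epsR_pos k).le
  have := epsR_pos k
  exact ⟨by linarith, by linarith, by linarith, by linarith⟩

omit [HasE3 M] in
/-- The limits coded by `b` at nearby points are close to each other. -/
theorem IsLimitAt.continuous {b : M.El one} {x y : M.Reals} (h : IsLimitAt b x y) (k : M.N) :
    ∃ m : M.N, ∀ x' y' : M.Reals, x'.InUnit → |x'.val - x.val| < epsR m → IsLimitAt b x' y' →
      |y'.val - y.val| ≤ epsR k := by
  obtain ⟨m, hm⟩ := isLimitAt_iff.1 h k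
  refine ⟨m + 1, fun x' y' hx' hxx' h' => le_of_forall_le_add fun l => ?_⟩
  obtain ⟨m', hm'⟩ := isLimitAt_iff.1 h' l
  have h1 := epsR_succ m
  have h2 := epsR_pos (m + 1)
  obtain ⟨c, hc0, hc1, hc⟩ := exists_decode_near hx' (m + 1 + (m' + 1))
  have h3 := epsR_anti (le_add_of_nonneg_right (zero_le_num (m' + 1)) : m + 1 ≤ m + 1 + (m' + 1))
  have h4 := epsR_anti (le_add_of_nonneg_left (zero_le_num (m + 1)) : m' + 1 ≤ m + 1 + (m' + 1))
  have h5 := epsR_lt (lt_add_of_pos_right m' one_pos)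
  have h6 := hm c (m + m') (le_add_of_nonneg_right (zero_le_num _)) hc0 hc1 (by
    have := abs_sub_le (M.decode c).real x'.val x.val
    linarith)
  have h7 := hm' c (m + m') (le_add_of_nonneg_left (zero_le_num _)) hc0 hc1 (by linarith)
  have h8 := abs_sub_le y'.val (M.decode (b (M.pair c (m + m')))).real y.val
  rw [abs_sub_comm] at h7
  linarith

omit [HasE3 M] in
theorem IsLimitAt.unique {b : M.El one} {x x' y y' : M.Reals} (h : IsLimitAt b x y)
    (h' : IsLimitAt b x' y') (hx : x'.InUnit) (hxx' : x'.val = x.val) : y'.val = y.val :=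
  eq_of_forall_abs_le fun k => by
    obtain ⟨m, hm⟩ := h.continuous k
    exact hm x' y' hx (by rw [hxx', sub_self, abs_zero]; exact epsR_pos m) h'

omit [HasE2 M] [HasE3 M] in
theorem Reals.InUnit.congr {x x' : M.Reals} (hx : x.val = x'.val) : x.InUnit ↔ x'.InUnit := by
  rw [inUnit_iff, inUnit_iff, hx]

/-- If the values coded by `b` have limits everywhere on `[0, 1]`, then these limits are the
values of a continuous function. -/
theorem exists_continuous_of_isLimitAt {b : M.El one}
    (hb : ∀ x : M.Reals, x.InUnit → ∃ y, IsLimitAt b x y) :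
    ∃ g : M.RealFun, g.Continuous ∧ ∀ x : M.Reals, x.InUnit → IsLimitAt b x (g.at x) := by
  let L : M.Reals → M.Reals → Prop := fun x y =>
    (x.InUnit ∧ IsLimitAt b x y) ∨ (¬ x.InUnit ∧ LimEq y.seq fun _ => 0)
  have hL0 : Rep M fun p : M.Reals × M.Reals => L p.1 p.2 := by fun_prop
  have hzero : ∀ y : M.Reals, LimEq y.seq (fun _ => 0) ↔ y.val = 0 := fun y => by
    rw [limEq_iff y.isCauchy .zero, limit_zero]
    rfl
  have hex : ∀ x, ∃ y, L x y := fun x => by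
    by_cases hx : x.InUnit
    · obtain ⟨y, hy⟩ := hb x hx
      exact ⟨y, .inl ⟨hx, hy⟩⟩
    · refine ⟨ofFrac 0 one_pos, .inr ⟨hx, (hzero _).2 ?_⟩⟩
      rw [val_ofFrac, Frac.real_zero]
  have huniq : ∀ x x' y y', x.val = x'.val → L x y → L x' y' → y'.val = y.val := by
    rintro x x' y y' hxx' (⟨hx, h⟩ | ⟨hx, h⟩) (⟨hx', h'⟩ | ⟨hx', h'⟩)
    · exact h.unique h' hx' hxx'.symm
    · exact absurd ((Reals.InUnit.congr hxx').1 hx) hx'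
    · exact absurd ((Reals.InUnit.congr hxx').2 hx') hx
    · rw [(hzero y).1 h, (hzero y').1 h']
  -- the description of the value at `a`, for an arbitrary element `a` of type `1`
  let L' : M.El one → M.Reals → Prop := fun a y => ∃ x : M.Reals, (∀ n, a n = x.1 n) ∧ L x y
  have hL : Rep M fun p : M.El one × M.Reals => L' p.1 p.2 := by
    have h1 : Rep M fun q : ((M.El one × M.Reals) × M.Reals) × M.N => q.1.2.1 q.2 :=
      (Rep.real_iff.1 (by fun_prop)).app (by fun_prop)
    exact Rep.exists_real (Rep.and (Rep.forall_num (by fun_prop))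
      (hL0.comp_curried (by fun_prop) (by fun_prop)))
  have hL' : ∀ (x y : M.Reals), L' x.1 y ↔ L x y := fun x y => by
    refine ⟨?_, fun h => ⟨x, fun _ => rfl, h⟩⟩
    rintro ⟨x', hx', h⟩
    rwa [show x = x' from Subtype.ext (El.ext hx')]
  have hval : Rep M fun a => theReal (L' a) := Rep.theReal hL
  have hspec : ∀ x y, L x y → ∃ h : M.IsReal (lam (fun a => theReal (L' a)) x.1),
      Reals.val ⟨_, h⟩ = y.val := fun x y h => by
    rw [Rep.lam_app hval]
    exact theReal_spec (hL.curry_left (f := L') x.1) ((hL' x y).2 h) fun z hz =>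
      huniq x x y z rfl h ((hL' x z).1 hz)
  have hreal : ∀ x : M.Reals, M.IsReal (lam (fun a => theReal (L' a)) x.1) := fun x => by
    obtain ⟨y, hy⟩ := hex x
    exact (hspec x y hy).1
  have hvalue : ∀ x y, L x y → Reals.val ⟨_, hreal x⟩ = y.val := fun x y h => (hspec x y h).2
  let g : M.RealFun :=
    { val := lam fun a => theReal (L' a)
      isReal := hreal
      ext := fun x x' hxx' => by
        obtain ⟨y, hy⟩ := hex x
        obtain ⟨y', hy'⟩ := hex x'
        exact Reals.eq_iff.2 ((hvalue x y hy).trans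
          ((huniq x x' y y' (Reals.eq_iff.1 hxx') hy hy').symm.trans (hvalue x' y' hy').symm)) }
  have hg : ∀ x : M.Reals, x.InUnit → IsLimitAt b x (g.at x) := fun x hx => by
    obtain ⟨y, hy⟩ := hb x hx
    have e : (g.at x).val = y.val := hvalue x y (.inl ⟨hx, hy⟩)
    rw [isLimitAt_iff] at hy ⊢
    rwa [e]
  refine ⟨g, fun x hx => RealFun.contAt_iff.2 fun k => ?_, hg⟩
  obtain ⟨m, hm⟩ := (hg x hx).continuous (k + 1)
  exact ⟨m, fun y hy hyx => (hm y _ hy hyx (hg y hy)).trans_lt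
    (epsR_lt (lt_add_of_pos_right k one_pos))⟩

omit [HasE3 M] in
/-- The values of a continuous function at the rational numbers code the function. -/
theorem RealFun.Continuous.exists_isLimitAt {g : M.RealFun} (hg : g.Continuous) :
    ∃ b : M.El one, ∀ x : M.Reals, x.InUnit → IsLimitAt b x (g.at x) := by
  have hrep : Rep M fun e => g.val (codeSeq fun _ => M.decode (unpairFst e)) (unpairSnd e) := by
    fun_prop
  refine ⟨lam fun e => g.val (codeSeq fun _ => M.decode (unpairFst e)) (unpairSnd e),
    fun x hx => isLimitAt_iff.2 fun k => ?_⟩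
  obtain ⟨m, hm⟩ := RealFun.contAt_iff.1 (hg x hx) (k + 1)
  refine ⟨m + (k + 1), fun c n hn hc0 hc1 hc => ?_⟩
  rw [Rep.lam_app hrep, unpairFst_pair, unpairSnd_pair]
  let q : M.Reals := ofFrac (M.decode c) (decode_den_pos c)
  have hq : q.val = (M.decode c).real := val_ofFrac _ _
  have h1 := (g.at q).abs_val_sub_seq_le n
  have h2 := hm q (Reals.inUnit_iff.2 (by rw [hq]; exact ⟨hc0, hc1⟩)) (by
    rw [hq]
    exact hc.trans_le (epsR_anti (le_add_of_nonneg_right (zero_le_num _))))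
  have h3 := epsR_anti ((le_add_of_nonneg_left (zero_le_num m)).trans hn)
  have h4 := epsR_succ k
  have h5 := abs_sub_le ((g.at q).seq n).real (g.at q).val (g.at x).val
  rw [abs_sub_comm] at h1
  change |((g.at q).seq n).real - (g.at x).val| ≤ epsR k
  linarith

/-- Every open set is coded by the set of all rational squares that it contains. -/
theorem PlaneSet.IsOpen.exists_inCodedSet {O : M.PlaneSet} (hO : O.IsOpen) :
    ∃ a : M.El one, ∀ x y, O.Mem x y ↔ InCodedSet a x y := by
  let S : M.N → Prop := fun e => ∀ x y : M.Reals,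
    LimLt (fun i => (M.decode (unpairFst (unpairFst e)) - x.seq i).abs)
      (fun _ => M.eps (unpairSnd e)) →
    LimLt (fun i => (M.decode (unpairSnd (unpairFst e)) - y.seq i).abs)
      (fun _ => M.eps (unpairSnd e)) → O.val x.1 y.1 = 1
  have hS : Rep M S := by
    refine Rep.forall_real (Rep.forall_real (.imp ?_ (.imp ?_ ?_)))
    · fun_prop
    · fun_prop
    · have h1 : Rep M fun q : (M.N × M.Reals) × M.Reals => q.1.2.1 := Rep.real_iff.1 (by fun_prop)
      have h2 : Rep M fun q : (M.N × M.Reals) × M.Reals => q.2.1 := Rep.real_iff.1 (by fun_prop)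
      exact Rep.eq (((Rep.const O.val).app h1).app h2) (Rep.const _)
  refine ⟨lam fun e => chi (S e), fun x y => ?_⟩
  rw [inCodedSet_iff]
  simp only [Rep.lam_app hS.chi, Rep.chi_eq_zero]
  simp only [S, unpairFst_pair, unpairSnd_pair,
    limLt_abs_sub_iff (decode_den_pos _)]
  constructor
  · intro h
    obtain ⟨k, hk⟩ := hO x y h
    have h1 := epsR_succ k
    have h2 := epsR_lt (lt_add_of_pos_right (k + 1) one_pos)
    have hx := x.abs_val_sub_seq_le (k + 1 + 1)
    have hy := y.abs_val_sub_seq_le (k + 1 + 1)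
    rw [abs_sub_comm] at hx hy
    refine ⟨x.1 (k + 1 + 1), y.1 (k + 1 + 1), k + 1, fun x' y' hx' hy' => ?_, hx.trans_lt h2,
      hy.trans_lt h2⟩
    rw [abs_sub_comm] at hx' hy'
    refine hk x' y' (Reals.near_iff.2 ?_) (Reals.near_iff.2 ?_)
    · have := abs_sub_le x'.val (x.seq (k + 1 + 1)).real x.val
      change |x'.val - (x.seq (k + 1 + 1)).real| < _ at hx'
      linarith
    · have := abs_sub_le y'.val (y.seq (k + 1 + 1)).real y.val
      change |y'.val - (y.seq (k + 1 + 1)).real| < _ at hy'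
      linarith
  · rintro ⟨c, d, k, h, hx, hy⟩
    exact h x y hx hy

omit [HasE3 M] in
theorem exists_isOpen_of_code (a : M.El one) :
    ∃ O : M.PlaneSet, O.IsOpen ∧ ∀ x y, O.Mem x y ↔ InCodedSet a x y := by
  let P : M.El one → M.El one → Prop := fun u v => ∃ c d k : M.N,
    a (M.pair (M.pair c d) k) = 0 ∧ LimLt (fun i => (M.decode c - sq u i).abs) (fun _ => M.eps k) ∧
      LimLt (fun i => (M.decode d - sq v i).abs) (fun _ => M.eps k)
  have hP : Rep M fun p : M.El one × M.El one => P p.1 p.2 := by fun_prop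
  have hPx : ∀ x y : M.Reals, P x.1 y.1 ↔ InCodedSet a x y := fun x y => Iff.rfl
  refine ⟨planeSet hP fun x x' y y' hx hy => by
    rw [hPx, hPx, inCodedSet_iff, inCodedSet_iff, hx, hy], fun x y hxy => ?_, fun x y =>
    (mem_planeSet hP _).trans (hPx x y)⟩
  simp only [mem_planeSet, hPx, inCodedSet_iff, Reals.near_iff] at hxy ⊢
  obtain ⟨c, d, k, h, hx, hy⟩ := hxy
  obtain ⟨l, hl⟩ := exists_epsR_lt (lt_min (sub_pos.2 hx) (sub_pos.2 hy))
  obtain ⟨h1, h2⟩ := lt_min_iff.1 hl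
  refine ⟨l, fun x' y' hx' hy' => ⟨c, d, k, h, ?_, ?_⟩⟩
  · have := abs_sub_le (M.decode c).real x.val x'.val
    rw [abs_sub_comm] at hx'
    linarith
  · have := abs_sub_le (M.decode d).real y.val y'.val
    rw [abs_sub_comm] at hy'
    linarith

/-- Stallings' property in terms of codes, without quantifiers over higher types. -/
theorem RealFun.stallings_iff {f : M.RealFun} : f.Stallings ↔ ∀ a : M.El one,
    (∀ x : M.Reals, x.InUnit → InCodedSet a x (f.at x)) →
      ∃ b : M.El one, (∀ x : M.Reals, x.InUnit → ∃ y, IsLimitAt b x y) ∧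
        ∀ x : M.Reals, x.InUnit → ∀ y, IsLimitAt b x y → InCodedSet a x y := by
  constructor
  · intro h a ha
    obtain ⟨O, hO, hOa⟩ := exists_isOpen_of_code a
    obtain ⟨g, hg, hgO⟩ := h O hO fun x hx => (hOa _ _).2 (ha x hx)
    obtain ⟨b, hb⟩ := hg.exists_isLimitAt
    refine ⟨b, fun x hx => ⟨_, hb x hx⟩, fun x hx y hy => ?_⟩
    rw [← hOa, O.mem_congr rfl ((hb x hx).unique hy hx rfl)]
    exact hgO x hx
  · intro h O hO hfO
    obtain ⟨a, ha⟩ := hO.exists_inCodedSet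
    obtain ⟨b, hb, hba⟩ := h a fun x hx => (ha _ _).1 (hfO x hx)
    obtain ⟨g, hg, hgb⟩ := exists_continuous_of_isLimitAt hb
    exact ⟨g, hg, fun x hx => (ha _ _).2 (hba x hx _ (hgb x hx))⟩

theorem rep_stallings : Rep M fun f : M.RealFun => f.Stallings := by
  simp only [RealFun.stallings_iff]
  refine .forall_one (.imp (.forall_real (.imp ?_ ?_)) (.exists_one (.and (.forall_real (.imp ?_
    (.exists_real ?_))) (.forall_real (.imp ?_ (.forall_real (.imp ?_ ?_)))))))
  all_goals fun_prop

/-! ### From `(∃³)` to decision functionals -/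

theorem rep_holds : ∀ P : DecidedProperty, Rep M fun f : M.RealFun => P.Holds f
  | .stallings => rep_stallings
  | .continuous => rep_continuous
  | .continuousAE => rep_continuousAE
  | .riemannIntegrable => rep_riemannIntegrable
  | .intermediateValue => rep_intermediateValue

/-- In the presence of `(∃³)` there is a functional that decides `P` for all functions. -/
theorem exists_decides (P : DecidedProperty) :
    ∃ Ξ : M.RealFunctional, ∀ Γ : WeakContinuity, Ξ.Decides P Γ := by
  classical
  obtain ⟨G, hG⟩ := (rep_holds (M := M) P).exists_char
  let D : M.El (arr one one) → Prop := fun F => M.app (τ := nat) G F = 0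
  have hD : ∀ f : M.RealFun, D f.val ↔ P.Holds f := fun f => hG f.val f rfl
  have hDrep : Rep M D := Rep.eq (Rep.app (Rep.const G) Rep.id') (Rep.const _)
  have hrep : Rep M fun F : M.El (arr one one) =>
      codeSeq fun _ => if D F then (0 : Frac M) else 1 := by fun_prop
  have happ : ∀ f : M.RealFun, lam (fun F : M.El (arr one one) =>
      codeSeq fun _ => if D F then (0 : Frac M) else 1) f.val =
      if P.Holds f then (ofFrac (M := M) 0 one_pos).1 else (ofFrac (M := M) 1 one_pos).1 := by
    intro f
    rw [Rep.lam_app hrep]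
    simp only [hD]
    split_ifs <;> rfl
  let Ξ : M.RealFunctional :=
    { val := lam fun F : M.El (arr one one) => codeSeq fun _ => if D F then (0 : Frac M) else 1
      isReal := fun f => by
        rw [happ]
        split_ifs
        exacts [(ofFrac _ _).2, (ofFrac _ _).2]
      ext := fun f g h => by
        have e := DecidedProperty.holds_congr (fun x => Reals.eq_iff.1 (h x)) P
        refine Reals.eq_iff.2 (congrArg Reals.val (Subtype.ext ?_))
        simp only [happ, e] }
  refine ⟨Ξ, fun Γ f _ => ?_⟩
  have hval : (Ξ.at f).val = if P.Holds f then 0 else 1 := by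
    have h : ∀ y : M.Reals, Ξ.val f.val = y.1 → (Ξ.at f).val = y.val := fun y h =>
      congrArg Reals.val (Subtype.ext h)
    split_ifs with hP
    · rw [h (ofFrac 0 one_pos) ((happ f).trans (if_pos hP)), val_ofFrac, Frac.real_zero]
    · rw [h (ofFrac 1 one_pos) ((happ f).trans (if_neg hP)), val_ofFrac, Frac.real_one]
  rw [limEq_iff (Ξ.at f).isCauchy .zero, limit_zero]
  change (Ξ.at f).val = 0 ↔ _
  rw [hval]
  split_ifs with hP <;> simp [hP]

end TypeStructure

theorem theorem2p5 (M : TypeStructure.{u}) (hM : M.ModelsRCA0omega)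
    (Γ : TypeStructure.WeakContinuity) (P : TypeStructure.DecidedProperty) :
    M.KleeneE3 ↔ (M.KleeneE2 ∧ ∃ Ξ : M.RealFunctional, Ξ.Decides P Γ) := by
  have : TypeStructure.IsModel M := ⟨hM⟩
  constructor
  · intro h
    have : TypeStructure.HasE3 M := ⟨h⟩
    have : TypeStructure.HasE2 M := ⟨h.kleeneE2⟩
    obtain ⟨Ξ, hΞ⟩ := TypeStructure.exists_decides (M := M) P
    exact ⟨h.kleeneE2, Ξ, hΞ Γ⟩
  · rintro ⟨h, Ξ, hΞ⟩
    have : TypeStructure.HasE2 M := ⟨h⟩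
    exact hΞ.kleeneE3
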